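/- Let $d\ge 1$ and let $P\subset\mathbb R^d$ be a reflexive polytope with respect to the lattice $\mathbb Z^d$: $P$ is a polytope with $0$ in its interior, its vertices are primitive points of $\mathbb Z^d$, and all vertices of the dual polytope $P^*=\{y\in\mathbb R^d : \langle x,y\rangle\ge -1 \text{ for all } x\in P\}$ lie in $\mathbb Z^d$. Suppose that $P$ is simplicial (every facet is a simplex) and that $P^*$ has a vertex $u$ with $-u\in P^*$. Let $\mathcal V(P)$ be the set of vertices of $P$, and let $X$ be the toric variety over $\mathbb C$ of the fan $\Sigma_P$ whose cones are the positive hulls of the proper faces of $P$ (including $\emptyset$), i.e. $X$ is glued from the affine varieties $\operatorname{Spec}\mathbb C[\sigma^\vee\cap\mathbb Z^d]$, $\sigma\in\Sigma_P$, along those of common faces. Let $\mathcal Z_2=\operatorname{conv}\big([0,1]^2\cup -[0,1]^2\big)\subset\mathbb R^2$, and let $S_3$ be the toric surface over $\mathbb C$ of the fan $\Sigma_{\mathcal Z_2}$. 1. If $d$ is even, then $|\mathcal V(P)|\le 3d$. Moreover $|\mathcal V(P)|=3d$ if and only if $P^*\cong(\mathcal Z_2)^{d/2}$, i.e. there is an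 isomorphism of lattices $\mathbb Z^d\to(\mathbb Z^2)^{d/2}$ whose real extension maps $P^*$ onto $(\mathcal Z_2)^{d/2}$; and $|\mathcal V(P)|=3d$ if and only if $X\cong(S_3)^{d/2}$ as schemes over $\mathbb C$, where $(S_3)^{d/2}$ is the $d/2$-fold product over $\mathbb C$. 2. If $d$ is odd, then $|\mathcal V(P)|\le 3d-1$. -/

import Mathlib

open CategoryTheory CategoryTheory.Limits AlgebraicGeometry
open scoped NNReal Pointwise

noncomputable section

namespace ToricFano

/-! ## Lattice points and polytopes in `ℝ^ι`

The lattices `M` and `N` are both `ℤ^ι`, embedded in `M_ℝ = N_ℝ = ℝ^ι`, and the pairing between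
them is the dot product. -/

/-- The inclusion of the lattice `ℤ^ι` into `ℝ^ι`. -/
def intVec {ι : Type} (n : ι → ℤ) : ι → ℝ := fun i => (n i : ℝ)

/-- The set of lattice points of `ℝ^ι`. -/
def latticePoints (ι : Type) : Set (ι → ℝ) := Set.range intVec

/-- A polytope is the convex hull of finitely many points. -/
def IsPolytope {ι : Type} (P : Set (ι → ℝ)) : Prop :=
  ∃ S : Finset (ι → ℝ), P = convexHull ℝ (S : Set (ι → ℝ))

/-- The vertices of a polytope. -/
def vertices {ι : Type} (P : Set (ι → ℝ)) : Set (ι → ℝ) := P.extremePoints ℝ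

/-- A face of a polytope: a convex subset that contains both end points of every segment in `P`
one of whose inner points it contains. The empty set and `P` itself are faces. -/
def IsFace {ι : Type} (P F : Set (ι → ℝ)) : Prop := IsExtreme ℝ P F ∧ Convex ℝ F

/-- A facet: a nonempty face of dimension `d - 1`, where `d` is the dimension of the space. -/
def IsFacet {ι : Type} [Fintype ι] (P F : Set (ι → ℝ)) : Prop :=
  IsFace P F ∧ F.Nonempty ∧ Module.finrank ℝ (vectorSpan ℝ F) + 1 = Fintype.card ι

/-- A simplex: the convex hull of finitely many affinely independent points. -/
def IsSimplex {ι : Type} (F : Set (ι → ℝ)) : Prop :=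
  ∃ S : Finset (ι → ℝ), AffineIndependent ℝ ((↑) : S → (ι → ℝ)) ∧
    F = convexHull ℝ (S : Set (ι → ℝ))

/-- A full-dimensional polytope is simplicial if every facet is a simplex. -/
def IsSimplicial {ι : Type} [Fintype ι] (P : Set (ι → ℝ)) : Prop :=
  ∀ F, IsFacet P F → IsSimplex F

/-- A lattice polytope: a polytope whose vertices are lattice points. -/
def IsLatticePolytope {ι : Type} (P : Set (ι → ℝ)) : Prop :=
  IsPolytope P ∧ vertices P ⊆ latticePoints ι

/-- A lattice point is primitive if it is not a multiple `k • w` of a lattice point `w`, except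
with `k = 1` or `k = -1`; in particular `0` is not primitive. -/
def IsPrimitive {ι : Type} (n : ι → ℤ) : Prop :=
  ∀ (k : ℤ) (w : ι → ℤ), n = k • w → IsUnit k

/-- A Fano polytope: a lattice polytope with the origin in its interior (hence of full dimension)
whose vertices are primitive lattice points. -/
def IsFanoPolytope {ι : Type} (P : Set (ι → ℝ)) : Prop :=
  IsLatticePolytope P ∧ (0 : ι → ℝ) ∈ interior P ∧
    ∀ n : ι → ℤ, intVec n ∈ vertices P → IsPrimitive n

/-- The dual polytope `P* = {y : ⟨x, y⟩ ≥ -1 for all x ∈ P}`. -/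
def dual {ι : Type} [Fintype ι] (P : Set (ι → ℝ)) : Set (ι → ℝ) :=
  {y | ∀ x ∈ P, -1 ≤ x ⬝ᵥ y}

/-- A reflexive polytope: a Fano polytope whose dual is a lattice polytope. -/
def IsReflexive {ι : Type} [Fintype ι] (P : Set (ι → ℝ)) : Prop :=
  IsFanoPolytope P ∧ IsLatticePolytope (dual P)

/-- Isomorphism of lattice polytopes: an isomorphism of the lattices whose real extension maps
one polytope onto the other. -/
def LatticeIso {ι κ : Type} (P : Set (ι → ℝ)) (Q : Set (κ → ℝ)) : Prop :=
  ∃ (e : (ι → ℤ) ≃ₗ[ℤ] (κ → ℤ)) (f : (ι → ℝ) ≃ₗ[ℝ] (κ → ℝ)),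
    (∀ n, f (intVec n) = intVec (e n)) ∧ f '' P = Q

/-- The hexagon `Z₂ = conv([0,1]² ∪ -[0,1]²)`. -/
def Z2 : Set (Fin 2 → ℝ) := convexHull ℝ (Set.Icc 0 1 ∪ -Set.Icc 0 1)

/-- The `k`-fold product `(Z₂)^k` in `(ℝ²)^k`. -/
def Z2pow (k : ℕ) : Set (Fin k × Fin 2 → ℝ) := {x | ∀ i, (fun j => x (i, j)) ∈ Z2}

/-! ## Rational polyhedral cones and their faces -/

section Cones

variable {ι : Type} [Fintype ι]

/-- The pairing of a point of `M_ℝ` with a point of the lattice `N`, linear in the first. -/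
def pairing (m : ι → ℤ) : (ι → ℝ) →ₗ[ℝ≥0] ℝ where
  toFun x := x ⬝ᵥ intVec m
  map_add' x y := add_dotProduct x y _
  map_smul' c x := by
    simp only [NNReal.smul_def, smul_dotProduct, RingHom.id_apply]

theorem pairing_add (m n : ι → ℤ) (x : ι → ℝ) :
    pairing (m + n) x = pairing m x + pairing n x := by
  change x ⬝ᵥ intVec (m + n) = x ⬝ᵥ intVec m + x ⬝ᵥ intVec n
  rw [← dotProduct_add]
  congr 1
  ext i
  simp [intVec]

theorem pairing_zero (x : ι → ℝ) : pairing (0 : ι → ℤ) x = 0 := by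
  change x ⬝ᵥ intVec 0 = 0
  simp [intVec, dotProduct]

theorem pairing_nsmul (k : ℕ) (m : ι → ℤ) (x : ι → ℝ) :
    pairing (k • m) x = k * pairing m x := by
  induction k with
  | zero => simp [pairing_zero]
  | succ k ih => rw [succ_nsmul, pairing_add, ih]; push_cast; ring

/-- A rational polyhedral cone: a cone generated by finitely many lattice points. -/
structure RationalCone (ι : Type) where
  carrier : PointedCone ℝ (ι → ℝ)
  fg : ∃ S : Finset (ι → ℤ), carrier = PointedCone.hull ℝ (intVec '' (S : Set (ι → ℤ)))

/-- The monoid `σ^∨ ∩ N` of lattice points of the dual cone. -/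
def RationalCone.dualMonoid (σ : RationalCone ι) : AddSubmonoid (ι → ℤ) where
  carrier := {m | ∀ x ∈ σ.carrier, 0 ≤ pairing m x}
  zero_mem' x _ := by rw [pairing_zero]
  add_mem' {a b} ha hb x hx := by rw [pairing_add]; exact add_nonneg (ha x hx) (hb x hx)

theorem RationalCone.mem_dualMonoid {σ : RationalCone ι} {m : ι → ℤ} :
    m ∈ σ.dualMonoid ↔ ∀ x ∈ σ.carrier, 0 ≤ pairing m x := Iff.rfl

theorem RationalCone.mem_dualMonoid_of_gen {σ : RationalCone ι} {s : Set (ι → ℝ)}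
    (hs : σ.carrier = PointedCone.hull ℝ s) {m : ι → ℤ} (h : ∀ x ∈ s, 0 ≤ pairing m x) :
    m ∈ σ.dualMonoid := by
  intro x hx
  rw [hs] at hx
  induction hx using Submodule.span_induction with
  | mem x hx => exact h x hx
  | zero => simp
  | add x y _ _ hx hy => rw [map_add]; exact add_nonneg hx hy
  | smul c x _ hx => rw [map_smul]; exact smul_nonneg c.2 hx

/-- `τ.IsFaceBy σ m`: the cone `τ` is the face `σ ∩ m^⊥` cut out by `m ∈ σ^∨ ∩ N`. -/
def RationalCone.IsFaceBy (τ σ : RationalCone ι) (m : ι → ℤ) : Prop :=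
  m ∈ σ.dualMonoid ∧ ∀ x, x ∈ τ.carrier ↔ x ∈ σ.carrier ∧ pairing m x = 0

/-- If `τ = σ ∩ m^⊥`, then `w + k m ∈ σ^∨` for all `w ∈ τ^∨` and large `k`. -/
theorem RationalCone.IsFaceBy.exists_add_mem {τ σ : RationalCone ι} {m : ι → ℤ}
    (h : τ.IsFaceBy σ m) {w : ι → ℤ} (hw : w ∈ τ.dualMonoid) :
    ∃ k : ℕ, ∀ l : ℕ, k ≤ l → w + l • m ∈ σ.dualMonoid := by
  classical
  obtain ⟨S, hS⟩ := σ.fg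
  have hgen : ∀ s ∈ S, intVec s ∈ σ.carrier := fun s hs => by
    rw [hS]; exact Submodule.subset_span ⟨s, hs, rfl⟩
  have key : ∀ s : ι → ℤ, ∃ k : ℕ, s ∈ S → ∀ l : ℕ, k ≤ l →
      0 ≤ pairing w (intVec s) + l * pairing m (intVec s) := by
    intro s
    by_cases hs : s ∈ S
    · rcases (h.1 _ (hgen s hs)).eq_or_lt with h0 | h0
      · refine ⟨0, fun _ l _ => ?_⟩
        rw [← h0]
        simpa using hw _ ((h.2 _).2 ⟨hgen s hs, h0.symm⟩)
      · obtain ⟨k, hk⟩ := exists_nat_ge (-pairing w (intVec s) / pairing m (intVec s))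
        refine ⟨k, fun _ l hl => ?_⟩
        rw [div_le_iff₀ h0] at hk
        have : (k : ℝ) * pairing m (intVec s) ≤ l * pairing m (intVec s) := by gcongr
        linarith
    · exact ⟨0, fun h => absurd h hs⟩
  choose k hk using key
  refine ⟨S.sup k, fun l hl => mem_dualMonoid_of_gen hS ?_⟩
  rintro _ ⟨s, hs, rfl⟩
  rw [pairing_add, pairing_nsmul]
  exact hk s hs l ((Finset.le_sup hs).trans hl)

/-- Rational polyhedral cones are ordered by the relation of being a face. -/
instance : Preorder (RationalCone ι) where
  le τ σ := ∃ m, τ.IsFaceBy σ m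
  le_refl σ := ⟨0, σ.dualMonoid.zero_mem, fun x => by simp [pairing_zero]⟩
  le_trans := by
    rintro ρ τ σ ⟨n, hn⟩ ⟨m, hm⟩
    obtain ⟨k, hk⟩ := hm.exists_add_mem hn.1
    refine ⟨n + (k + 1) • m, hk _ (Nat.le_succ k), fun x => ?_⟩
    rw [hn.2, hm.2, and_assoc]
    refine and_congr_right fun hx => ?_
    constructor
    · rintro ⟨h1, h2⟩
      rw [pairing_add, pairing_nsmul, h1, h2, mul_zero, add_zero]
    · intro h
      have h1 := hk k le_rfl x hx
      have h2 := hm.1 x hx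
      rw [pairing_add, pairing_nsmul] at h h1
      push_cast at h
      have h3 : pairing m x = 0 := by linarith
      refine ⟨h3, ?_⟩
      rw [h3] at h
      linarith

theorem RationalCone.le_def {τ σ : RationalCone ι} : τ ≤ σ ↔ ∃ m, τ.IsFaceBy σ m := Iff.rfl

theorem RationalCone.dualMonoid_mono {τ σ : RationalCone ι} (h : τ ≤ σ) :
    σ.dualMonoid ≤ τ.dualMonoid := by
  obtain ⟨m, hm⟩ := h
  exact fun n hn x hx => hn x ((hm.2 x).1 hx).1

theorem hull_inter_eq_zero {s : Set (ι → ℝ)} {m : ι → ℤ} (h : ∀ x ∈ s, 0 ≤ pairing m x)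
    (x : ι → ℝ) : x ∈ PointedCone.hull ℝ {y ∈ s | pairing m y = 0} ↔
      x ∈ PointedCone.hull ℝ s ∧ pairing m x = 0 := by
  have hnn : ∀ x ∈ PointedCone.hull ℝ s, 0 ≤ pairing m x := by
    intro x hx
    induction hx using Submodule.span_induction with
    | mem x hx => exact h x hx
    | zero => simp
    | add x y _ _ hx hy => rw [map_add]; exact add_nonneg hx hy
    | smul c x _ hx => rw [map_smul]; exact smul_nonneg c.2 hx
  constructor
  · intro hx
    refine ⟨Submodule.span_mono (fun y hy => hy.1) hx, ?_⟩
    induction hx using Submodule.span_induction with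
    | mem x hx => exact hx.2
    | zero => simp
    | add x y _ _ hx hy => rw [map_add, hx, hy, add_zero]
    | smul c x _ hx => rw [map_smul, hx, smul_zero]
  · rintro ⟨hx, h0⟩
    induction hx using Submodule.span_induction with
    | mem x hx => exact Submodule.subset_span ⟨hx, h0⟩
    | zero => exact Submodule.zero_mem _
    | add x y hx' hy' hx hy =>
      rw [map_add] at h0
      have h1 := hnn x hx'
      have h2 := hnn y hy'
      exact Submodule.add_mem _ (hx (by linarith)) (hy (by linarith))
    | smul c x hx' hx =>
      rw [map_smul, smul_eq_zero] at h0
      rcases h0 with rfl | h0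
      · rw [zero_smul]; exact Submodule.zero_mem _
      · exact Submodule.smul_mem _ _ (hx h0)

/-- The face `σ ∩ m^⊥`. -/
def RationalCone.faceBy (σ : RationalCone ι) (m : ι → ℤ) (hm : m ∈ σ.dualMonoid) :
    RationalCone ι where
  carrier := PointedCone.hull ℝ {y | y ∈ σ.carrier ∧ pairing m y = 0}
  fg := by
    classical
    obtain ⟨S, hS⟩ := σ.fg
    refine ⟨S.filter fun s => pairing m (intVec s) = 0, ?_⟩
    have hm' : ∀ x ∈ intVec '' (S : Set (ι → ℤ)), 0 ≤ pairing m x := fun x hx =>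
      hm x (by rw [hS]; exact Submodule.subset_span hx)
    ext x
    have e : intVec '' ((S.filter fun s => pairing m (intVec s) = 0 : Finset _) : Set (ι → ℤ))
        = {y ∈ intVec '' (S : Set (ι → ℤ)) | pairing m y = 0} := by
      ext y
      simp only [Finset.coe_filter, Set.mem_image, Set.mem_ofPred_eq, Finset.mem_coe]
      constructor
      · rintro ⟨s, ⟨h1, h2⟩, rfl⟩; exact ⟨⟨s, h1, rfl⟩, h2⟩
      · rintro ⟨⟨s, h1, rfl⟩, h2⟩; exact ⟨s, ⟨h1, h2⟩, rfl⟩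
    rw [e, hull_inter_eq_zero hm', ← hS]
    exact (hull_inter_eq_zero (s := (σ.carrier : Set (ι → ℝ))) hm x).trans
      (by rw [PointedCone.hull, Submodule.span_eq])

theorem RationalCone.isFaceBy_faceBy (σ : RationalCone ι) (m : ι → ℤ) (hm : m ∈ σ.dualMonoid) :
    (σ.faceBy m hm).IsFaceBy σ m :=
  ⟨hm, fun x => (hull_inter_eq_zero (s := (σ.carrier : Set (ι → ℝ))) hm x).trans
    (by rw [PointedCone.hull, Submodule.span_eq])⟩

/-- A set of rational polyhedral cones that is closed under taking faces. (A fan is such a set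
that is finite, consists of strongly convex cones, and in which any two cones intersect in a
common face; these further properties are not needed to glue the affine charts.) -/
structure ConeSystem (ι : Type) [Fintype ι] where
  cones : Set (RationalCone ι)
  face_mem : ∀ {τ σ : RationalCone ι}, τ ≤ σ → σ ∈ cones → τ ∈ cones

/-- The fan `Σ_P = {pos(F) : F a proper face of P}` spanned by a lattice polytope `P` with
`0 ∈ int P`. The empty face gives the cone `{0}`. -/
def spannedFan (P : Set (ι → ℝ)) : ConeSystem ι where
  cones := {σ | ∃ F, IsFace P F ∧ F ≠ P ∧ σ.carrier = PointedCone.hull ℝ F}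
  face_mem := by
    rintro τ σ ⟨m, hm⟩ ⟨F, hF, hne, hσ⟩
    have hF0 : ∀ x ∈ F, 0 ≤ pairing m x := fun x hx =>
      hm.1 x (by rw [hσ]; exact Submodule.subset_span hx)
    have hsub : {x ∈ F | pairing m x = 0} ⊆ F := fun x hx => hx.1
    have hlin : ∀ (a : ℝ) (x : ι → ℝ), pairing m (a • x) = a * pairing m x := fun a x => by
      change (a • x) ⬝ᵥ intVec m = a * (x ⬝ᵥ intVec m)
      rw [smul_dotProduct, smul_eq_mul]
    refine ⟨{x ∈ F | pairing m x = 0}, ⟨hF.1.trans ⟨hsub, ?_⟩, ?_⟩, ?_, ?_⟩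
    · rintro x hx y hy z ⟨_, hz⟩ ⟨a, b, ha, hb, _, rfl⟩
      refine ⟨hx, ?_⟩
      have h1 := hF0 x hx
      have h2 := hF0 y hy
      rw [map_add, hlin, hlin] at hz
      have h3 := mul_nonneg ha.le h1
      have h4 := mul_nonneg hb.le h2
      have h5 : a * pairing m x = 0 := by linarith
      exact (mul_eq_zero.1 h5).resolve_left ha.ne'
    · rintro x ⟨hx, hx0⟩ y ⟨hy, hy0⟩ a b ha hb hab
      refine ⟨hF.2 hx hy ha hb hab, ?_⟩
      rw [map_add, hlin, hlin, hx0, hy0, mul_zero, mul_zero, add_zero]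
    · intro h
      exact hne (Set.Subset.antisymm hF.1.1 (h ▸ hsub))
    · ext x
      rw [hm.2, hull_inter_eq_zero hF0, hσ]

/-! ## Toric varieties over `ℂ` -/

/-- The coordinate ring `ℂ[σ^∨ ∩ N]` of the affine toric variety of a cone `σ`. -/
abbrev RationalCone.Ring (σ : RationalCone ι) : Type := AddMonoidAlgebra ℂ σ.dualMonoid

/-- For a face `τ` of `σ`, the inclusion `ℂ[σ^∨ ∩ N] → ℂ[τ^∨ ∩ N]`. -/
def RationalCone.ringMap {τ σ : RationalCone ι} (h : τ ≤ σ) : σ.Ring →ₐ[ℂ] τ.Ring :=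
  AddMonoidAlgebra.mapDomainAlgHom ℂ ℂ (AddSubmonoid.inclusion (dualMonoid_mono h))

theorem RationalCone.ringMap_single {τ σ : RationalCone ι} (h : τ ≤ σ) (n : σ.dualMonoid) (c : ℂ) :
    ringMap h (AddMonoidAlgebra.single n c) =
      AddMonoidAlgebra.single (⟨n.1, dualMonoid_mono h n.2⟩ : τ.dualMonoid) c :=
  AddMonoidAlgebra.mapDomain_single

theorem RationalCone.ringMap_id (σ : RationalCone ι) :
    ringMap (le_refl σ) = AlgHom.id ℂ σ.Ring :=
  AddMonoidAlgebra.mapDomainAlgHom_id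

theorem RationalCone.ringMap_comp {ρ τ σ : RationalCone ι} (h : ρ ≤ τ) (h' : τ ≤ σ) :
    ringMap (h.trans h') = (ringMap h).comp (ringMap h') :=
  AddMonoidAlgebra.mapDomainAlgHom_comp (AddSubmonoid.inclusion (dualMonoid_mono h'))
    (AddSubmonoid.inclusion (dualMonoid_mono h))

theorem RationalCone.ringMap_injective {τ σ : RationalCone ι} (h : τ ≤ σ) :
    Function.Injective (ringMap h) :=
  AddMonoidAlgebra.mapDomain_injective (AddSubmonoid.inclusion_injective _)

/-- If `τ = σ ∩ m^⊥`, then `ℂ[τ^∨ ∩ N]` is the localization of `ℂ[σ^∨ ∩ N]` at `χ^m`. -/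
theorem RationalCone.IsFaceBy.isLocalization {τ σ : RationalCone ι} {m : ι → ℤ}
    (hm : τ.IsFaceBy σ m) :
    letI := (ringMap ⟨m, hm⟩ : σ.Ring →ₐ[ℂ] τ.Ring).toRingHom.toAlgebra
    IsLocalization.Away (AddMonoidAlgebra.single (⟨m, hm.1⟩ : σ.dualMonoid) (1 : ℂ)) τ.Ring := by
  have hle : τ ≤ σ := ⟨m, hm⟩
  let := (ringMap hle : σ.Ring →ₐ[ℂ] τ.Ring).toRingHom.toAlgebra
  have hmap : ∀ x : σ.Ring, algebraMap σ.Ring τ.Ring x = ringMap hle x := fun _ => rfl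
  have hneg : -m ∈ τ.dualMonoid := by
    intro x hx
    have h1 := pairing_add (-m) m x
    rw [neg_add_cancel, pairing_zero, ((hm.2 x).1 hx).2, add_zero] at h1
    exact h1.le
  have hpow : ∀ k : ℕ, ringMap hle (AddMonoidAlgebra.single (⟨m, hm.1⟩ : σ.dualMonoid) (1 : ℂ) ^ k)
      = AddMonoidAlgebra.single (k • (⟨m, dualMonoid_mono hle hm.1⟩ : τ.dualMonoid)) (1 : ℂ) := by
    intro k
    rw [map_pow, ringMap_single, AddMonoidAlgebra.single_pow, one_pow]
  have hsurj : ∀ z : τ.Ring, ∃ k : ℕ, ∀ l : ℕ, k ≤ l → ∃ y : σ.Ring, z *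
      ringMap hle (AddMonoidAlgebra.single (⟨m, hm.1⟩ : σ.dualMonoid) (1 : ℂ) ^ l) =
        ringMap hle y := by
    intro z
    induction z using AddMonoidAlgebra.induction_linear with
    | zero => exact ⟨0, fun l _ => ⟨0, by rw [zero_mul, map_zero]⟩⟩
    | add f g hf hg =>
      obtain ⟨k1, h1⟩ := hf
      obtain ⟨k2, h2⟩ := hg
      refine ⟨max k1 k2, fun l hl => ?_⟩
      obtain ⟨y1, e1⟩ := h1 l ((le_max_left _ _).trans hl)
      obtain ⟨y2, e2⟩ := h2 l ((le_max_right _ _).trans hl)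
      exact ⟨y1 + y2, by rw [add_mul, e1, e2, map_add]⟩
    | single n c =>
      obtain ⟨k, hk⟩ := hm.exists_add_mem n.2
      refine ⟨k, fun l hl => ⟨AddMonoidAlgebra.single ⟨_, hk l hl⟩ c, ?_⟩⟩
      rw [hpow, AddMonoidAlgebra.single_mul_single, mul_one, ringMap_single]
      rfl
  refine { map_units := ?_, surj := ?_, exists_of_eq := ?_ }
  · rintro ⟨_, k, rfl⟩
    change IsUnit (algebraMap σ.Ring τ.Ring (_ ^ k))
    rw [map_pow]
    refine IsUnit.pow _ ?_
    rw [hmap, ringMap_single]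
    refine IsUnit.of_mul_eq_one (AddMonoidAlgebra.single (⟨-m, hneg⟩ : τ.dualMonoid) (1 : ℂ)) ?_
    rw [AddMonoidAlgebra.single_mul_single, mul_one, AddMonoidAlgebra.one_def]
    congr 1
    exact Subtype.ext (add_neg_cancel m)
  · intro z
    obtain ⟨k, hk⟩ := hsurj z
    obtain ⟨y, hy⟩ := hk k le_rfl
    exact ⟨⟨y, ⟨_, k, rfl⟩⟩, hy⟩
  · intro x y hxy
    exact ⟨1, by rw [ringMap_injective hle hxy]⟩

/-- The base `Spec ℂ`. -/
abbrev SpecC : Scheme.{0} := Spec (CommRingCat.of ℂ)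

/-- The affine toric variety `Spec ℂ[σ^∨ ∩ N]`, as a scheme over `ℂ`. -/
def RationalCone.affine (σ : RationalCone ι) : Over SpecC :=
  Over.mk (Spec.map (CommRingCat.ofHom (algebraMap ℂ σ.Ring)))

/-- For a face `τ` of `σ`, the morphism `Spec ℂ[τ^∨ ∩ N] → Spec ℂ[σ^∨ ∩ N]` over `ℂ`. -/
def RationalCone.affineMap {τ σ : RationalCone ι} (h : τ ≤ σ) : τ.affine ⟶ σ.affine :=
  Over.homMk (Spec.map (CommRingCat.ofHom (ringMap h).toRingHom)) (by
    change Spec.map _ ≫ Spec.map _ = Spec.map _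
    rw [← Spec.map_comp, ← CommRingCat.ofHom_comp]
    congr 2
    exact (ringMap h).comp_algebraMap)

instance {τ σ : RationalCone ι} (h : τ ≤ σ) : IsOpenImmersion (RationalCone.affineMap h).left := by
  obtain ⟨m, hm⟩ := h
  let := (RationalCone.ringMap ⟨m, hm⟩ : σ.Ring →ₐ[ℂ] τ.Ring).toRingHom.toAlgebra
  have := hm.isLocalization
  exact IsOpenImmersion.of_isLocalization (S := τ.Ring)
    (AddMonoidAlgebra.single (⟨m, hm.1⟩ : σ.dualMonoid) (1 : ℂ))

/-- The diagram of the affine toric varieties of the cones of a system, with the open immersions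
given by the faces. -/
def ConeSystem.diagram (C : ConeSystem ι) : C.cones ⥤ Over SpecC where
  obj σ := σ.1.affine
  map f := RationalCone.affineMap (leOfHom f)
  map_id σ := by
    ext1
    change Spec.map (CommRingCat.ofHom _) = 𝟙 _
    rw [← Spec.map_id]
    congr 1
    ext1
    exact congrArg AlgHom.toRingHom (RationalCone.ringMap_id σ.1)
  map_comp f g := by
    ext1
    change Spec.map (CommRingCat.ofHom _) = Spec.map _ ≫ Spec.map _
    rw [← Spec.map_comp, ← CommRingCat.ofHom_comp]
    congr 2
    exact congrArg AlgHom.toRingHom (RationalCone.ringMap_comp (leOfHom f) (leOfHom g))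

instance (C : ConeSystem ι) {σ τ : C.cones} (f : σ ⟶ τ) : IsOpenImmersion (C.diagram.map f).left :=
  inferInstanceAs (IsOpenImmersion (RationalCone.affineMap (leOfHom f)).left)

theorem RationalCone.IsFaceBy.range {τ σ : RationalCone ι} {m : ι → ℤ} (hm : τ.IsFaceBy σ m) :
    Set.range (PrimeSpectrum.comap (ringMap (τ := τ) (σ := σ) ⟨m, hm⟩).toRingHom) =
      PrimeSpectrum.basicOpen
        (AddMonoidAlgebra.single (⟨m, hm.1⟩ : σ.dualMonoid) (1 : ℂ)) := by
  let := (RationalCone.ringMap ⟨m, hm⟩ : σ.Ring →ₐ[ℂ] τ.Ring).toRingHom.toAlgebra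
  have := hm.isLocalization
  exact PrimeSpectrum.localization_away_comap_range τ.Ring
    (AddMonoidAlgebra.single (⟨m, hm.1⟩ : σ.dualMonoid) (1 : ℂ))

/-- Two faces `σ ∩ m^⊥` and `σ ∩ n^⊥` of a cone `σ` have the common face `σ ∩ (m + n)^⊥`, and the
corresponding open subsets of the affine toric variety of `σ` intersect in that of this face. -/
instance (C : ConeSystem ι) :
    (C.diagram ⋙ Over.forget SpecC ⋙ Scheme.forget).IsLocallyDirected := by
  constructor
  intro i j k fi fj xi xj hx
  obtain ⟨m, hm⟩ := leOfHom fi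
  obtain ⟨n, hn⟩ := leOfHom fj
  have hmn : m + n ∈ k.1.dualMonoid := k.1.dualMonoid.add_mem hm.1 hn.1
  have hl := k.1.isFaceBy_faceBy (m + n) hmn
  have hmi : (k.1.faceBy (m + n) hmn).IsFaceBy i.1 n := by
    refine ⟨fun x hx => hn.1 x ((hm.2 x).1 hx).1, fun x => ?_⟩
    rw [hl.2, hm.2, pairing_add, and_assoc]
    refine and_congr_right fun hx => ?_
    have h1 := hm.1 x hx
    have h2 := hn.1 x hx
    exact ⟨fun h => ⟨by linarith, by linarith⟩, fun h => by rw [h.1, h.2, add_zero]⟩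
  have hmj : (k.1.faceBy (m + n) hmn).IsFaceBy j.1 m := by
    refine ⟨fun x hx => hm.1 x ((hn.2 x).1 hx).1, fun x => ?_⟩
    rw [hl.2, hn.2, pairing_add, and_assoc]
    refine and_congr_right fun hx => ?_
    have h1 := hm.1 x hx
    have h2 := hn.1 x hx
    exact ⟨fun h => ⟨by linarith, by linarith⟩, fun h => by rw [h.1, h.2, add_zero]⟩
  let l : C.cones := ⟨k.1.faceBy (m + n) hmn, C.face_mem ⟨n, hmi⟩ i.2⟩
  let fli : l ⟶ i := homOfLE ⟨n, hmi⟩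
  let flj : l ⟶ j := homOfLE ⟨m, hmj⟩
  let G := C.diagram ⋙ Over.forget SpecC ⋙ Scheme.forget
  have hinj : ∀ {a b : C.cones} (f : a ⟶ b), Function.Injective (G.map f) := fun f =>
    (C.diagram.map f).left.isOpenEmbedding.injective
  have hxi : (G.map fi xi : PrimeSpectrum k.1.Ring) ∈ PrimeSpectrum.basicOpen
      (AddMonoidAlgebra.single (⟨m, hm.1⟩ : k.1.dualMonoid) (1 : ℂ)) :=
    hm.range.subset ⟨xi, rfl⟩
  have hxj : (G.map fi xi : PrimeSpectrum k.1.Ring) ∈ PrimeSpectrum.basicOpen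
      (AddMonoidAlgebra.single (⟨n, hn.1⟩ : k.1.dualMonoid) (1 : ℂ)) := by
    have : G.map fi xi = G.map fj xj := hx
    rw [this]
    exact hn.range.subset ⟨xj, rfl⟩
  have hxl : (G.map fi xi : PrimeSpectrum k.1.Ring) ∈ PrimeSpectrum.basicOpen
      (AddMonoidAlgebra.single (⟨m + n, hmn⟩ : k.1.dualMonoid) (1 : ℂ)) := by
    have e : AddMonoidAlgebra.single (⟨m + n, hmn⟩ : k.1.dualMonoid) (1 : ℂ) =
        AddMonoidAlgebra.single (⟨m, hm.1⟩ : k.1.dualMonoid) (1 : ℂ) *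
          AddMonoidAlgebra.single (⟨n, hn.1⟩ : k.1.dualMonoid) (1 : ℂ) := by
      rw [AddMonoidAlgebra.single_mul_single, one_mul]
      rfl
    rw [e, PrimeSpectrum.basicOpen_mul]
    exact ⟨hxi, hxj⟩
  obtain ⟨x, hx'⟩ := hl.range.superset hxl
  have hx1 : G.map (fli ≫ fi) x = G.map fi xi := hx'
  have hx2 : G.map (flj ≫ fj) x = G.map fj xj := hx'.trans hx
  refine ⟨l, fli, flj, x, hinj fi ?_, hinj fj ?_⟩
  · rw [← hx1, G.map_comp]; rfl
  · rw [← hx2, G.map_comp]; rfl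

/-- The toric variety over `ℂ` of a fan: the affine toric varieties of its cones, glued along the
affine toric varieties of common faces. -/
def toricVariety (C : ConeSystem ι) : Over SpecC := colimit C.diagram

end Cones

/-- The toric surface `S₃`, whose fan is spanned by the hexagon `Z₂`. -/
def S3 : Over SpecC := toricVariety (spannedFan Z2)

/-- The `k`-fold product `(S₃)^k` over `ℂ`. -/
def S3pow (k : ℕ) : Over SpecC := ∏ᶜ fun _ : Fin k => S3

end ToricFano

end

/-! The bound. A vertex `u` of the dual polytope cuts out a facet of P, and every vertex `v` of P
has an integral level ⟨v, u⟩ ≥ -1. Since P is simplicial, exactly d vertices have level -1, and they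
form a basis of the space. A vertex of level 0 lies on one of the d facets adjacent to that of `u`
(`exists_neighbour_mem`), and each adjacent facet has room for only one vertex off the facet of `u`
(`eq_of_mem_neighbour`); so at most d vertices have level 0. Finally choose `u` such that the sum of
all vertices has level ≤ 0 (`exists_le_zero`): level -1 contributes -d to it, hence at most d
vertices have positive level, and there are at most 3d vertices altogether (`card_le`).

Equality. If there are 3d vertices, their sum must be 0, so the count is sharp at every `u` and all
levels are -1, 0 or 1 (`levels_of_card_eq`). Hence P = -P. In the basis given by one facet, a vertex
of level 0 is a difference f - e of two basis vectors, and e ↦ f is an involution without fixed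
points (`exists_involution`). So d is even, which settles the odd case, and P is a free sum of d/2
hexagons, one for each orbit; dually, P* is a power of `Z2`.

Toric varieties. The fan of a free sum is a product fan, whose charts are products of affine toric
varieties; gluing these gives a power of `S3` (`Splitting.nonempty_iso`). For the converse the
number of vertices is to be recovered from the bare scheme. The points of codimension one outside
the torus are among the generic points of the divisors of the rays, and all of these occur if every
ray generator takes the value 1 on some lattice point. An abstract isomorphism need not respect the
torus, so it must be shown that the number of missed points does not depend on the open embedding of
the torus (`ncard_codimOneCompl_torus`). Two embeddings share a common basic open set W, and each of
them makes W the open set b ≠ 0 of an affine space. The number of prime factors of b is the rank of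
the units of W modulo constants; as the constant units are divisible, this rank depends only on W
(`card_eq_of_surjective`). -/

noncomputable section

namespace ToricFano

open scoped Matrix

/-! ### Duality and faces of polytopes. -/

section Convex

theorem exists_dotProduct_eq {ι : Type} [Fintype ι] (f : (ι → ℝ) →ₗ[ℝ] ℝ) :
    ∃ y : ι → ℝ, ∀ x, f x = x ⬝ᵥ y := by
  classical
  refine ⟨fun i => f (Pi.single i 1), fun x => ?_⟩
  conv_lhs => rw [← LinearMap.sum_single_apply (fun _ => ℝ) x]
  rw [map_sum, dotProduct]
  refine Finset.sum_congr rfl fun i _ => ?_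
  have : (LinearMap.single ℝ (fun _ : ι => ℝ) i) (x i) = x i • Pi.single i (1 : ℝ) := by
    ext j
    by_cases h : j = i
    · subst h; simp
    · simp [h]
  rw [Pi.single, ← Pi.single] at *
  simpa using congrArg f this

theorem intVec_injective {ι : Type} : Function.Injective (intVec (ι := ι)) := by
  intro a b h
  ext i
  have := congrFun h i
  simpa [intVec] using this

theorem intVec_dotProduct {ι : Type} [Fintype ι] (a b : ι → ℤ) :
    intVec a ⬝ᵥ intVec b = ((a ⬝ᵥ b : ℤ) : ℝ) := by
  simp [dotProduct, intVec]

/-- A lattice polytope is the convex hull of its finitely many vertices. -/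
theorem IsPolytope.eq_convexHull {ι : Type} [Fintype ι] {P : Set (ι → ℝ)} (hP : IsPolytope P) :
    (vertices P).Finite ∧ P = convexHull ℝ (vertices P) := by
  obtain ⟨S, rfl⟩ := hP
  have hfin : (vertices (convexHull ℝ (S : Set (ι → ℝ)))).Finite :=
    S.finite_toSet.subset extremePoints_convexHull_subset
  refine ⟨hfin, ?_⟩
  have hc : IsCompact (convexHull ℝ (S : Set (ι → ℝ))) := S.finite_toSet.isCompact_convexHull ℝ
  have h := closure_convexHull_extremePoints hc (convex_convexHull ℝ _)
  have : IsClosed (convexHull ℝ ((convexHull ℝ (S : Set (ι → ℝ))).extremePoints ℝ)) :=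
    (hfin.isCompact_convexHull ℝ).isClosed
  rw [vertices, ← this.closure_eq, h]

theorem IsLatticePolytope.exists_finset {ι : Type} [Fintype ι] {P : Set (ι → ℝ)}
    (hP : IsLatticePolytope P) : ∃ V : Finset (ι → ℤ),
      vertices P = intVec '' (V : Set (ι → ℤ)) ∧ P = convexHull ℝ (intVec '' (V : Set (ι → ℤ))) := by
  classical
  obtain ⟨hfin, heq⟩ := hP.1.eq_convexHull
  have hf : (intVec ⁻¹' vertices P).Finite := hfin.preimage intVec_injective.injOn
  have h1 : vertices P = intVec '' (hf.toFinset : Set (ι → ℤ)) := by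
    rw [Set.Finite.coe_toFinset, Set.image_preimage_eq_of_subset hP.2]
  exact ⟨hf.toFinset, h1, by rw [← h1]; exact heq⟩

variable {ι : Type} [Fintype ι]

theorem mem_dual_convexHull {S : Set (ι → ℝ)} {y : ι → ℝ} :
    y ∈ dual (convexHull ℝ S) ↔ ∀ x ∈ S, -1 ≤ x ⬝ᵥ y := by
  constructor
  · exact fun h x hx => h x (subset_convexHull ℝ S hx)
  · intro h x hx
    have hc : Convex ℝ {x : ι → ℝ | -1 ≤ x ⬝ᵥ y} := by
      intro a ha b hb s t hs ht hst
      simp only [Set.mem_ofPred_eq, add_dotProduct, smul_dotProduct, smul_eq_mul] at *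
      nlinarith
    exact convexHull_min (fun x hx => h x hx) hc hx

theorem zero_mem_dual (P : Set (ι → ℝ)) : (0 : ι → ℝ) ∈ dual P := fun x _ => by simp

/-- This is the bipolar theorem. A functional separating a point `x` from P is bounded on P by some
`u`, and `u > 0` because P contains 0; its multiple by -1/u then lies in the dual and is violated by
`x`. -/
theorem dual_dual {P : Set (ι → ℝ)} (hc : Convex ℝ P) (hcl : IsClosed P) (h0 : (0 : ι → ℝ) ∈ P) :
    dual (dual P) = P := by
  ext x
  constructor
  · intro hx
    by_contra hxP
    obtain ⟨f, u, hfu, hux⟩ := geometric_hahn_banach_closed_point hc hcl hxP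
    obtain ⟨y, hy⟩ := exists_dotProduct_eq f.toLinearMap
    have hy' : ∀ x, f x = x ⬝ᵥ y := hy
    have hu : 0 < u := by simpa using hfu 0 h0
    have h1 : (-u⁻¹) • y ∈ dual P := by
      intro z hz
      have := hfu z hz
      rw [hy'] at this
      rw [dotProduct_smul, smul_eq_mul]
      have h2 : u⁻¹ * (z ⬝ᵥ y) ≤ u⁻¹ * u := by gcongr
      rw [inv_mul_cancel₀ hu.ne'] at h2
      linarith
    have h2 := hx _ h1
    rw [smul_dotProduct, smul_eq_mul, dotProduct_comm] at h2
    rw [hy'] at hux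
    have h3 : u⁻¹ * u < u⁻¹ * (x ⬝ᵥ y) := by gcongr
    rw [inv_mul_cancel₀ hu.ne'] at h3
    linarith
  · intro hx y hy
    rw [dotProduct_comm]
    exact hy x hx

theorem ne_zero_exists_neg {P : Set (ι → ℝ)} (h0 : (0 : ι → ℝ) ∈ interior P) {y : ι → ℝ}
    (hy : y ≠ 0) : ∃ x ∈ P, x ⬝ᵥ y < 0 := by
  have hcont : Continuous fun t : ℝ => t • y := by fun_prop
  have : ∀ᶠ t in nhds (0 : ℝ), t • y ∈ interior P := by
    refine hcont.continuousAt.eventually_mem ?_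
    rw [zero_smul]
    exact isOpen_interior.mem_nhds h0
  obtain ⟨ε, hε, h⟩ := Metric.eventually_nhds_iff.1 this
  refine ⟨(-(ε / 2)) • y, interior_subset (h ?_), ?_⟩
  · rw [Real.dist_eq, sub_zero, abs_neg, abs_of_pos (by linarith)]; linarith
  · rw [smul_dotProduct, smul_eq_mul]
    have : 0 < y ⬝ᵥ y := by
      have h1 : 0 ≤ y ⬝ᵥ y := Finset.sum_nonneg fun i _ => mul_self_nonneg _
      refine lt_of_le_of_ne h1 fun h2 => hy (dotProduct_self_eq_zero.1 h2.symm)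
    nlinarith

theorem dotProduct_convexHull_neg {S : Set (ι → ℝ)} (h0 : (0 : ι → ℝ) ∈ interior (convexHull ℝ S))
    {y : ι → ℝ} (hy : y ≠ 0) : ∃ x ∈ S, x ⬝ᵥ y < 0 := by
  by_contra! h
  obtain ⟨x, hx, hx'⟩ := ne_zero_exists_neg h0 hy
  have hc : Convex ℝ {x : ι → ℝ | 0 ≤ x ⬝ᵥ y} := by
    intro a ha b hb s t hs ht hst
    simp only [Set.mem_ofPred_eq, add_dotProduct, smul_dotProduct, smul_eq_mul] at *
    positivity
  have := convexHull_min (fun x hx => h x hx) hc hx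
  exact absurd hx' (not_lt.2 this)

/-- The face of `P` on which `y ∈ P*` is minimal. -/
theorem isFace_of_mem_dual {P : Set (ι → ℝ)} (hP : Convex ℝ P) {y : ι → ℝ} (hy : y ∈ dual P) :
    IsFace P {x ∈ P | x ⬝ᵥ y = -1} := by
  refine ⟨⟨fun x hx => hx.1, ?_⟩, ?_⟩
  · rintro a ha b hb z ⟨_, hz⟩ ⟨s, t, hs, ht, hst, rfl⟩
    refine ⟨ha, ?_⟩
    have h1 := hy a ha
    have h2 := hy b hb
    simp only [add_dotProduct, smul_dotProduct, smul_eq_mul] at hz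
    nlinarith
  · rintro a ⟨ha, ha'⟩ b ⟨hb, hb'⟩ s t hs ht hst
    refine ⟨hP ha hb hs ht hst, ?_⟩
    simp only [add_dotProduct, smul_dotProduct, smul_eq_mul, ha', hb']
    linarith

-- The complement of a face in the polytope is convex. A point of F is therefore on a segment from
-- the hull of the generators in F to a point outside F, and extremality forces it to be the first
-- end point.
omit [Fintype ι] in
theorem IsFace.eq_convexHull {S : Set (ι → ℝ)} {F : Set (ι → ℝ)}
    (hF : IsFace (convexHull ℝ S) F) : F = convexHull ℝ (S ∩ F) := by
  refine Set.Subset.antisymm (fun x hx => ?_)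
    (convexHull_min Set.inter_subset_right hF.2)
  have hconv := hF.1.convex_sdiff (convex_convexHull ℝ S)
  have hB : convexHull ℝ (S \ F) ⊆ convexHull ℝ S \ F :=
    convexHull_min (fun y hy => ⟨subset_convexHull ℝ S hy.1, hy.2⟩) hconv
  have hA : convexHull ℝ (S ∩ F) ⊆ F := convexHull_min Set.inter_subset_right hF.2
  have hxS := hF.1.1 hx
  rcases (S \ F).eq_empty_or_nonempty with h | hne
  · rwa [Set.inter_eq_left.2 (Set.sdiff_eq_empty.1 h)]
  rcases (S ∩ F).eq_empty_or_nonempty with h | hne'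
  · have : S \ F = S := by
      ext y; exact ⟨fun h => h.1, fun hy => ⟨hy, fun hyF => by
        have : y ∈ S ∩ F := ⟨hy, hyF⟩
        rw [h] at this; exact this⟩⟩
    rw [this] at hB
    exact absurd hx (hB hxS).2
  rw [← Set.inter_union_sdiff S F, convexHull_union hne' hne, mem_convexJoin] at hxS
  obtain ⟨a, ha, b, hb, hab⟩ := hxS
  rw [← insert_endpoints_openSegment] at hab
  rcases hab with rfl | rfl | hab
  · exact ha
  · exact absurd hx (hB hb).2
  · exact absurd (hF.1.right_mem_of_mem_openSegment (hF.1.1 (hA ha)) (hB hb).1 hx hab) (hB hb).2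

/-- Every proper face of a polytope with the origin in its interior is cut out by a point of the
dual polytope. -/
theorem IsFace.exists_dual {S : Set (ι → ℝ)} (hS : S.Finite) {F : Set (ι → ℝ)}
    (h0 : (0 : ι → ℝ) ∈ interior (convexHull ℝ S))
    (hF : IsFace (convexHull ℝ S) F) (hne : F ≠ convexHull ℝ S) :
    ∃ y ∈ dual (convexHull ℝ S), F = {x ∈ convexHull ℝ S | x ⬝ᵥ y = -1} := by
  classical
  have hFe := hF.eq_convexHull
  have hconv := hF.1.convex_sdiff (convex_convexHull ℝ S)
  have hB : convexHull ℝ (S \ F) ⊆ convexHull ℝ S \ F :=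
    convexHull_min (fun y hy => ⟨subset_convexHull ℝ S hy.1, hy.2⟩) hconv
  have hA : convexHull ℝ (S ∩ F) ⊆ F := convexHull_min Set.inter_subset_right hF.2
  rcases (S ∩ F).eq_empty_or_nonempty with h | hne'
  · rw [h, convexHull_empty] at hFe
    refine ⟨0, zero_mem_dual _, ?_⟩
    rw [hFe]
    ext x
    simp
  have hBne : (S \ F).Nonempty := by
    by_contra h
    rw [Set.not_nonempty_iff_eq_empty, Set.sdiff_eq_empty] at h
    rw [Set.inter_eq_left.2 h] at hFe
    exact hne hFe
  have hAfin : (S ∩ F).Finite := hS.subset Set.inter_subset_left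
  -- If `z` were in both sets, the barycentre `x` of the generators in F would lie strictly between
  -- `z` and a point `x'` of F on the other side, and extremality would put `z` into F.
  have hdisj : Disjoint (convexHull ℝ (S \ F)) (affineSpan ℝ (S ∩ F) : Set (ι → ℝ)) := by
    rw [Set.disjoint_left]
    intro z hz hz'
    obtain ⟨T, hT⟩ : ∃ T : Finset (ι → ℝ), (T : Set (ι → ℝ)) = S ∩ F :=
      ⟨hAfin.toFinset, hAfin.coe_toFinset⟩
    have hTne : T.Nonempty := by rw [← Finset.coe_nonempty, hT]; exact hne'
    obtain ⟨n, hndef⟩ : ∃ n : ℝ, n = (T.card : ℝ) := ⟨_, rfl⟩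
    have hn : 0 < n := by rw [hndef]; exact_mod_cast hTne.card_pos
    have hr : (Set.range ((↑) : T → (ι → ℝ))) = S ∩ F := by rw [← hT]; simp
    rw [SetLike.mem_coe, ← hr] at hz'
    obtain ⟨w, hw, hzw⟩ := eq_affineCombination_of_mem_affineSpan_of_fintype hz'
    rw [Finset.affineCombination_eq_linear_combination _ _ _ hw] at hzw
    obtain ⟨M, hM⟩ : ∃ M : ℝ, 0 < M ∧ ∀ i : T, w i ≤ M := by
      refine ⟨∑ i : T, |w i| + 1, by positivity, fun i => ?_⟩
      have := Finset.single_le_sum (f := fun i => |w i|) (fun i _ => abs_nonneg _)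
        (Finset.mem_univ i)
      linarith [le_abs_self (w i)]
    -- This ε is small enough for the coefficients of `x'`, which is `x` pushed away from `z`, to
    -- stay nonnegative.
    obtain ⟨ε, hε⟩ : ∃ ε : ℝ, ε = 1 / (n * M) := ⟨_, rfl⟩
    have hεpos : 0 < ε := by have := hM.1; rw [hε]; positivity
    let x : ι → ℝ := ∑ i : T, (1 / n) • (i : ι → ℝ)
    let x' : ι → ℝ := ∑ i : T, ((1 + ε) / n - ε * w i) • (i : ι → ℝ)
    have hsum : ∑ i : T, (1 / n) = 1 := by
      simp [← hndef, hn.ne']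
    have hTA : ∀ i : T, (i : ι → ℝ) ∈ S ∩ F := fun i => hT ▸ i.2
    have hx : x ∈ F := hA <| (convex_convexHull ℝ _).sum_mem (fun i _ => by positivity) hsum
      fun i _ => subset_convexHull ℝ _ (hTA i)
    have hx' : x' ∈ F := by
      refine hA <| (convex_convexHull ℝ _).sum_mem (fun i _ => ?_) ?_
        fun i _ => subset_convexHull ℝ _ (hTA i)
      · have h1 := hM.2 i
        have h2 : ε * w i ≤ ε * M := by gcongr
        have h3 : ε * M = 1 / n := by
          rw [hε]; have := hM.1.ne'; field_simp
        have h4 : 1 / n ≤ (1 + ε) / n := by gcongr; linarith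
        linarith
      · rw [Finset.sum_sub_distrib, ← Finset.mul_sum, hw]
        have : ∑ i : T, (1 + ε) / n = (1 + ε) * ∑ i : T, (1 / n) := by
          rw [Finset.mul_sum]; exact Finset.sum_congr rfl fun i _ => by ring
        rw [this, hsum]; ring
    have hmem : x ∈ openSegment ℝ x' z := by
      refine ⟨1 / (1 + ε), ε / (1 + ε), by positivity, by positivity, by field_simp, ?_⟩
      rw [hzw, Finset.smul_sum, Finset.smul_sum, ← Finset.sum_add_distrib]
      refine Finset.sum_congr rfl fun i _ => ?_
      rw [smul_smul, smul_smul, ← add_smul]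
      congr 1
      have : (1 + ε) ≠ 0 := by positivity
      field_simp
      ring
    exact (hB hz).2 (hF.1.right_mem_of_mem_openSegment (hF.1.1 hx') (hB hz).1 hx hmem)
  obtain ⟨f, u, v, hfu, huv, hfv⟩ := geometric_hahn_banach_compact_closed
    (convex_convexHull ℝ (S \ F)) ((hS.subset Set.sdiff_subset).isCompact_convexHull ℝ)
    (affineSpan ℝ (S ∩ F)).convex (AffineSubspace.closed_of_finiteDimensional _) hdisj
  obtain ⟨a, ha⟩ := hne'
  have haS : a ∈ affineSpan ℝ (S ∩ F) := subset_affineSpan ℝ _ ha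
  have hconst : ∀ b ∈ affineSpan ℝ (S ∩ F), f b = f a := by
    intro b hb
    by_contra hfb
    set r := f b - f a with hr
    have hr0 : r ≠ 0 := sub_ne_zero.2 hfb
    -- A functional that is not constant on the affine span attains every value there, including the
    -- lower bound `v`.
    have h := hfv _ (AffineMap.lineMap_mem ((v - f a) / r) haS hb)
    rw [AffineMap.lineMap_apply_module', map_add, map_smul, map_sub, smul_eq_mul, ← hr,
      div_mul_cancel₀ _ hr0] at h
    linarith
  obtain ⟨y, hy⟩ := exists_dotProduct_eq f.toLinearMap
  have hy' : ∀ x, f x = x ⬝ᵥ y := hy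
  have hva := hfv a haS
  have hle : ∀ x ∈ S, f x ≤ f a := by
    intro x hx
    by_cases hxF : x ∈ F
    · exact (hconst x (subset_affineSpan ℝ _ ⟨hx, hxF⟩)).le
    · linarith [hfu x (subset_convexHull ℝ _ ⟨hx, hxF⟩)]
  obtain ⟨b, hb⟩ := hBne
  have hfb := hfu b (subset_convexHull ℝ _ hb)
  have hyne : y ≠ 0 := by
    rintro rfl
    have h1 := hy' a
    have h2 := hy' b
    rw [dotProduct_zero] at h1 h2
    linarith
  -- The value `f a` is the maximum of `f` on S, and as 0 is an interior point, `f` is positive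
  -- somewhere on S.
  have hca : 0 < f a := by
    obtain ⟨x, hx, hx'⟩ := dotProduct_convexHull_neg h0 (neg_ne_zero.2 hyne)
    rw [dotProduct_neg, ← hy'] at hx'
    linarith [hle x hx]
  set c := f a with hc
  have hydual : (-c⁻¹) • y ∈ dual (convexHull ℝ S) := by
    rw [mem_dual_convexHull]
    intro x hx
    rw [dotProduct_smul, smul_eq_mul, ← hy']
    have h1 : c⁻¹ * f x ≤ c⁻¹ * c := by gcongr; exact hle x hx
    rw [inv_mul_cancel₀ hca.ne'] at h1
    linarith
  refine ⟨(-c⁻¹) • y, hydual, ?_⟩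
  have hface := (isFace_of_mem_dual (convex_convexHull ℝ S) hydual).eq_convexHull
  rw [hFe, hface]
  congr 1
  ext x
  simp only [Set.mem_inter_iff, Set.mem_ofPred_eq, dotProduct_smul, smul_eq_mul, ← hy']
  refine and_congr_right fun hx => ?_
  constructor
  · intro hxF
    refine ⟨subset_convexHull ℝ S hx, ?_⟩
    rw [hconst x (subset_affineSpan ℝ _ ⟨hx, hxF⟩)]
    field_simp
  · rintro ⟨-, hfx⟩
    by_contra hxF
    have h1 := hfu x (subset_convexHull ℝ _ ⟨hx, hxF⟩)
    have h2 : f x = c := by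
      field_simp at hfx
      linarith
    linarith

theorem face_eq_convexHull {S : Set (ι → ℝ)} {y : ι → ℝ} (hy : y ∈ dual (convexHull ℝ S)) :
    {x ∈ convexHull ℝ S | x ⬝ᵥ y = -1} = convexHull ℝ {x ∈ S | x ⬝ᵥ y = -1} := by
  rw [(isFace_of_mem_dual (convex_convexHull ℝ S) hy).eq_convexHull]
  congr 1
  ext x
  simp only [Set.mem_inter_iff, Set.mem_ofPred_eq]
  exact ⟨fun h => ⟨h.1, h.2.2⟩, fun h => ⟨h.1, subset_convexHull ℝ S h.1, h.2⟩⟩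

omit [Fintype ι] in
theorem hull_convexHull (S : Set (ι → ℝ)) :
    PointedCone.hull ℝ (convexHull ℝ S) = PointedCone.hull ℝ S := by
  refine le_antisymm (Submodule.span_le.2 (convexHull_min Submodule.subset_span ?_))
    (Submodule.span_mono (subset_convexHull ℝ S))
  exact (PointedCone.hull ℝ S).convex

/-- The cones of the fan spanned by a polytope, in terms of points of the dual polytope. -/
theorem mem_spannedFan_iff {S : Set (ι → ℝ)} (hS : S.Finite)
    (h0 : (0 : ι → ℝ) ∈ interior (convexHull ℝ S)) {σ : RationalCone ι} :
    σ ∈ (spannedFan (convexHull ℝ S)).cones ↔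
      ∃ y ∈ dual (convexHull ℝ S), σ.carrier = PointedCone.hull ℝ {x ∈ S | x ⬝ᵥ y = -1} := by
  constructor
  · rintro ⟨F, hF, hne, hσ⟩
    obtain ⟨y, hy, rfl⟩ := hF.exists_dual hS h0 hne
    exact ⟨y, hy, by rw [hσ, face_eq_convexHull hy, hull_convexHull]⟩
  · rintro ⟨y, hy, hσ⟩
    refine ⟨_, isFace_of_mem_dual (convex_convexHull ℝ S) hy, ?_, ?_⟩
    · intro h
      have : (0 : ι → ℝ) ∈ {x ∈ convexHull ℝ S | x ⬝ᵥ y = -1} := by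
        rw [h]; exact interior_subset h0
      have := this.2
      rw [zero_dotProduct] at this
      linarith
    · rw [hσ, face_eq_convexHull hy, hull_convexHull]

end Convex

/-! ### Vertices of the dual polytope and the facets that they cut out. -/

section Vertices

variable {ι : Type} [Fintype ι]

theorem exists_orthogonal {S : Set (ι → ℝ)} (h : Submodule.span ℝ S ≠ ⊤) :
    ∃ z : ι → ℝ, z ≠ 0 ∧ ∀ x ∈ S, x ⬝ᵥ z = 0 := by
  obtain ⟨f, hf, hle⟩ := Submodule.exists_le_ker_of_lt_top _ h.lt_top
  obtain ⟨z, hz⟩ := exists_dotProduct_eq f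
  refine ⟨z, ?_, fun x hx => ?_⟩
  · rintro rfl
    exact hf (LinearMap.ext fun x => by rw [hz, dotProduct_zero, LinearMap.zero_apply])
  · rw [← hz]
    exact hle (Submodule.subset_span hx)

theorem eq_zero_of_span_eq_top {S : Set (ι → ℝ)} (h : Submodule.span ℝ S = ⊤) {z : ι → ℝ}
    (hz : ∀ x ∈ S, x ⬝ᵥ z = 0) : z = 0 := by
  have : ∀ x : ι → ℝ, x ⬝ᵥ z = 0 := by
    intro x
    have hx : x ∈ Submodule.span ℝ S := h ▸ Submodule.mem_top
    induction hx using Submodule.span_induction with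
    | mem x hx => exact hz x hx
    | zero => simp
    | add x y _ _ hx hy => rw [add_dotProduct, hx, hy, add_zero]
    | smul c x _ hx => rw [smul_dotProduct, hx, smul_zero]
  exact dotProduct_self_eq_zero.1 (this z)

/-- The constraints that are active at a vertex of the dual polytope span the space. -/
theorem span_active_eq_top {S : Set (ι → ℝ)} (hS : S.Finite) {y : ι → ℝ}
    (hy : y ∈ vertices (dual (convexHull ℝ S))) :
    Submodule.span ℝ {x ∈ S | x ⬝ᵥ y = -1} = ⊤ := by
  by_contra h
  obtain ⟨z, hz0, hz⟩ := exists_orthogonal h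
  have hyd := mem_dual_convexHull.1 hy.1
  -- The finitely many inactive constraints are strict at `y` and survive a small move in the
  -- directions ±z, while the active ones do not change. Then `y` is the midpoint of a segment in
  -- the dual, hence not a vertex.
  have hev : ∀ᶠ t in nhdsWithin (0 : ℝ) (Set.Ioi 0), ∀ x ∈ S, x ⬝ᵥ y ≠ -1 →
      t * |x ⬝ᵥ z| < x ⬝ᵥ y + 1 := by
    rw [Filter.eventually_all_finite hS]
    intro x hx
    by_cases hxy : x ⬝ᵥ y = -1
    · simp [hxy]
    have hpos : 0 < x ⬝ᵥ y + 1 := by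
      have := lt_of_le_of_ne (hyd x hx) (Ne.symm hxy)
      linarith
    have hc : Continuous fun t : ℝ => t * |x ⬝ᵥ z| := by fun_prop
    have := (hc.tendsto 0).eventually_lt_const (u := x ⬝ᵥ y + 1) (by simpa using hpos)
    exact (this.filter_mono nhdsWithin_le_nhds).mono fun t ht _ => ht
  obtain ⟨t, ht, ht0⟩ := (hev.and self_mem_nhdsWithin).exists
  have ht0 : 0 < t := ht0
  have hmem : ∀ s : ℝ, |s| = t → y + s • z ∈ dual (convexHull ℝ S) := by
    intro s hs
    rw [mem_dual_convexHull]
    intro x hx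
    rw [dotProduct_add, dotProduct_smul, smul_eq_mul]
    by_cases hxy : x ⬝ᵥ y = -1
    · rw [hz x ⟨hx, hxy⟩, hxy]; simp
    · have h1 := ht x hx hxy
      rw [← hs, ← abs_mul] at h1
      linarith [neg_abs_le (s * (x ⬝ᵥ z))]
  have h1 := hmem t (abs_of_pos ht0)
  have h2 := hmem (-t) (by rw [abs_neg, abs_of_pos ht0])
  have h3 : y ∈ openSegment ℝ (y + t • z) (y + (-t) • z) := by
    refine ⟨1 / 2, 1 / 2, by norm_num, by norm_num, by norm_num, ?_⟩
    ext i
    simp only [Pi.add_apply, Pi.smul_apply, smul_eq_mul]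
    ring
  have h4 := (mem_extremePoints_iff_left.1 hy).2 _ h1 _ h2 h3
  have h5 : t • z = 0 := by simpa using h4
  exact (smul_ne_zero ht0.ne' hz0) h5

/-- Converse of `span_active_eq_top`. A constraint that is active at an inner point of a segment in
the dual is active on the whole segment, so the segment is orthogonal to a spanning set. -/
theorem mem_vertices_dual {S : Set (ι → ℝ)} {y : ι → ℝ}
    (hy : y ∈ dual (convexHull ℝ S)) (h : Submodule.span ℝ {x ∈ S | x ⬝ᵥ y = -1} = ⊤) :
    y ∈ vertices (dual (convexHull ℝ S)) := by
  refine mem_extremePoints_iff_left.2 ⟨hy, fun a ha b hb hab => ?_⟩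
  obtain ⟨s, t, hs, ht, hst, hab⟩ := hab
  rw [← sub_eq_zero]
  refine eq_zero_of_span_eq_top h fun x hx => ?_
  have h1 := mem_dual_convexHull.1 ha x hx.1
  have h2 := mem_dual_convexHull.1 hb x hx.1
  have h3 := hx.2
  rw [← hab, dotProduct_add, dotProduct_smul, dotProduct_smul, smul_eq_mul, smul_eq_mul] at h3
  rw [dotProduct_sub, hx.2]
  nlinarith

/-- The points active at a dual vertex span the space and lie in an affine hyperplane off the
origin, so their hull is a facet, and by assumption a simplex. Being vertices of P, they are among
the vertices of the simplex and are affinely independent. Pairing a linear relation with `y`, which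
is -1 on each of them, shows that its coefficients sum to 0, so it is an affine relation. -/
theorem linearIndependent_of_isSimplicial [Nonempty ι] {S : Set (ι → ℝ)} (hS : S.Finite)
    (hv : vertices (convexHull ℝ S) = S) (hs : IsSimplicial (convexHull ℝ S)) {y : ι → ℝ}
    (hy : y ∈ vertices (dual (convexHull ℝ S))) :
    LinearIndependent ℝ (fun x : {x ∈ S | x ⬝ᵥ y = -1} => (x : ι → ℝ)) := by
  classical
  set A : Set (ι → ℝ) := {x ∈ S | x ⬝ᵥ y = -1} with hA
  have hspan : Submodule.span ℝ A = ⊤ := span_active_eq_top hS hy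
  have hAne : A.Nonempty := by
    by_contra h
    rw [Set.not_nonempty_iff_eq_empty] at h
    rw [h, Submodule.span_empty] at hspan
    exact bot_ne_top hspan
  obtain ⟨a, ha⟩ := hAne
  have hface := isFace_of_mem_dual (convex_convexHull ℝ S) hy.1
  have hFA := face_eq_convexHull hy.1
  have hvs : vectorSpan ℝ (convexHull ℝ A) = vectorSpan ℝ A := by
    rw [← direction_affineSpan, affineSpan_convexHull, direction_affineSpan]
  have hker : ∀ z ∈ vectorSpan ℝ A, z ⬝ᵥ y = 0 := by
    intro z hz
    rw [vectorSpan_def] at hz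
    induction hz using Submodule.span_induction with
    | mem x hx =>
      obtain ⟨p, hp, q, hq, rfl⟩ := hx
      change (p - q) ⬝ᵥ y = 0
      rw [sub_dotProduct, hp.2, hq.2, sub_self]
    | zero => simp
    | add x y _ _ hx hy => rw [add_dotProduct, hx, hy, add_zero]
    | smul c x _ hx => rw [smul_dotProduct, hx, smul_zero]
  have hfacet : IsFacet (convexHull ℝ S) {x ∈ convexHull ℝ S | x ⬝ᵥ y = -1} := by
    refine ⟨hface, ⟨a, subset_convexHull ℝ S ha.1, ha.2⟩, ?_⟩
    rw [hFA, hvs]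
    have h1 : Module.finrank ℝ (vectorSpan ℝ A) < Module.finrank ℝ (ι → ℝ) := by
      apply Submodule.finrank_lt
      intro h
      have := hker a (h ▸ Submodule.mem_top)
      rw [ha.2] at this
      norm_num at this
    have h2 : (⊤ : Submodule ℝ (ι → ℝ)) ≤ vectorSpan ℝ A ⊔ Submodule.span ℝ {a} := by
      rw [← hspan, Submodule.span_le]
      intro x hx
      have : x = (x - a) + a := by abel
      rw [this]
      exact Submodule.add_mem_sup (vsub_mem_vectorSpan ℝ hx ha)
        (Submodule.mem_span_singleton_self a)
    have h3 := Submodule.finrank_mono h2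
    have h4 := Submodule.finrank_add_le_finrank_add_finrank (vectorSpan ℝ A) (Submodule.span ℝ {a})
    have h5 := finrank_span_singleton (K := ℝ) (v := a) (by
      rintro rfl
      have := ha.2
      rw [zero_dotProduct] at this
      norm_num at this)
    rw [finrank_top] at h3
    rw [Module.finrank_fintype_fun_eq_card] at h1 h3
    omega
  obtain ⟨T, hT, hFT⟩ := hs _ hfacet
  have hAT : A ⊆ (T : Set (ι → ℝ)) := by
    intro x hx
    have h1 : x ∈ (convexHull ℝ S).extremePoints ℝ := by
      have : x ∈ vertices (convexHull ℝ S) := by rw [hv]; exact hx.1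
      exact this
    have h2 : x ∈ ({x ∈ convexHull ℝ S | x ⬝ᵥ y = -1}).extremePoints ℝ :=
      inter_extremePoints_subset_extremePoints_of_subset (fun z hz => hz.1)
        ⟨⟨subset_convexHull ℝ S hx.1, hx.2⟩, h1⟩
    rw [hFT] at h2
    exact extremePoints_convexHull_subset h2
  have hAaff : AffineIndependent ℝ ((↑) : A → (ι → ℝ)) := hT.mono hAT
  rw [linearIndependent_iff']
  intro s c hc i hi
  have hsum : ∑ i ∈ s, c i = 0 := by
    have := congrArg (· ⬝ᵥ y) hc
    simp only [sum_dotProduct, smul_dotProduct, zero_dotProduct, smul_eq_mul] at this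
    rw [Finset.sum_congr rfl fun i _ => by rw [i.2.2]] at this
    rw [← Finset.sum_mul] at this
    linarith
  exact affineIndependent_iff.1 hAaff s c hsum hc i hi

end Vertices

/-! ### Facets of a simplicial polytope and their neighbours. -/

/-- The lattice points `V` are the vertices of a simplicial polytope with the origin in its
interior whose dual has the lattice points `U` as its vertices. -/
structure SimplicialData {ι : Type} [Fintype ι] (V U : Finset (ι → ℤ)) : Prop where
  vert : vertices (convexHull ℝ (intVec '' (V : Set (ι → ℤ)))) = intVec '' (V : Set (ι → ℤ))
  zero_mem : (0 : ι → ℝ) ∈ interior (convexHull ℝ (intVec '' (V : Set (ι → ℤ))))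
  zero_notMem : (0 : ι → ℤ) ∉ V
  dual_eq : dual (convexHull ℝ (intVec '' (V : Set (ι → ℤ)))) =
    convexHull ℝ (intVec '' (U : Set (ι → ℤ)))
  dual_vert : vertices (dual (convexHull ℝ (intVec '' (V : Set (ι → ℤ))))) =
    intVec '' (U : Set (ι → ℤ))
  indep : ∀ u ∈ U, LinearIndependent ℝ
    (fun v : {v ∈ V | v ⬝ᵥ u = -1} => (intVec (v : ι → ℤ) : ι → ℝ))

namespace SimplicialData

variable {ι : Type} [Fintype ι] {V U : Finset (ι → ℤ)}

theorem image_active (V : Finset (ι → ℤ)) (u : ι → ℤ) :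
    {x ∈ intVec '' (V : Set (ι → ℤ)) | x ⬝ᵥ intVec u = -1} =
      Set.range (fun v : {v ∈ V | v ⬝ᵥ u = -1} => (intVec (v : ι → ℤ) : ι → ℝ)) := by
  ext x
  constructor
  · rintro ⟨⟨v, hv, rfl⟩, h⟩
    rw [intVec_dotProduct] at h
    exact ⟨⟨v, Finset.mem_filter.2 ⟨hv, by exact_mod_cast h⟩⟩, rfl⟩
  · rintro ⟨⟨v, hv⟩, rfl⟩
    rw [Finset.mem_filter] at hv
    exact ⟨⟨v, hv.1, rfl⟩, by rw [intVec_dotProduct, hv.2]; norm_num⟩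

theorem mem_dual_iff {y : ι → ℝ} : y ∈ dual (convexHull ℝ (intVec '' (V : Set (ι → ℤ)))) ↔
    ∀ v ∈ V, -1 ≤ intVec v ⬝ᵥ y := by
  rw [mem_dual_convexHull]
  simp

theorem neg_one_le (h : SimplicialData V U) {u v : ι → ℤ} (hu : u ∈ U) (hv : v ∈ V) :
    -1 ≤ v ⬝ᵥ u := by
  have h1 : intVec u ∈ dual (convexHull ℝ (intVec '' (V : Set (ι → ℤ)))) := by
    rw [h.dual_eq]; exact subset_convexHull ℝ _ ⟨u, hu, rfl⟩
  have := mem_dual_iff.1 h1 v hv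
  rw [intVec_dotProduct] at this
  exact_mod_cast this

theorem span_eq_top (h : SimplicialData V U) {u : ι → ℤ} (hu : u ∈ U) : Submodule.span ℝ
    (Set.range (fun v : {v ∈ V | v ⬝ᵥ u = -1} => (intVec (v : ι → ℤ) : ι → ℝ))) = ⊤ := by
  rw [← image_active]
  exact span_active_eq_top (V.finite_toSet.image _) (h.dual_vert ▸ ⟨u, hu, rfl⟩)

/-- The vertices of a facet as a basis. -/
def facetBasis (h : SimplicialData V U) {u : ι → ℤ} (hu : u ∈ U) :
    Module.Basis {v ∈ V | v ⬝ᵥ u = -1} ℝ (ι → ℝ) :=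
  Module.Basis.mk (h.indep u hu) (h.span_eq_top hu).ge

theorem facetBasis_apply (h : SimplicialData V U) {u : ι → ℤ} (hu : u ∈ U)
    (e : {v ∈ V | v ⬝ᵥ u = -1}) : h.facetBasis hu e = intVec (e : ι → ℤ) := by
  simp [facetBasis]

theorem card_active (h : SimplicialData V U) {u : ι → ℤ} (hu : u ∈ U) :
    {v ∈ V | v ⬝ᵥ u = -1}.card = Fintype.card ι := by
  have := Module.finrank_eq_card_basis (h.facetBasis hu)
  rw [Module.finrank_fintype_fun_eq_card] at this
  simpa using this.symm

/-- The facet adjacent to the facet `u` across the ridge opposite to `e`. -/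
theorem exists_neighbour (h : SimplicialData V U) {u : ι → ℤ} (hu : u ∈ U) {e : ι → ℤ}
    (he : e ∈ {v ∈ V | v ⬝ᵥ u = -1}) :
    ∃ w ∈ U, (∀ f ∈ {v ∈ V | v ⬝ᵥ u = -1}, f ≠ e → f ⬝ᵥ w = -1) ∧ 0 ≤ e ⬝ᵥ w := by
  classical
  let b := h.facetBasis hu
  -- The form `z` belongs to the dual basis: moving from `u` along `z` keeps all vertices of the
  -- facet other than `e` at level -1.
  obtain ⟨z, hz⟩ := exists_dotProduct_eq (b.coord ⟨e, he⟩)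
  have hze : intVec e ⬝ᵥ z = 1 := by
    rw [← hz, ← h.facetBasis_apply hu ⟨e, he⟩]; simp [b]
  have hzf : ∀ f ∈ {v ∈ V | v ⬝ᵥ u = -1}, f ≠ e → intVec f ⬝ᵥ z = 0 := by
    intro f hf hfe
    rw [← hz, ← h.facetBasis_apply hu ⟨f, hf⟩]
    simp [b, hfe]
  have hz0 : z ≠ 0 := by rintro rfl; simp at hze
  obtain ⟨_, ⟨v₀, hv₀, rfl⟩, hneg⟩ := dotProduct_convexHull_neg h.zero_mem hz0
  -- The ratio test of the simplex method: `r v` is the time at which the constraint of `v` becomes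
  -- tight along `u + t • z`, and the minimum is the last time at which the ray is in the dual.
  let r : (ι → ℤ) → ℝ := fun v => (intVec v ⬝ᵥ intVec u + 1) / -(intVec v ⬝ᵥ z)
  obtain ⟨n, hn, hmin⟩ := Finset.exists_min_image {v ∈ V | intVec v ⬝ᵥ z < 0} r
    ⟨v₀, Finset.mem_filter.2 ⟨hv₀, hneg⟩⟩
  rw [Finset.mem_filter] at hn
  have hge : ∀ v ∈ V, 0 ≤ intVec v ⬝ᵥ intVec u + 1 := by
    intro v hv
    have := h.neg_one_le hu hv
    rw [intVec_dotProduct]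
    have : (-1 : ℝ) ≤ ((v ⬝ᵥ u : ℤ) : ℝ) := by exact_mod_cast this
    linarith
  have hnpos : 0 < intVec n ⬝ᵥ intVec u + 1 := by
    refine lt_of_le_of_ne (hge n hn.1) fun h0 => ?_
    have hnA : n ∈ {v ∈ V | v ⬝ᵥ u = -1} := by
      refine Finset.mem_filter.2 ⟨hn.1, ?_⟩
      rw [intVec_dotProduct] at h0
      have : ((n ⬝ᵥ u : ℤ) : ℝ) = ((-1 : ℤ) : ℝ) := by push_cast; linarith
      exact_mod_cast this
    have := hn.2
    by_cases hne : n = e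
    · rw [hne, hze] at this; linarith
    · rw [hzf n hnA hne] at this; linarith
  have ht : 0 < r n := div_pos hnpos (by linarith [hn.2])
  set t := r n with ht'
  have hnt : intVec n ⬝ᵥ intVec u + t * (intVec n ⬝ᵥ z) = -1 := by
    have := hn.2.ne
    simp only [ht', r]
    field_simp
    ring
  have hy : intVec u + t • z ∈ dual (convexHull ℝ (intVec '' (V : Set (ι → ℤ)))) := by
    rw [mem_dual_iff]
    intro v hv
    rw [dotProduct_add, dotProduct_smul, smul_eq_mul]
    by_cases hvz : intVec v ⬝ᵥ z < 0
    · have h1 := hmin v (Finset.mem_filter.2 ⟨hv, hvz⟩)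
      simp only [r] at h1
      rw [le_div_iff₀ (by linarith)] at h1
      linarith
    · have := hge v hv
      have : 0 ≤ t * (intVec v ⬝ᵥ z) := mul_nonneg ht.le (not_lt.1 hvz)
      linarith
  -- A vector orthogonal to all active points is a multiple of `z`, since it vanishes on the facet
  -- vertices other than `e`; the new active point `n` has a nonzero product with `z`, so the
  -- multiple is 0.
  have hspan : Submodule.span ℝ
      {x ∈ intVec '' (V : Set (ι → ℤ)) | x ⬝ᵥ (intVec u + t • z) = -1} = ⊤ := by
    by_contra hne
    obtain ⟨q, hq0, hq⟩ := exists_orthogonal hne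
    have hqf : ∀ f ∈ {v ∈ V | v ⬝ᵥ u = -1}, f ≠ e → intVec f ⬝ᵥ q = 0 := by
      intro f hf hfe
      refine hq _ ⟨⟨f, (Finset.mem_filter.1 hf).1, rfl⟩, ?_⟩
      rw [dotProduct_add, dotProduct_smul, hzf f hf hfe, smul_zero, add_zero, intVec_dotProduct,
        (Finset.mem_filter.1 hf).2]
      norm_num
    have hqn : intVec n ⬝ᵥ q = 0 := by
      refine hq _ ⟨⟨n, hn.1, rfl⟩, ?_⟩
      rw [dotProduct_add, dotProduct_smul, smul_eq_mul, hnt]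
    have hqz : q - (intVec e ⬝ᵥ q) • z = 0 := by
      refine eq_zero_of_span_eq_top (h.span_eq_top hu) ?_
      rintro _ ⟨⟨f, hf⟩, rfl⟩
      simp only [dotProduct_sub, dotProduct_smul, smul_eq_mul]
      by_cases hfe : f = e
      · rw [hfe, hze]; ring
      · rw [hqf f hf hfe, hzf f hf hfe]; ring
    rw [sub_eq_zero] at hqz
    rw [hqz, dotProduct_smul, smul_eq_mul, mul_eq_zero] at hqn
    rcases hqn with h1 | h1
    · rw [h1, zero_smul] at hqz; exact hq0 hqz
    · exact hn.2.ne h1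
  obtain ⟨w, hw, hwy⟩ : intVec u + t • z ∈ intVec '' (U : Set (ι → ℤ)) := by
    rw [← h.dual_vert]; exact mem_vertices_dual hy hspan
  have hdot : ∀ f : ι → ℤ, ((f ⬝ᵥ w : ℤ) : ℝ) = ((f ⬝ᵥ u : ℤ) : ℝ) + t * (intVec f ⬝ᵥ z) := by
    intro f
    rw [← intVec_dotProduct, hwy, dotProduct_add, dotProduct_smul, intVec_dotProduct, smul_eq_mul]
  refine ⟨w, hw, fun f hf hfe => ?_, ?_⟩
  · have := hdot f
    rw [hzf f hf hfe, (Finset.mem_filter.1 hf).2, mul_zero, add_zero] at this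
    exact_mod_cast this
  · have := hdot e
    rw [hze, (Finset.mem_filter.1 he).2, mul_one] at this
    -- The move raises the level of `e` strictly above -1, and levels on elements of `U` are
    -- integers.
    have h1 : ((-1 : ℤ) : ℝ) < ((e ⬝ᵥ w : ℤ) : ℝ) := by rw [this]; linarith
    have h2 : (-1 : ℤ) < e ⬝ᵥ w := by exact_mod_cast h1
    omega

/-- A small negative multiple of `s` lies in the dual, which is the convex hull of `U`. If `s` were
nonnegative on `U`, it would be nonnegative on this multiple, against `s ⬝ᵥ s > 0`. The main
application is to the sum of all vertices. -/
theorem exists_le_zero (h : SimplicialData V U) (s : ι → ℤ) :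
    ∃ u ∈ U, s ⬝ᵥ u ≤ 0 ∧ (s ⬝ᵥ u = 0 → s = 0) := by
  have hU : U.Nonempty := by
    have h1 := zero_mem_dual (convexHull ℝ (intVec '' (V : Set (ι → ℤ))))
    rw [h.dual_eq] at h1
    have := convexHull_nonempty_iff.1 ⟨_, h1⟩
    simpa using this
  by_cases hs : s = 0
  · obtain ⟨u, hu⟩ := hU
    exact ⟨u, hu, by simp [hs], fun _ => hs⟩
  suffices ∃ u ∈ U, s ⬝ᵥ u < 0 by
    obtain ⟨u, hu, hlt⟩ := this
    exact ⟨u, hu, hlt.le, fun h0 => absurd h0 hlt.ne⟩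
  by_contra! hge
  obtain ⟨M, hM⟩ : ∃ M : ℝ, 0 < M ∧ ∀ v ∈ V, intVec v ⬝ᵥ intVec s ≤ M := by
    refine ⟨∑ v ∈ V, |intVec v ⬝ᵥ intVec s| + 1, by positivity, fun v hv => ?_⟩
    have := Finset.single_le_sum (f := fun v => |intVec v ⬝ᵥ intVec s|)
      (fun i _ => abs_nonneg _) hv
    have h2 := le_abs_self (intVec v ⬝ᵥ intVec s)
    linarith
  have hy : (-M⁻¹) • intVec s ∈ dual (convexHull ℝ (intVec '' (V : Set (ι → ℤ)))) := by
    rw [mem_dual_iff]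
    intro v hv
    rw [dotProduct_smul, smul_eq_mul]
    have h1 : M⁻¹ * (intVec v ⬝ᵥ intVec s) ≤ M⁻¹ * M := by
      have := hM.2 v hv
      have := hM.1
      gcongr
    rw [inv_mul_cancel₀ hM.1.ne'] at h1
    linarith
  rw [h.dual_eq] at hy
  have hc : Convex ℝ {x : ι → ℝ | 0 ≤ intVec s ⬝ᵥ x} := by
    intro a ha b hb s t hs ht hst
    simp only [Set.mem_ofPred_eq, dotProduct_add, dotProduct_smul, smul_eq_mul] at *
    positivity
  have hmem := convexHull_min (t := {x : ι → ℝ | 0 ≤ intVec s ⬝ᵥ x}) (by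
    rintro _ ⟨u, hu, rfl⟩
    have := hge u hu
    rw [Set.mem_ofPred_eq, intVec_dotProduct]
    exact_mod_cast this) hc hy
  rw [Set.mem_ofPred_eq, dotProduct_smul, smul_eq_mul, intVec_dotProduct] at hmem
  have hpos : 0 < s ⬝ᵥ s := by
    refine lt_of_le_of_ne (Finset.sum_nonneg fun i _ => mul_self_nonneg _) fun h2 =>
      hs (dotProduct_self_eq_zero.1 h2.symm)
  have hpos' : (0 : ℝ) < ((s ⬝ᵥ s : ℤ) : ℝ) := by exact_mod_cast hpos
  have := mul_pos (inv_pos.2 hM.1) hpos'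
  linarith

end SimplicialData

/-! ### Counting the vertices by their level on a facet, and the case of equality. -/

namespace SimplicialData

variable {ι : Type} [Fintype ι] {V U : Finset (ι → ℤ)}

/-- A choice of the facets adjacent to the facet `u`, indexed by the opposite vertices. -/
def IsNeighbours (V U : Finset (ι → ℤ)) (u : ι → ℤ) (w : (ι → ℤ) → ι → ℤ) : Prop :=
  ∀ e ∈ {v ∈ V | v ⬝ᵥ u = -1}, w e ∈ U ∧
    (∀ f ∈ {v ∈ V | v ⬝ᵥ u = -1}, f ≠ e → f ⬝ᵥ w e = -1) ∧ 0 ≤ e ⬝ᵥ w e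

theorem exists_neighbours (h : SimplicialData V U) {u : ι → ℤ} (hu : u ∈ U) :
    ∃ w, IsNeighbours V U u w := by
  have := fun e he => h.exists_neighbour hu (e := e) he
  choose! w hw using this
  exact ⟨w, hw⟩

theorem sum_repr (h : SimplicialData V U) {u : ι → ℤ} (hu : u ∈ U) (x y : ι → ℝ) :
    x ⬝ᵥ y = ∑ e, (h.facetBasis hu).repr x e * (intVec (e : ι → ℤ) ⬝ᵥ y) := by
  conv_lhs => rw [← (h.facetBasis hu).sum_repr x]
  rw [sum_dotProduct]
  refine Finset.sum_congr rfl fun e _ => ?_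
  rw [smul_dotProduct, h.facetBasis_apply, smul_eq_mul]

theorem sum_repr_eq (h : SimplicialData V U) {u : ι → ℤ} (hu : u ∈ U) (x : ι → ℝ) :
    ∑ e, (h.facetBasis hu).repr x e = -(x ⬝ᵥ intVec u) := by
  rw [h.sum_repr hu x, ← Finset.sum_neg_distrib]
  refine Finset.sum_congr rfl fun e _ => ?_
  rw [intVec_dotProduct, (Finset.mem_filter.1 e.2).2]
  push_cast
  ring

/-- The difference `w e - u` vanishes on all vertices of the facet except `e`, hence is a multiple
of the coordinate at `e`. The factor is positive, so the sign of a coordinate can be read off from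
the levels on the two facets. -/
theorem dotProduct_neighbour (h : SimplicialData V U) {u : ι → ℤ} (hu : u ∈ U)
    {w : (ι → ℤ) → ι → ℤ} (hw : IsNeighbours V U u w) (x : ι → ℝ)
    (e : {v ∈ V | v ⬝ᵥ u = -1}) :
    x ⬝ᵥ intVec (w e) = x ⬝ᵥ intVec u +
      (h.facetBasis hu).repr x e * (((e : ι → ℤ) ⬝ᵥ w e + 1 : ℤ) : ℝ) := by
  classical
  have h1 := h.sum_repr hu x (intVec (w e) - intVec u)
  rw [dotProduct_sub, Finset.sum_eq_single e] at h1
  · rw [dotProduct_sub, intVec_dotProduct, intVec_dotProduct, (Finset.mem_filter.1 e.2).2] at h1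
    push_cast at h1 ⊢
    linarith
  · intro f _ hf
    rw [dotProduct_sub, intVec_dotProduct, intVec_dotProduct,
      (hw e e.2).2.1 f f.2 (fun h => hf (Subtype.ext h)), (Finset.mem_filter.1 f.2).2]
    simp
  · simp

/-- Otherwise `x` has level ≥ 0 on all neighbours, so all its coordinates in the facet basis are
nonnegative. Their sum is minus the level on `u`, that is 0, so `x = 0`, which is not a vertex. -/
theorem exists_neighbour_mem (h : SimplicialData V U) {u : ι → ℤ} (hu : u ∈ U)
    {w : (ι → ℤ) → ι → ℤ} (hw : IsNeighbours V U u w) {x : ι → ℤ} (hx : x ∈ V)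
    (hxu : x ⬝ᵥ u = 0) : ∃ e ∈ {v ∈ V | v ⬝ᵥ u = -1}, x ⬝ᵥ w e = -1 := by
  by_contra! hne
  have hpos : ∀ e, 0 ≤ (h.facetBasis hu).repr (intVec x) e := by
    intro e
    have h1 := h.neg_one_le (hw e e.2).1 hx
    have h2 : 0 ≤ x ⬝ᵥ w e := by have := hne e e.2; omega
    have h3 := h.dotProduct_neighbour hu hw (intVec x) e
    rw [intVec_dotProduct, intVec_dotProduct, hxu, Int.cast_zero, zero_add] at h3
    have h4 : (0 : ℝ) < (((e : ι → ℤ) ⬝ᵥ w e + 1 : ℤ) : ℝ) := by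
      have := (hw e e.2).2.2
      exact_mod_cast (by omega : 0 < (e : ι → ℤ) ⬝ᵥ w e + 1)
    have h5 : (0 : ℝ) ≤ ((x ⬝ᵥ w e : ℤ) : ℝ) := by exact_mod_cast h2
    rw [h3] at h5
    exact nonneg_of_mul_nonneg_left h5 h4
  have hsum := h.sum_repr_eq hu (intVec x)
  rw [intVec_dotProduct, hxu, Int.cast_zero, neg_zero,
    Finset.sum_eq_zero_iff_of_nonneg fun e _ => hpos e] at hsum
  have h0 : intVec x = 0 := by
    apply (h.facetBasis hu).repr.injective
    ext e
    rw [hsum e (Finset.mem_univ e)]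
    simp
  refine h.zero_notMem ?_
  have : x = 0 := intVec_injective (h0.trans (by ext; simp [intVec]))
  exact this ▸ hx

/-- The adjacent facet has d vertices and shares d - 1 of them with the facet of `u`, so there is
room for only one other vertex. -/
theorem eq_of_mem_neighbour (h : SimplicialData V U) {u : ι → ℤ} (hu : u ∈ U)
    {w : (ι → ℤ) → ι → ℤ} (hw : IsNeighbours V U u w) {e x y : ι → ℤ}
    (he : e ∈ {v ∈ V | v ⬝ᵥ u = -1}) (hx : x ∈ V) (hy : y ∈ V) (hxu : x ⬝ᵥ u ≠ -1)
    (hyu : y ⬝ᵥ u ≠ -1) (hxe : x ⬝ᵥ w e = -1) (hye : y ⬝ᵥ w e = -1) : x = y := by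
  classical
  by_contra hne
  have hsub : insert x (insert y ({v ∈ V | v ⬝ᵥ u = -1}.erase e)) ⊆ {v ∈ V | v ⬝ᵥ w e = -1} := by
    intro z hz
    rw [Finset.mem_insert, Finset.mem_insert, Finset.mem_erase] at hz
    rw [Finset.mem_filter]
    rcases hz with rfl | rfl | ⟨hz, hz'⟩
    · exact ⟨hx, hxe⟩
    · exact ⟨hy, hye⟩
    · exact ⟨(Finset.mem_filter.1 hz').1, (hw e he).2.1 z hz' hz⟩
  have h1 := Finset.card_le_card hsub
  have hy' : y ∉ {v ∈ V | v ⬝ᵥ u = -1}.erase e := fun hmem =>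
    hyu (Finset.mem_filter.1 (Finset.mem_of_mem_erase hmem)).2
  have hx' : x ∉ insert y ({v ∈ V | v ⬝ᵥ u = -1}.erase e) := fun hmem => by
    rcases Finset.mem_insert.1 hmem with h2 | h2
    · exact hne h2
    · exact hxu (Finset.mem_filter.1 (Finset.mem_of_mem_erase h2)).2
  rw [Finset.card_insert_of_notMem hx', Finset.card_insert_of_notMem hy',
    Finset.card_erase_of_mem he, h.card_active hu, h.card_active (hw e he).1] at h1
  have h2 := Finset.card_pos.2 ⟨e, he⟩
  rw [h.card_active hu] at h2
  omega

/-- Each vertex of level 0 is assigned the facet vertex `e` whose opposite neighbour contains it;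
injectivity is `eq_of_mem_neighbour`. This is what bounds level 0 by d. -/
theorem exists_map (h : SimplicialData V U) {u : ι → ℤ} (hu : u ∈ U)
    {w : (ι → ℤ) → ι → ℤ} (hw : IsNeighbours V U u w) :
    ∃ φ : (ι → ℤ) → ι → ℤ, Set.MapsTo φ {v ∈ V | v ⬝ᵥ u = 0} {v ∈ V | v ⬝ᵥ u = -1} ∧
      Set.InjOn φ {v ∈ V | v ⬝ᵥ u = 0} ∧ ∀ x ∈ V, x ⬝ᵥ u = 0 → x ⬝ᵥ w (φ x) = -1 := by
  have := fun x hx hxu => h.exists_neighbour_mem hu hw (x := x) hx hxu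
  choose! φ hφ using this
  refine ⟨φ, ?_, ?_, fun x hx hxu => (hφ x hx hxu).2⟩
  · rintro x ⟨hx, hxu⟩
    exact Finset.mem_filter.1 (hφ x hx hxu).1
  · rintro x ⟨hx, hxu⟩ y ⟨hy, hyu⟩ hxy
    exact h.eq_of_mem_neighbour hu hw (hφ x hx hxu).1 hx hy (by rw [hxu]; norm_num)
      (by rw [hyu]; norm_num) (hφ x hx hxu).2 (hxy ▸ (hφ y hy hyu).2)

theorem card_zero_le (h : SimplicialData V U) {u : ι → ℤ} (hu : u ∈ U) :
    {v ∈ V | v ⬝ᵥ u = 0}.card ≤ Fintype.card ι := by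
  obtain ⟨w, hw⟩ := h.exists_neighbours hu
  obtain ⟨φ, h1, h2, -⟩ := h.exists_map hu hw
  rw [← h.card_active hu]
  refine Finset.card_le_card_of_injOn φ ?_ ?_
  · simpa using h1
  · simpa using h2

theorem card_eq (h : SimplicialData V U) {u : ι → ℤ} (hu : u ∈ U) :
    V.card = Fintype.card ι + {v ∈ V | v ⬝ᵥ u = 0}.card + {v ∈ V | 1 ≤ v ⬝ᵥ u}.card := by
  rw [← h.card_active hu, ← Finset.card_filter_add_card_filter_not (s := V) (fun v => v ⬝ᵥ u = -1),
    add_assoc]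
  congr 1
  rw [← Finset.card_filter_add_card_filter_not
    (s := {v ∈ V | ¬ v ⬝ᵥ u = -1}) (fun v => v ⬝ᵥ u = 0), Finset.filter_filter,
    Finset.filter_filter]
  congr 2
  · refine Finset.filter_congr fun v hv => ?_
    have := h.neg_one_le hu hv
    omega
  · refine Finset.filter_congr fun v hv => ?_
    have := h.neg_one_le hu hv
    omega

theorem sum_eq (h : SimplicialData V U) {u : ι → ℤ} (hu : u ∈ U) :
    (∑ v ∈ V, v) ⬝ᵥ u = -(Fintype.card ι : ℤ) + ∑ v ∈ {v ∈ V | 1 ≤ v ⬝ᵥ u}, v ⬝ᵥ u := by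
  rw [sum_dotProduct, ← Finset.sum_filter_add_sum_filter_not V (fun v => v ⬝ᵥ u = -1)]
  congr 1
  · rw [Finset.sum_congr rfl fun v hv => (Finset.mem_filter.1 hv).2, Finset.sum_const,
      h.card_active hu]
    simp
  · rw [← Finset.sum_filter_add_sum_filter_not {v ∈ V | ¬ v ⬝ᵥ u = -1} (fun v => v ⬝ᵥ u = 0),
      Finset.sum_eq_zero (s := Finset.filter _ (Finset.filter _ V))
      (fun v hv => (Finset.mem_filter.1 hv).2), zero_add, Finset.filter_filter]
    refine Finset.sum_congr (Finset.filter_congr fun v hv => ?_) fun _ _ => rfl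
    have := h.neg_one_le hu hv
    omega

theorem card_pos_le_sum (u : ι → ℤ) :
    (({v ∈ V | 1 ≤ v ⬝ᵥ u}.card : ℕ) : ℤ) ≤ ∑ v ∈ {v ∈ V | 1 ≤ v ⬝ᵥ u}, v ⬝ᵥ u := by
  have := Finset.card_nsmul_le_sum {v ∈ V | 1 ≤ v ⬝ᵥ u} (fun v => v ⬝ᵥ u) 1
    (fun v hv => (Finset.mem_filter.1 hv).2)
  simpa using this

/-- On a facet where the sum of the vertices has level ≤ 0, the vertices of positive level, each
contributing at least 1, are outweighed by the d vertices of level -1. Thus each of the three ranges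
of levels contains at most d vertices. -/
theorem card_le (h : SimplicialData V U) : V.card ≤ 3 * Fintype.card ι := by
  obtain ⟨u, hu, hle, -⟩ := h.exists_le_zero (∑ v ∈ V, v)
  have h1 := h.card_eq hu
  have h2 := h.card_zero_le hu
  have h3 := h.sum_eq hu
  have h4 := card_pos_le_sum (V := V) u
  omega

/-- With 3d vertices the estimate of `card_le` is an equality, so the sum of the vertices has level
0 on the chosen facet, and by the choice of that facet it vanishes. The estimate then holds on every
facet, again with equality, which leaves no level above 1. -/
theorem levels_of_card_eq (h : SimplicialData V U) (hc : V.card = 3 * Fintype.card ι)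
    {u : ι → ℤ} (hu : u ∈ U) :
    {v ∈ V | v ⬝ᵥ u = 0}.card = Fintype.card ι ∧ ∀ v ∈ V, v ⬝ᵥ u ≤ 1 := by
  have hs : ∑ v ∈ V, v = 0 := by
    obtain ⟨u, hu, hle, hz⟩ := h.exists_le_zero (∑ v ∈ V, v)
    have h1 := h.card_eq hu
    have h2 := h.card_zero_le hu
    have h3 := h.sum_eq hu
    have h4 := card_pos_le_sum (V := V) u
    exact hz (by omega)
  have h1 := h.card_eq hu
  have h2 := h.card_zero_le hu
  have h3 := h.sum_eq hu
  have h4 := card_pos_le_sum (V := V) u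
  rw [hs, zero_dotProduct] at h3
  refine ⟨by omega, fun v hv => ?_⟩
  by_contra! hlt
  have h5 : (({v ∈ V | 1 ≤ v ⬝ᵥ u}.card : ℕ) : ℤ) < ∑ v ∈ {v ∈ V | 1 ≤ v ⬝ᵥ u}, v ⬝ᵥ u := by
    have := Finset.sum_lt_sum (s := {v ∈ V | 1 ≤ v ⬝ᵥ u}) (f := fun _ => (1 : ℤ))
      (g := fun v => v ⬝ᵥ u) (fun v hv => (Finset.mem_filter.1 hv).2)
      ⟨v, Finset.mem_filter.2 ⟨hv, by omega⟩, hlt⟩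
    simpa using this
  omega

theorem mem_convexHull_iff (h : SimplicialData V U) {x : ι → ℝ} :
    x ∈ convexHull ℝ (intVec '' (V : Set (ι → ℤ))) ↔ ∀ u ∈ U, -1 ≤ x ⬝ᵥ intVec u := by
  rw [← dual_dual (convex_convexHull ℝ _)
    ((V.finite_toSet.image _).isCompact_convexHull ℝ).isClosed (interior_subset h.zero_mem),
    h.dual_eq, mem_dual_convexHull]
  simp [dotProduct_comm]

/-- As no level exceeds 1, the negatives of the dual vertices lie in the dual as well. Hence P = -P,
and negation permutes the vertices of P. -/
theorem neg_mem (h : SimplicialData V U) (hc : V.card = 3 * Fintype.card ι)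
    {v : ι → ℤ} (hv : v ∈ V) : -v ∈ V := by
  set P := convexHull ℝ (intVec '' (V : Set (ι → ℤ))) with hP
  have hnegU : ∀ u ∈ U, -intVec u ∈ dual P := by
    intro u hu
    rw [mem_dual_iff]
    intro v hv
    rw [dotProduct_neg, intVec_dotProduct]
    have := (h.levels_of_card_eq hc hu).2 v hv
    have : ((v ⬝ᵥ u : ℤ) : ℝ) ≤ ((1 : ℤ) : ℝ) := by exact_mod_cast this
    push_cast at this
    linarith
  have hsub : P ⊆ -P := by
    intro x hx
    rw [Set.mem_neg, hP, h.mem_convexHull_iff]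
    intro u hu
    have := hnegU u hu x hx
    rwa [dotProduct_neg, ← neg_dotProduct] at this
  have hneg : -P = P := by
    refine Set.Subset.antisymm (fun x hx => ?_) hsub
    have := hsub hx
    rwa [Set.mem_neg, neg_neg] at this
  have h1 : intVec v ∈ vertices P := by rw [h.vert]; exact ⟨v, hv, rfl⟩
  have h2 : -intVec v ∈ vertices P := by
    have := image_extremePoints (𝕜 := ℝ) (LinearEquiv.neg ℝ (M := ι → ℝ)) P
    have himg : (LinearEquiv.neg ℝ (M := ι → ℝ)) '' P = P := by
      conv_rhs => rw [← hneg]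
      ext x
      simp
    rw [himg] at this
    rw [vertices, ← this]
    exact ⟨_, h1, rfl⟩
  rw [h.vert] at h2
  obtain ⟨v', hv', he⟩ := h2
  have : v' = -v := intVec_injective (he.trans (by ext; simp [intVec]))
  exact this ▸ hv'

/-- The combinatorial structure of a simplicial polytope with the maximal number of vertices:
its vertices are `±e` and `σ e - e` for the elements `e` of a lattice basis and an involution `σ`
of this basis without fixed points. -/
theorem exists_involution (h : SimplicialData V U) (hc : V.card = 3 * Fintype.card ι) :
    ∃ (A : Finset (ι → ℤ)) (g σ : (ι → ℤ) → ι → ℤ), A.card = Fintype.card ι ∧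
      (∀ e ∈ A, e ⬝ᵥ g e = 1) ∧ (∀ e ∈ A, ∀ f ∈ A, f ≠ e → f ⬝ᵥ g e = 0) ∧
      (∀ x : ι → ℝ, (∀ e ∈ A, x ⬝ᵥ intVec (g e) = 0) → x = 0) ∧
      (∀ e ∈ A, σ e ∈ A ∧ σ e ≠ e ∧ σ (σ e) = e) ∧
      (∀ v, v ∈ V ↔ v ∈ A ∨ -v ∈ A ∨ ∃ e ∈ A, v = σ e - e) := by
  classical
  -- Any facet will do; only its existence is taken from this lemma.
  obtain ⟨u, hu, -⟩ := h.exists_le_zero 0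
  obtain ⟨w, hw⟩ := h.exists_neighbours hu
  obtain ⟨φ, hφ, hinj, hφw⟩ := h.exists_map hu hw
  set A := {v ∈ V | v ⬝ᵥ u = -1} with hA
  have hAV : ∀ {e}, e ∈ A → e ∈ V := fun he => (Finset.mem_filter.1 he).1
  have hAu : ∀ {e}, e ∈ A → e ⬝ᵥ u = -1 := fun he => (Finset.mem_filter.1 he).2
  have hφA : ∀ x ∈ V, x ⬝ᵥ u = 0 → φ x ∈ A := fun x hx hxu => by
    have := hφ (show x ∈ {v | v ∈ V ∧ v ⬝ᵥ u = 0} from ⟨hx, hxu⟩)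
    exact Finset.mem_filter.2 this
  have hsurj : ∀ e ∈ A, ∃ x ∈ V, x ⬝ᵥ u = 0 ∧ φ x = e := by
    intro e he
    have hcard : A.card ≤ {v ∈ V | v ⬝ᵥ u = 0}.card := by
      rw [h.card_active hu, (h.levels_of_card_eq hc hu).1]
    have := Finset.surj_on_of_inj_on_of_card_le (s := {v ∈ V | v ⬝ᵥ u = 0}) (t := A)
      (fun x _ => φ x)
      (fun x hx => hφA x (Finset.mem_filter.1 hx).1 (Finset.mem_filter.1 hx).2)
      (fun x y hx hy hxy => hinj (by simpa using hx) (by simpa using hy) hxy) hcard e he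
    obtain ⟨x, hx, rfl⟩ := this
    exact ⟨x, (Finset.mem_filter.1 hx).1, (Finset.mem_filter.1 hx).2, rfl⟩
  -- The level of `e` on its neighbour is 0 or 1. If it were 1, the vertex `-e` would lie on the
  -- neighbour, together with the vertex of level 0 that is mapped to `e`; but there is room for one
  -- only.
  have hwe : ∀ e ∈ A, e ⬝ᵥ w e = 0 := by
    intro e he
    have h0 := (hw e he).2.2
    have h1 := (h.levels_of_card_eq hc (hw e he).1).2 e (hAV he)
    by_contra hne
    have h2 : -e ⬝ᵥ w e = -1 := by rw [neg_dotProduct]; omega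
    obtain ⟨x, hx, hxu, hxe⟩ := hsurj e he
    have h3 : -e ⬝ᵥ u = 1 := by rw [neg_dotProduct, hAu he]; rfl
    have := h.eq_of_mem_neighbour hu hw he hx (h.neg_mem hc (hAV he)) (by rw [hxu]; norm_num)
      (by rw [h3]; norm_num) (hxe ▸ hφw x hx hxu) h2
    rw [this, h3] at hxu
    norm_num at hxu
  -- These integral forms are the basis dual to the facet vertices, so the facet vertices form a
  -- basis of the lattice.
  let g : (ι → ℤ) → ι → ℤ := fun e => w e - u
  have hg1 : ∀ e ∈ A, e ⬝ᵥ g e = 1 := fun e he => by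
    simp only [g]; rw [dotProduct_sub, hwe e he, hAu he]; norm_num
  have hg0 : ∀ e ∈ A, ∀ f ∈ A, f ≠ e → f ⬝ᵥ g e = 0 := fun e he f hf hfe => by
    simp only [g]; rw [dotProduct_sub, (hw e he).2.1 f hf hfe, hAu hf]; norm_num
  have hgrepr : ∀ (x : ι → ℝ) (e : A), x ⬝ᵥ intVec (g e) = (h.facetBasis hu).repr x e := by
    intro x e
    have h1 := h.dotProduct_neighbour hu hw x e
    have h2 : intVec (g e) = intVec (w e) - intVec u := by ext; simp [g, intVec]
    rw [h2, dotProduct_sub, h1, hwe e e.2]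
    push_cast
    ring
  have hinj' : ∀ x : ι → ℝ, (∀ e ∈ A, x ⬝ᵥ intVec (g e) = 0) → x = 0 := by
    intro x hx
    apply (h.facetBasis hu).repr.injective
    ext e
    rw [← hgrepr, hx e e.2]
    simp
  have hinjZ : ∀ x y : ι → ℤ, (∀ e ∈ A, x ⬝ᵥ g e = y ⬝ᵥ g e) → x = y := by
    intro x y hxy
    apply intVec_injective
    rw [← sub_eq_zero]
    refine hinj' _ fun e he => ?_
    rw [sub_dotProduct, intVec_dotProduct, intVec_dotProduct, hxy e he, sub_self]
  have hsumZ : ∀ x : ι → ℤ, ∑ e ∈ A, x ⬝ᵥ g e = -(x ⬝ᵥ u) := by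
    intro x
    have h1 := h.sum_repr_eq hu (intVec x)
    simp_rw [← hgrepr, intVec_dotProduct] at h1
    rw [Finset.sum_coe_sort A (fun e => ((x ⬝ᵥ g e : ℤ) : ℝ))] at h1
    exact_mod_cast h1
  -- The coordinates of `x` in the facet basis are its levels on the neighbours. The one at `φ x` is
  -- -1, the others are 0 or 1, as only one neighbour contains `x`; since they sum to 0, exactly one
  -- of them is 1.
  have hex : ∀ x ∈ V, x ⬝ᵥ u = 0 → ∃ f ∈ A, f ≠ φ x ∧ x = f - φ x := by
    intro x hx hxu
    set e := φ x with he'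
    have he : e ∈ A := hφA x hx hxu
    have hxg : ∀ f, x ⬝ᵥ g f = x ⬝ᵥ w f := fun f => by simp [g, dotProduct_sub, hxu]
    have hxe : x ⬝ᵥ g e = -1 := by rw [hxg]; exact hφw x hx hxu
    have hle : ∀ f ∈ A, x ⬝ᵥ g f ≤ 1 := fun f hf => by
      rw [hxg]; exact (h.levels_of_card_eq hc (hw f hf).1).2 x hx
    have hge : ∀ f ∈ A, f ≠ e → 0 ≤ x ⬝ᵥ g f := by
      intro f hf hfe
      have h1 := h.neg_one_le (hw f hf).1 hx
      rw [hxg]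
      by_contra hlt
      have h2 : x ⬝ᵥ w f = -1 := by omega
      obtain ⟨y, hy, hyu, hyf⟩ := hsurj f hf
      have := h.eq_of_mem_neighbour hu hw hf hx hy (by rw [hxu]; norm_num)
        (by rw [hyu]; norm_num) h2 (hyf ▸ hφw y hy hyu)
      rw [← this] at hyf
      exact hfe (hyf.symm.trans he'.symm)
    have hsum := hsumZ x
    rw [hxu, neg_zero, ← Finset.add_sum_erase A _ he, hxe] at hsum
    have hpos : ∃ f ∈ A.erase e, x ⬝ᵥ g f ≠ 0 := by
      by_contra! h0
      rw [Finset.sum_eq_zero h0] at hsum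
      norm_num at hsum
    obtain ⟨f, hf, hf0⟩ := hpos
    have hfe := Finset.ne_of_mem_erase hf
    have hfA := Finset.mem_of_mem_erase hf
    have hf1 : x ⬝ᵥ g f = 1 := by
      have := hle f hfA
      have := hge f hfA hfe
      omega
    rw [← Finset.add_sum_erase _ _ hf, hf1] at hsum
    have hrest : ∑ z ∈ (A.erase e).erase f, x ⬝ᵥ g z = 0 := by linarith
    rw [Finset.sum_eq_zero_iff_of_nonneg fun z hz =>
      hge z (Finset.mem_of_mem_erase (Finset.mem_of_mem_erase hz))
        (Finset.ne_of_mem_erase (Finset.mem_of_mem_erase hz))] at hrest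
    refine ⟨f, hfA, hfe, hinjZ _ _ fun z hz => ?_⟩
    rw [sub_dotProduct]
    by_cases hze : z = e
    · rw [hze, hxe, hg1 e he, hg0 e he f hfA hfe]; norm_num
    by_cases hzf : z = f
    · rw [hzf, hf1, hg1 f hfA, hg0 f hfA e he (Ne.symm hfe)]; norm_num
    · rw [hrest z (Finset.mem_erase.2 ⟨hzf, Finset.mem_erase.2 ⟨hze, hz⟩⟩),
        hg0 z hz f hfA (Ne.symm hzf), hg0 z hz e he (Ne.symm hze)]
      norm_num
  have hσ : ∀ e ∈ A, ∃ f ∈ A, f ≠ e ∧ f - e ∈ V := by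
    intro e he
    obtain ⟨x, hx, hxu, rfl⟩ := hsurj e he
    obtain ⟨f, hf, hfe, hxf⟩ := hex x hx hxu
    exact ⟨f, hf, hfe, hxf ▸ hx⟩
  have huniq : ∀ e ∈ A, ∀ f ∈ A, ∀ f' ∈ A, f ≠ e → f' ≠ e → f - e ∈ V → f' - e ∈ V → f = f' := by
    intro e he f hf f' hf' hfe hfe' hV hV'
    have hlev : ∀ {f}, f ∈ A → (f - e) ⬝ᵥ u ≠ -1 := fun hf => by
      rw [sub_dotProduct, hAu hf, hAu he]; norm_num
    have hlev' : ∀ {f}, f ∈ A → f ≠ e → (f - e) ⬝ᵥ w e = -1 := fun hf hfe => by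
      rw [sub_dotProduct, (hw e he).2.1 _ hf hfe, hwe e he]; norm_num
    exact sub_left_injective (h.eq_of_mem_neighbour hu hw he hV hV' (hlev hf) (hlev hf')
      (hlev' hf hfe) (hlev' hf' hfe'))
  choose! σ hσA hσe hσV using hσ
  refine ⟨A, g, σ, h.card_active hu, hg1, hg0, hinj', fun e he => ⟨hσA e he, hσe e he, ?_⟩,
    fun v => ⟨fun hv => ?_, ?_⟩⟩
  -- By central symmetry `e - σ e` is a vertex along with `σ e - e`, so uniqueness at `σ e` gives `σ
  -- (σ e) = e`.
  · refine huniq (σ e) (hσA e he) _ (hσA _ (hσA e he)) e he (hσe _ (hσA e he))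
      (Ne.symm (hσe e he)) (hσV _ (hσA e he)) ?_
    have := h.neg_mem hc (hσV e he)
    rwa [neg_sub] at this
  · have h1 := h.neg_one_le hu hv
    have h2 := (h.levels_of_card_eq hc hu).2 v hv
    rcases (by omega : v ⬝ᵥ u = -1 ∨ v ⬝ᵥ u = 0 ∨ v ⬝ᵥ u = 1) with h3 | h3 | h3
    · exact Or.inl (Finset.mem_filter.2 ⟨hv, h3⟩)
    · right; right
      obtain ⟨f, hf, hfe, hxf⟩ := hex v hv h3
      refine ⟨φ v, hφA v hv h3, ?_⟩
      rw [← huniq _ (hφA v hv h3) f hf _ (hσA _ (hφA v hv h3)) hfe (hσe _ (hφA v hv h3))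
        (hxf ▸ hv) (hσV _ (hφA v hv h3))]
      exact hxf
    · exact Or.inr (Or.inl (Finset.mem_filter.2 ⟨h.neg_mem hc hv, by rw [neg_dotProduct, h3]⟩))
  · rintro (hv | hv | ⟨e, he, rfl⟩)
    · exact hAV hv
    · have := h.neg_mem hc (hAV hv)
      rwa [neg_neg] at this
    · exact hσV e he

end SimplicialData

/-! ### Lattice isomorphisms as unimodular matrices. -/

section LatticeIso

variable {ι κ : Type} {P : Set (ι → ℝ)} {Q : Set (κ → ℝ)}

theorem LatticeIso.symm (h : LatticeIso P Q) : LatticeIso Q P := by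
  obtain ⟨e, f, hef, rfl⟩ := h
  refine ⟨e.symm, f.symm, fun n => ?_, ?_⟩
  · rw [LinearEquiv.symm_apply_eq, hef, LinearEquiv.apply_symm_apply]
  · rw [Set.image_image]; simp

theorem LatticeIso.trans {μ : Type} {R : Set (μ → ℝ)} (h : LatticeIso P Q)
    (h' : LatticeIso Q R) : LatticeIso P R := by
  obtain ⟨e, f, hef, rfl⟩ := h
  obtain ⟨e', f', hef', rfl⟩ := h'
  exact ⟨e.trans e', f.trans f', fun n => by simp [hef, hef'], by
    rw [Set.image_image]; rfl⟩

theorem LatticeIso.ncard_vertices (h : LatticeIso P Q) :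
    (vertices P).ncard = (vertices Q).ncard := by
  obtain ⟨e, f, hef, rfl⟩ := h
  have := image_extremePoints (𝕜 := ℝ) f P
  rw [vertices, vertices, ← this, Set.ncard_image_of_injective _ f.injective]

variable [Fintype ι] [Fintype κ] [DecidableEq ι] [DecidableEq κ]

/-- The real extension of an integral matrix. -/
def realMatrix (M : Matrix κ ι ℤ) : Matrix κ ι ℝ := M.map (Int.cast : ℤ → ℝ)

omit [Fintype κ] [DecidableEq ι] [DecidableEq κ] in
theorem realMatrix_mulVec (M : Matrix κ ι ℤ) (n : ι → ℤ) :
    realMatrix M *ᵥ intVec n = intVec (M *ᵥ n) := by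
  ext i
  simp [realMatrix, Matrix.mulVec, dotProduct, intVec]

omit [Fintype κ] [DecidableEq ι] [DecidableEq κ] in
theorem realMatrix_mul {μ : Type} (M : Matrix κ ι ℤ) (N : Matrix ι μ ℤ) :
    realMatrix (M * N) = realMatrix M * realMatrix N := by
  ext i j
  simp [realMatrix, Matrix.mul_apply]

omit [Fintype ι] in
theorem realMatrix_one : realMatrix (1 : Matrix ι ι ℤ) = 1 := by
  ext i j
  simp [realMatrix, Matrix.one_apply]

theorem LatticeIso.of_matrix {M : Matrix κ ι ℤ} {N : Matrix ι κ ℤ} (h1 : M * N = 1)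
    (h2 : N * M = 1) (h : (realMatrix M *ᵥ ·) '' P = Q) : LatticeIso P Q := by
  refine ⟨LinearEquiv.ofLinearMap M.mulVecLin N.mulVecLin ?_ ?_,
    LinearEquiv.ofLinearMap (realMatrix M).mulVecLin (realMatrix N).mulVecLin ?_ ?_, ?_, ?_⟩
  · rw [← Matrix.mulVecLin_mul, h1, Matrix.mulVecLin_one]
  · rw [← Matrix.mulVecLin_mul, h2, Matrix.mulVecLin_one]
  · rw [← Matrix.mulVecLin_mul, ← realMatrix_mul, h1, realMatrix_one, Matrix.mulVecLin_one]
  · rw [← Matrix.mulVecLin_mul, ← realMatrix_mul, h2, realMatrix_one, Matrix.mulVecLin_one]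
  · exact fun n => realMatrix_mulVec M n
  · exact h

theorem LatticeIso.exists_matrix (h : LatticeIso P Q) :
    ∃ (M : Matrix κ ι ℤ) (N : Matrix ι κ ℤ), M * N = 1 ∧ N * M = 1 ∧
      (realMatrix M *ᵥ ·) '' P = Q := by
  obtain ⟨e, f, hef, rfl⟩ := h
  have he : ∀ n, LinearMap.toMatrix' e.toLinearMap *ᵥ n = e n := fun n => by
    rw [← Matrix.toLin'_apply, Matrix.toLin'_toMatrix']; rfl
  refine ⟨LinearMap.toMatrix' e.toLinearMap, LinearMap.toMatrix' e.symm.toLinearMap, ?_, ?_, ?_⟩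
  · rw [← LinearMap.toMatrix'_comp]; simp
  · rw [← LinearMap.toMatrix'_comp]; simp
  -- The real extension is determined by its values on the unit vectors, which are lattice points.
  · have : (realMatrix (LinearMap.toMatrix' e.toLinearMap)).mulVecLin = f.toLinearMap := by
      refine LinearMap.pi_ext' fun i => LinearMap.ext_ring ?_
      have h1 : (LinearMap.single ℝ (fun _ : ι => ℝ) i) 1 = intVec (Pi.single i (1 : ℤ)) := by
        ext j
        by_cases h : j = i
        · subst h; simp [intVec]
        · simp [h, intVec]
      rw [LinearMap.comp_apply, LinearMap.comp_apply, h1, LinearEquiv.coe_coe, hef, ← he]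
      exact realMatrix_mulVec _ _
    congr 1
    ext x
    exact congrFun (congrArg DFunLike.coe this) x ▸ rfl

/-- A lattice isomorphism induces one of the dual polytopes. -/
theorem LatticeIso.dual (h : LatticeIso P Q) : LatticeIso (dual P) (ToricFano.dual Q) := by
  obtain ⟨M, N, h1, h2, rfl⟩ := h.exists_matrix
  have h1' := congrArg realMatrix h1
  have h2' := congrArg realMatrix h2
  rw [realMatrix_mul, realMatrix_one] at h1' h2'
  -- The dual polytope is transformed by the inverse transpose.
  refine LatticeIso.of_matrix (M := N.transpose) (N := M.transpose)
    (by rw [← Matrix.transpose_mul, h1, Matrix.transpose_one])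
    (by rw [← Matrix.transpose_mul, h2, Matrix.transpose_one]) ?_
  have hT : ∀ {μ ν : Type} (K : Matrix μ ν ℤ),
    realMatrix K.transpose = (realMatrix K).transpose := fun K => rfl
  ext z
  constructor
  · rintro ⟨y, hy, rfl⟩ _ ⟨x, hx, rfl⟩
    change -1 ≤ (realMatrix M *ᵥ x) ⬝ᵥ (realMatrix N.transpose *ᵥ y)
    rw [hT, Matrix.dotProduct_mulVec, Matrix.vecMul_transpose, Matrix.mulVec_mulVec, h2',
      Matrix.one_mulVec]
    exact hy x hx
  · intro hz
    refine ⟨realMatrix M.transpose *ᵥ z, fun x hx => ?_, ?_⟩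
    · rw [hT, Matrix.dotProduct_mulVec, Matrix.vecMul_transpose]
      exact hz _ ⟨x, hx, rfl⟩
    · change realMatrix N.transpose *ᵥ (realMatrix M.transpose *ᵥ z) = z
      rw [hT, hT, Matrix.mulVec_mulVec, ← Matrix.transpose_mul, h1', Matrix.transpose_one,
        Matrix.one_mulVec]

omit [Fintype κ] [DecidableEq ι] [DecidableEq κ] in
theorem image_convexHull_matrix (M : Matrix κ ι ℤ) (S : Set (ι → ℤ)) :
    (realMatrix M *ᵥ ·) '' convexHull ℝ (intVec '' S) =
      convexHull ℝ (intVec '' ((M *ᵥ ·) '' S)) := by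
  have := (realMatrix M).mulVecLin.image_convexHull (intVec '' S)
  simp only [Matrix.coe_mulVecLin] at this
  rw [this, Set.image_image, Set.image_image]
  simp_rw [realMatrix_mulVec]

end LatticeIso

/-! ### Free sums of copies of a polytope, dual to products. -/

section FreeSum

/-- The inclusion of the `i`-th summand `ℤ^κ` into `(ℤ^κ)^k`. -/
def embed {R κ : Type} [Zero R] {k : ℕ} (i : Fin k) (m : κ → R) : Fin k × κ → R :=
  fun p => if p.1 = i then m p.2 else 0

theorem intVec_embed {κ : Type} {k : ℕ} (i : Fin k) (m : κ → ℤ) :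
    intVec (embed i m) = embed i (intVec m) := by
  ext p
  by_cases h : p.1 = i <;> simp [embed, intVec, h]

variable {κ : Type} [Fintype κ] {k : ℕ}

theorem embed_dotProduct {R : Type} [CommRing R] (i : Fin k) (m : κ → R) (y : Fin k × κ → R) :
    embed i m ⬝ᵥ y = m ⬝ᵥ fun j => y (i, j) := by
  rw [dotProduct, Fintype.sum_prod_type, Finset.sum_eq_single i]
  · simp [embed, dotProduct]
  · intro j _ hj
    simp [embed, hj]
  · simp

/-- The vertices of the free sum of `k` copies of a polytope with vertices `H`. -/
def freeSum (k : ℕ) (H : Finset (κ → ℤ)) : Set (Fin k × κ → ℤ) :=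
  {v | ∃ i, ∃ m ∈ H, v = embed i m}

/-- A generator in the `i`-th summand pairs only with the `i`-th block of `y`, so the constraints
separate. -/
theorem mem_dual_freeSum {H : Finset (κ → ℤ)} {y : Fin k × κ → ℝ} :
    y ∈ dual (convexHull ℝ (intVec '' freeSum k H)) ↔
      ∀ i, (fun j => y (i, j)) ∈ dual (convexHull ℝ (intVec '' (H : Set (κ → ℤ)))) := by
  simp_rw [mem_dual_convexHull]
  constructor
  · rintro h i _ ⟨m, hm, rfl⟩
    have := h _ ⟨embed i m, ⟨i, m, hm, rfl⟩, rfl⟩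
    rwa [intVec_embed, embed_dotProduct] at this
  · rintro h _ ⟨_, ⟨i, m, hm, rfl⟩, rfl⟩
    rw [intVec_embed, embed_dotProduct]
    exact h i _ ⟨m, hm, rfl⟩

omit [Fintype κ] in
theorem embed_injective {H : Finset (κ → ℤ)} (h0 : (0 : κ → ℤ) ∉ H) :
    Set.InjOn (fun p : Fin k × (κ → ℤ) => embed p.1 p.2) (Set.univ ×ˢ (H : Set (κ → ℤ))) := by
  rintro ⟨i, m⟩ ⟨-, hm⟩ ⟨j, n⟩ ⟨-, hn⟩ h
  simp only at h hm hn
  have hij : i = j := by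
    by_contra hij
    refine h0 ?_
    have : m = 0 := by
      ext l
      have := congrFun h (i, l)
      simpa [embed, hij] using this
    exact this ▸ hm
  subst hij
  refine Prod.ext rfl ?_
  ext l
  have := congrFun h (i, l)
  simpa [embed] using this

omit [Fintype κ] in
theorem freeSum_eq_image (H : Finset (κ → ℤ)) : freeSum k H =
    (fun p : Fin k × (κ → ℤ) => embed p.1 p.2) '' (Set.univ ×ˢ (H : Set (κ → ℤ))) := by
  ext v
  constructor
  · rintro ⟨i, m, hm, rfl⟩
    exact ⟨(i, m), ⟨trivial, hm⟩, rfl⟩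
  · rintro ⟨⟨i, m⟩, ⟨-, hm⟩, rfl⟩
    exact ⟨i, m, hm, rfl⟩

omit [Fintype κ] in
theorem finite_freeSum (H : Finset (κ → ℤ)) : (freeSum k H).Finite := by
  rw [freeSum_eq_image]
  exact (Set.finite_univ.prod H.finite_toSet).image _

omit [Fintype κ] in
theorem ncard_freeSum {H : Finset (κ → ℤ)} (h0 : (0 : κ → ℤ) ∉ H) :
    (freeSum k H).ncard = k * H.card := by
  rw [freeSum_eq_image, (embed_injective h0).ncard_image, Set.ncard_prod,
    Set.ncard_univ, Set.ncard_coe_finset, Nat.card_fin]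

/-- A point of a finite set that is exposed by a point of the dual polytope is a vertex. -/
theorem mem_vertices_of_exposed {ι : Type} [Fintype ι] {S : Set (ι → ℝ)} {s y : ι → ℝ}
    (hs : s ∈ S) (hsy : s ⬝ᵥ y = -1) (h : ∀ x ∈ S, x ≠ s → -1 < x ⬝ᵥ y) :
    s ∈ vertices (convexHull ℝ S) := by
  have hy : y ∈ dual (convexHull ℝ S) := by
    rw [mem_dual_convexHull]
    intro x hx
    by_cases hxs : x = s
    · rw [hxs, hsy]
    · exact (h x hx hxs).le
  have hface := (isFace_of_mem_dual (convex_convexHull ℝ S) hy).1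
  rw [face_eq_convexHull hy] at hface
  have : {x ∈ S | x ⬝ᵥ y = -1} = {s} := by
    ext x
    constructor
    · rintro ⟨hx, hxy⟩
      by_contra hxs
      exact (h x hx hxs).ne' hxy
    · rintro rfl
      exact ⟨hs, hsy⟩
  rwa [this, convexHull_singleton, isExtreme_singleton] at hface

/-- A point exposing a vertex of one summand, extended by 0, still exposes it: the generators in the
other summands take the value 0 > -1. -/
theorem vertices_freeSum {H : Finset (κ → ℤ)}
    (hH : ∀ m ∈ H, ∃ y : κ → ℝ, intVec m ⬝ᵥ y = -1 ∧ ∀ n ∈ H, n ≠ m → -1 < intVec n ⬝ᵥ y) :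
    vertices (convexHull ℝ (intVec '' freeSum k H)) = intVec '' freeSum k H := by
  refine Set.Subset.antisymm extremePoints_convexHull_subset ?_
  rintro _ ⟨_, ⟨i, m, hm, rfl⟩, rfl⟩
  obtain ⟨y, hy, hy'⟩ := hH m hm
  refine mem_vertices_of_exposed (y := embed i y) ⟨_, ⟨i, m, hm, rfl⟩, rfl⟩ ?_ ?_
  · rw [intVec_embed, embed_dotProduct]
    simpa [embed] using hy
  · rintro _ ⟨_, ⟨j, n, hn, rfl⟩, rfl⟩ hne
    rw [intVec_embed, embed_dotProduct]
    by_cases hij : j = i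
    · subst hij
      simpa [embed] using hy' n hn (by rintro rfl; exact hne rfl)
    · simp [embed, hij, dotProduct]

/-- The hull contains all vectors ±e_p, hence the cross polytope, and this contains the ball of
radius 1/n of the sup norm in dimension n. -/
theorem zero_mem_interior_freeSum [Nonempty (Fin k × κ)] [DecidableEq κ] {H : Finset (κ → ℤ)}
    (h1 : ∀ j, Pi.single j 1 ∈ H) (h2 : ∀ j, -Pi.single j 1 ∈ H) :
    (0 : Fin k × κ → ℝ) ∈ interior (convexHull ℝ (intVec '' freeSum k H)) := by
  set C := convexHull ℝ (intVec '' freeSum k H) with hC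
  set n : ℝ := (Fintype.card (Fin k × κ) : ℝ) with hn
  have hnpos : 0 < n := by rw [hn]; exact_mod_cast Fintype.card_pos
  have hsingle : ∀ (p : Fin k × κ) (c : ℤ), intVec (embed p.1 (Pi.single p.2 c)) =
      Pi.single p (c : ℝ) := by
    rintro ⟨i, j⟩ c
    ext ⟨i', j'⟩
    by_cases hi : i' = i
    · subst hi
      by_cases hj : j' = j
      · subst hj; simp [intVec, embed]
      · simp [intVec, embed, hj]
    · simp [intVec, embed, hi]
  have hpos : ∀ p : Fin k × κ, Pi.single p (1 : ℝ) ∈ C := fun p => by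
    refine subset_convexHull ℝ _ ⟨_, ⟨p.1, _, h1 p.2, rfl⟩, ?_⟩
    rw [hsingle]; simp
  have hneg : ∀ p : Fin k × κ, Pi.single p (-1 : ℝ) ∈ C := fun p => by
    refine subset_convexHull ℝ _ ⟨_, ⟨p.1, _, h2 p.2, rfl⟩, ?_⟩
    rw [← Pi.single_neg, hsingle]; simp
  rw [mem_interior]
  refine ⟨Metric.ball 0 n⁻¹, fun x hx => ?_, Metric.isOpen_ball, Metric.mem_ball_self (by positivity)⟩
  rw [mem_ball_zero_iff, pi_norm_lt_iff (by positivity)] at hx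
  have hx' : x = ∑ p, n⁻¹ • (Pi.single p (n * x p) : Fin k × κ → ℝ) := by
    ext q
    rw [Finset.sum_apply, Finset.sum_eq_single q]
    · simp [hnpos.ne']
    · intro p _ hp
      simp [Ne.symm hp]
    · simp
  rw [hx']
  refine (convex_convexHull ℝ _).sum_mem (fun _ _ => by positivity) ?_ fun p _ => ?_
  · rw [Finset.sum_const, Finset.card_univ, nsmul_eq_mul, ← hn, mul_inv_cancel₀ hnpos.ne']
  · have h3 := abs_lt.1 (Real.norm_eq_abs _ ▸ hx p)
    have h4 : n * x p < 1 := by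
      have := mul_lt_mul_of_pos_left h3.2 hnpos
      rwa [mul_inv_cancel₀ hnpos.ne'] at this
    have h5 : -1 < n * x p := by
      have := mul_lt_mul_of_pos_left h3.1 hnpos
      rwa [mul_neg, mul_inv_cancel₀ hnpos.ne'] at this
    have h6 := (convex_convexHull ℝ (intVec '' freeSum k H)) (hpos p) (hneg p)
      (a := (1 + n * x p) / 2) (b := (1 - n * x p) / 2) (by linarith) (by linarith) (by ring)
    convert h6 using 1
    ext q
    by_cases hq : q = p
    · subst hq; simp; ring
    · simp [hq]

/-- The dual is a product, and forming convex hulls commutes with products; a tuple of lattice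
points is a lattice point. -/
theorem dual_freeSum_subset {H : Finset (κ → ℤ)}
    (hH : dual (convexHull ℝ (intVec '' (H : Set (κ → ℤ)))) ⊆
      convexHull ℝ (dual (convexHull ℝ (intVec '' (H : Set (κ → ℤ)))) ∩ latticePoints κ)) :
    dual (convexHull ℝ (intVec '' freeSum k H)) ⊆
      convexHull ℝ (dual (convexHull ℝ (intVec '' freeSum k H)) ∩ latticePoints (Fin k × κ)) := by
  intro y hy
  rw [mem_dual_freeSum] at hy
  let L := LinearEquiv.curry ℝ ℝ (Fin k) κ
  have h1 : L y ∈ convexHull ℝ (Set.univ.pi fun _ : Fin k =>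
      dual (convexHull ℝ (intVec '' (H : Set (κ → ℤ)))) ∩ latticePoints κ) := by
    rw [convexHull_pi]
    exact fun i _ => hH (hy i)
  have h2 := L.symm.toLinearMap.image_convexHull (Set.univ.pi fun _ : Fin k =>
      dual (convexHull ℝ (intVec '' (H : Set (κ → ℤ)))) ∩ latticePoints κ)
  have h3 : y ∈ L.symm.toLinearMap '' convexHull ℝ (Set.univ.pi fun _ : Fin k =>
      dual (convexHull ℝ (intVec '' (H : Set (κ → ℤ)))) ∩ latticePoints κ) :=
    ⟨L y, h1, L.symm_apply_apply y⟩
  rw [h2] at h3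
  refine convexHull_mono ?_ h3
  rintro _ ⟨z, hz, rfl⟩
  refine ⟨mem_dual_freeSum.2 fun i => (hz i trivial).1, ?_⟩
  choose n hn using fun i => (hz i trivial).2
  refine ⟨fun p => n p.1 p.2, ?_⟩
  ext p
  exact congrFun (hn p.1) p.2

end FreeSum

/-! ### The hexagon, its dual, and free sums of hexagons. -/

section Hexagon

/-- The vertices of the hexagon `Z₂`. -/
def hexagon : Finset (Fin 2 → ℤ) :=
  {![1, 0], ![0, 1], ![1, 1], -![1, 0], -![0, 1], -![1, 1]}

theorem card_hexagon : hexagon.card = 6 := by decide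

theorem zero_notMem_hexagon : (0 : Fin 2 → ℤ) ∉ hexagon := by decide

theorem single_mem_hexagon (j : Fin 2) : Pi.single j 1 ∈ hexagon := by
  fin_cases j <;> decide

theorem neg_single_mem_hexagon (j : Fin 2) : -Pi.single j 1 ∈ hexagon := by
  fin_cases j <;> decide

theorem intVec_two (a b : ℤ) : intVec ![a, b] = ![(a : ℝ), (b : ℝ)] := by
  ext i; fin_cases i <;> simp [intVec]

theorem intVec_neg {ι : Type} (n : ι → ℤ) : intVec (-n) = -intVec n := by
  ext i; simp [intVec]

theorem mem_dual_hexagon {y : Fin 2 → ℝ} :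
    y ∈ dual (convexHull ℝ (intVec '' (hexagon : Set (Fin 2 → ℤ)))) ↔
      (-1 ≤ y 0 ∧ y 0 ≤ 1) ∧ (-1 ≤ y 1 ∧ y 1 ≤ 1) ∧ (-1 ≤ y 0 + y 1 ∧ y 0 + y 1 ≤ 1) := by
  rw [mem_dual_convexHull]
  simp only [hexagon, Finset.coe_insert, Finset.coe_singleton, Set.forall_mem_image,
    Set.mem_insert_iff, Set.mem_singleton_iff, forall_eq_or_imp, forall_eq, intVec_neg,
    intVec_two, neg_dotProduct]
  simp [dotProduct, Fin.sum_univ_two]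
  constructor
  · rintro ⟨h1, h2, h3, h4, h5, h6⟩
    refine ⟨⟨?_, ?_⟩, ⟨?_, ?_⟩, ?_, ?_⟩ <;> linarith
  · rintro ⟨⟨h1, h2⟩, ⟨h3, h4⟩, h5, h6⟩
    refine ⟨?_, ?_, ?_, ?_, ?_, ?_⟩ <;> linarith

theorem hexagon_exposed : ∀ m ∈ hexagon, ∃ y : Fin 2 → ℝ, intVec m ⬝ᵥ y = -1 ∧
    ∀ n ∈ hexagon, n ≠ m → -1 < intVec n ⬝ᵥ y := by
  have key : ∀ m ∈ ({![1, 0], ![0, 1], ![1, 1]} : Finset (Fin 2 → ℤ)), ∃ y : Fin 2 → ℝ,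
      intVec m ⬝ᵥ y = -1 ∧ ∀ n ∈ hexagon, n ≠ m → -1 < intVec n ⬝ᵥ y := by
    intro m hm
    simp only [Finset.mem_insert, Finset.mem_singleton] at hm
    rcases hm with rfl | rfl | rfl
    · refine ⟨![-1, 1 / 2], ?_, ?_⟩
      · rw [intVec_two]; simp
      · intro n hn hne
        simp only [hexagon, Finset.mem_insert, Finset.mem_singleton] at hn
        rcases hn with rfl | rfl | rfl | rfl | rfl | rfl
        · exact absurd rfl hne
        all_goals (simp only [intVec_neg, intVec_two, neg_dotProduct]; simp; try norm_num)
    · refine ⟨![1 / 2, -1], ?_, ?_⟩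
      · rw [intVec_two]; simp
      · intro n hn hne
        simp only [hexagon, Finset.mem_insert, Finset.mem_singleton] at hn
        rcases hn with rfl | rfl | rfl | rfl | rfl | rfl
        rotate_left
        · exact absurd rfl hne
        all_goals (simp only [intVec_neg, intVec_two, neg_dotProduct]; simp; try norm_num)
    · refine ⟨![-1 / 2, -1 / 2], ?_, ?_⟩
      · rw [intVec_two]; norm_num
      · intro n hn hne
        simp only [hexagon, Finset.mem_insert, Finset.mem_singleton] at hn
        rcases hn with rfl | rfl | rfl | rfl | rfl | rfl
        rotate_left 2
        · exact absurd rfl hne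
        all_goals (simp only [intVec_neg, intVec_two, neg_dotProduct]; simp; try norm_num)
  have hneg : ∀ n ∈ hexagon, -n ∈ hexagon := by decide
  intro m hm
  have hm' : m ∈ ({![1, 0], ![0, 1], ![1, 1]} : Finset (Fin 2 → ℤ)) ∨
      -m ∈ ({![1, 0], ![0, 1], ![1, 1]} : Finset (Fin 2 → ℤ)) := by
    revert m; decide
  rcases hm' with h | h
  · exact key m h
  · obtain ⟨y, hy, hy'⟩ := key (-m) h
    refine ⟨-y, ?_, fun n hn hne => ?_⟩
    · rw [dotProduct_neg, ← neg_dotProduct, ← intVec_neg, hy]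
    · have := hy' (-n) (hneg n hn) (fun h => hne (neg_injective h))
      rwa [dotProduct_neg, ← neg_dotProduct, ← intVec_neg]

theorem convexHull_hexagon : convexHull ℝ (intVec '' (hexagon : Set (Fin 2 → ℤ))) = Z2 := by
  have hsub : ∀ m ∈ hexagon, intVec m ∈ Set.Icc (0 : Fin 2 → ℝ) 1 ∪ -Set.Icc (0 : Fin 2 → ℝ) 1 := by
    intro m hm
    simp only [hexagon, Finset.mem_insert, Finset.mem_singleton] at hm
    rcases hm with rfl | rfl | rfl | rfl | rfl | rfl
    · left; rw [intVec_two]; constructor <;> intro i <;> fin_cases i <;> simp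
    · left; rw [intVec_two]; constructor <;> intro i <;> fin_cases i <;> simp
    · left; rw [intVec_two]; constructor <;> intro i <;> fin_cases i <;> simp
    all_goals right; rw [Set.mem_neg, intVec_neg, neg_neg, intVec_two]
    all_goals constructor <;> intro i <;> fin_cases i <;> simp
  refine Set.Subset.antisymm (convexHull_mono ?_) (convexHull_min ?_ (convex_convexHull ℝ _))
  · rintro _ ⟨m, hm, rfl⟩
    exact hsub m hm
  set C := convexHull ℝ (intVec '' (hexagon : Set (Fin 2 → ℤ))) with hC
  have hCc : Convex ℝ C := convex_convexHull ℝ _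
  have hmem : ∀ m ∈ hexagon, intVec m ∈ C := fun m hm => subset_convexHull ℝ _ ⟨m, hm, rfl⟩
  have hCneg : ∀ x ∈ C, -x ∈ C := by
    intro x hx
    have h1 : C ⊆ -C := by
      refine convexHull_min ?_ hCc.neg
      rintro _ ⟨m, hm, rfl⟩
      rw [Set.mem_neg, ← intVec_neg]
      refine hmem _ ?_
      revert m; decide
    exact h1 hx
  have h0 : (0 : Fin 2 → ℝ) ∈ C := by
    have h1 := hmem ![1, 0] (by decide)
    have := hCc h1 (hCneg _ h1) (a := 1 / 2) (b := 1 / 2) (by norm_num) (by norm_num) (by norm_num)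
    simpa using this
  have hIcc : Set.Icc (0 : Fin 2 → ℝ) 1 ⊆ C := by
    intro x hx
    have hx0 := hx.1 0
    have hx1 := hx.1 1
    have hx0' := hx.2 0
    have hx1' := hx.2 1
    simp only [Pi.zero_apply, Pi.one_apply] at hx0 hx1 hx0' hx1'
    have key : ∀ (a b c : ℝ) (p q : Fin 2 → ℝ), p ∈ C → q ∈ C → 0 ≤ a → 0 ≤ b → 0 ≤ c →
        a + b + c = 1 → a • p + b • q + c • (0 : Fin 2 → ℝ) ∈ C := by
      intro a b c p q hp hq ha hb hc habc
      have := hCc.sum_mem (t := Finset.univ) (w := ![a, b, c]) (z := ![p, q, 0])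
        (by intro i _; fin_cases i <;> simpa) (by simp [Fin.sum_univ_three, habc])
        (by intro i _; fin_cases i <;> simpa)
      simpa [Fin.sum_univ_three] using this
    have h1 := hmem ![1, 0] (by decide)
    have h2 := hmem ![0, 1] (by decide)
    have h3 := hmem ![1, 1] (by decide)
    rw [intVec_two] at h1 h2 h3
    -- The diagonal divides the square into two triangles with a vertex at the origin.
    rcases le_total (x 0) (x 1) with h | h
    · have := key (x 0) (x 1 - x 0) (1 - x 1) _ _ h3 h2 hx0 (by linarith) (by linarith) (by ring)
      convert this using 1
      ext i; fin_cases i <;> simp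
    · have := key (x 1) (x 0 - x 1) (1 - x 0) _ _ h3 h1 hx1 (by linarith) (by linarith) (by ring)
      convert this using 1
      ext i; fin_cases i <;> simp
  rintro x (hx | hx)
  · exact hIcc hx
  · have := hCneg _ (hIcc hx)
    rwa [neg_neg] at this

theorem mem_Z2_iff {x : Fin 2 → ℝ} :
    x ∈ Z2 ↔ (-1 ≤ x 0 ∧ x 0 ≤ 1) ∧ (-1 ≤ x 1 ∧ x 1 ≤ 1) ∧ (-1 ≤ x 0 - x 1 ∧ x 0 - x 1 ≤ 1) := by
  constructor
  · intro hx
    have : Z2 ⊆ {x : Fin 2 → ℝ | (-1 ≤ x 0 ∧ x 0 ≤ 1) ∧ (-1 ≤ x 1 ∧ x 1 ≤ 1) ∧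
        (-1 ≤ x 0 - x 1 ∧ x 0 - x 1 ≤ 1)} := by
      refine convexHull_min ?_ ?_
      · rintro x (⟨h0, h1⟩ | ⟨h0, h1⟩)
        · have h00 := h0 0
          have h01 := h0 1
          have h10 := h1 0
          have h11 := h1 1
          simp only [Pi.zero_apply, Pi.one_apply] at h00 h01 h10 h11
          refine ⟨⟨?_, ?_⟩, ⟨?_, ?_⟩, ?_, ?_⟩ <;> linarith
        · have h00 := h0 0
          have h01 := h0 1
          have h10 := h1 0
          have h11 := h1 1
          simp only [Pi.zero_apply, Pi.one_apply, Pi.neg_apply] at h00 h01 h10 h11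
          refine ⟨⟨?_, ?_⟩, ⟨?_, ?_⟩, ?_, ?_⟩ <;> linarith
      · rintro x ⟨⟨h1, h2⟩, ⟨h3, h4⟩, h5, h6⟩ y ⟨⟨g1, g2⟩, ⟨g3, g4⟩, g5, g6⟩ a b ha hb hab
        simp only [Set.mem_ofPred_eq, Pi.add_apply, Pi.smul_apply, smul_eq_mul]
        refine ⟨⟨?_, ?_⟩, ⟨?_, ?_⟩, ?_, ?_⟩ <;> nlinarith
    exact this hx
  · rintro ⟨⟨h1, h2⟩, ⟨h3, h4⟩, h5, h6⟩
    -- By the bipolar theorem it suffices to bound the pairing of `x` with the dual hexagon; the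
    -- signs of `x 0`, `x 1` and `x 0 - x 1` decide which inequalities to combine.
    rw [← convexHull_hexagon, ← dual_dual (convex_convexHull ℝ _)
      ((hexagon.finite_toSet.image _).isCompact_convexHull ℝ).isClosed]
    · intro y hy
      rw [mem_dual_hexagon] at hy
      obtain ⟨⟨g1, g2⟩, ⟨g3, g4⟩, g5, g6⟩ := hy
      rw [dotProduct, Fin.sum_univ_two]
      rcases le_total 0 (x 0) with p | p <;> rcases le_total 0 (x 1) with q | q <;>
        rcases le_total (x 0) (x 1) with r | r <;> nlinarith
    · rw [convexHull_hexagon]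
      exact subset_convexHull ℝ _ (Or.inl ⟨le_rfl, zero_le_one⟩)

/-- The reflection (a, b) ↦ (a, -b) exchanges the dual hexagon and the hexagon, so the vertices of
the dual are lattice points too. -/
theorem dual_hexagon_subset :
    dual (convexHull ℝ (intVec '' (hexagon : Set (Fin 2 → ℤ)))) ⊆
      convexHull ℝ (dual (convexHull ℝ (intVec '' (hexagon : Set (Fin 2 → ℤ)))) ∩
        latticePoints (Fin 2)) := by
  intro y hy
  have hr : ∀ m : Fin 2 → ℤ, realMatrix !![1, 0; 0, -1] *ᵥ intVec m = intVec ![m 0, -m 1] :=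
    fun m => by
      rw [realMatrix_mulVec]; congr 1; ext i
      fin_cases i <;> simp [Matrix.mulVec, dotProduct, Fin.sum_univ_two]
  have hr' : ∀ z : Fin 2 → ℝ, realMatrix !![1, 0; 0, -1] *ᵥ z = ![z 0, -z 1] := fun z => by
    ext i
    fin_cases i <;> simp [realMatrix, Matrix.mulVec, dotProduct, Fin.sum_univ_two]
  have h1 : ![y 0, -y 1] ∈ convexHull ℝ (intVec '' (hexagon : Set (Fin 2 → ℤ))) := by
    rw [convexHull_hexagon, mem_Z2_iff]
    rw [mem_dual_hexagon] at hy
    obtain ⟨a, ⟨b, c⟩, d⟩ := hy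
    simpa using ⟨a, ⟨c, by linarith⟩, d⟩
  have h2 : y ∈ (realMatrix !![1, 0; 0, -1] *ᵥ ·) ''
      convexHull ℝ (intVec '' (hexagon : Set (Fin 2 → ℤ))) := by
    refine ⟨_, h1, (hr' _).trans ?_⟩
    ext i; fin_cases i <;> simp
  rw [image_convexHull_matrix] at h2
  refine convexHull_mono ?_ h2
  rintro _ ⟨_, ⟨m, hm, rfl⟩, rfl⟩
  refine ⟨?_, ⟨_, rfl⟩⟩
  rw [← realMatrix_mulVec, hr, intVec_two, mem_dual_hexagon]
  have : ∀ m ∈ hexagon, (-1 ≤ m 0 ∧ m 0 ≤ 1) ∧ (-1 ≤ -m 1 ∧ -m 1 ≤ 1) ∧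
      (-1 ≤ m 0 + -m 1 ∧ m 0 + -m 1 ≤ 1) := by decide
  have := this m hm
  simp only [Matrix.cons_val_zero, Matrix.cons_val_one]
  exact_mod_cast this

/-- The free sum of `k` hexagons, dual to `(Z₂)^k`. -/
def hexagonSum (k : ℕ) : Set (Fin k × Fin 2 → ℝ) :=
  convexHull ℝ (intVec '' freeSum k hexagon)

theorem ncard_vertices_hexagonSum (k : ℕ) : (vertices (hexagonSum k)).ncard = 6 * k := by
  rw [hexagonSum, vertices_freeSum hexagon_exposed, intVec_injective.injOn.ncard_image,
    ncard_freeSum zero_notMem_hexagon, card_hexagon, mul_comm]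

theorem zero_mem_interior_hexagonSum {k : ℕ} (hk : k ≠ 0) :
    (0 : Fin k × Fin 2 → ℝ) ∈ interior (hexagonSum k) := by
  have : NeZero k := ⟨hk⟩
  have : Nonempty (Fin k × Fin 2) := ⟨(0, 0)⟩
  exact zero_mem_interior_freeSum single_mem_hexagon neg_single_mem_hexagon

/-- The inequalities of the dual hexagon involve the sum of the coordinates where those of `Z2`
involve the difference; the sign change in every second coordinate turns one into the other. -/
theorem latticeIso_dual_hexagonSum (k : ℕ) : LatticeIso (dual (hexagonSum k)) (Z2pow k) := by
  let s : Fin k × Fin 2 → ℤ := fun p => if p.2 = 0 then 1 else -1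
  have hs : Matrix.diagonal s * Matrix.diagonal s = 1 := by
    rw [Matrix.diagonal_mul_diagonal, ← Matrix.diagonal_one]
    congr 1
    ext p
    simp only [s]
    split <;> norm_num
  refine LatticeIso.of_matrix hs hs ?_
  have hsv : ∀ (y : Fin k × Fin 2 → ℝ) p, (realMatrix (Matrix.diagonal s) *ᵥ y) p = s p * y p := by
    intro y p
    have : realMatrix (Matrix.diagonal s) = Matrix.diagonal fun p => (s p : ℝ) := by
      ext p q
      by_cases h : p = q
      · subst h; simp [realMatrix]
      · simp [realMatrix, h]
    rw [this, Matrix.mulVec_diagonal]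
  have hmem : ∀ y, realMatrix (Matrix.diagonal s) *ᵥ y ∈ Z2pow k ↔ y ∈ dual (hexagonSum k) := by
    intro y
    rw [hexagonSum, mem_dual_freeSum]
    refine forall_congr' fun i => ?_
    rw [mem_Z2_iff, mem_dual_hexagon]
    simp only [hsv, s]
    simp only [↓reduceIte, one_ne_zero, Int.cast_one, one_mul, Int.cast_neg, neg_mul,
      sub_neg_eq_add]
    refine and_congr_right fun _ => and_congr_left fun _ => ?_
    constructor <;> rintro ⟨h1, h2⟩ <;> constructor <;> linarith
  ext z
  constructor
  · rintro ⟨y, hy, rfl⟩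
    exact (hmem y).2 hy
  · intro hz
    have hinv : realMatrix (Matrix.diagonal s) *ᵥ (realMatrix (Matrix.diagonal s) *ᵥ z) = z := by
      rw [Matrix.mulVec_mulVec, ← realMatrix_mul, hs, realMatrix_one, Matrix.one_mulVec]
    exact ⟨realMatrix (Matrix.diagonal s) *ᵥ z, (hmem _).1 (by rwa [hinv]), hinv⟩

/-- Dualize both sides. The bidual of the hexagon sum is the sum itself only for `k ≠ 0`, because
for `k = 0` the convex hull is empty and misses the origin. -/
theorem latticeIso_hexagonSum_iff {ι : Type} [Fintype ι] [DecidableEq ι] {P : Set (ι → ℝ)}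
    (hc : Convex ℝ P) (hcl : IsClosed P) (h0 : (0 : ι → ℝ) ∈ P) {k : ℕ} (hk : k ≠ 0) :
    LatticeIso (dual P) (Z2pow k) ↔ LatticeIso P (hexagonSum k) := by
  constructor
  · intro h
    have := (h.trans (latticeIso_dual_hexagonSum k).symm).dual
    rwa [dual_dual hc hcl h0, dual_dual (P := hexagonSum k) (convex_convexHull ℝ _)
      (((finite_freeSum hexagon).image _).isCompact_convexHull ℝ).isClosed
      (interior_subset (zero_mem_interior_hexagonSum hk))] at this
  · exact fun h => h.dual.trans (latticeIso_dual_hexagonSum k)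

end Hexagon

/-! ### From the involution to a free sum of hexagons. -/

section Equality

/-- An involution without fixed points of a finite set pairs its elements. -/
theorem exists_pairing {α : Type} [Countable α] (A : Finset α) (σ : α → α)
    (hσ : ∀ e ∈ A, σ e ∈ A ∧ σ e ≠ e ∧ σ (σ e) = e) :
    ∃ (k : ℕ) (t : Fin k → α), 2 * k = A.card ∧ (∀ i, t i ∈ A) ∧ Function.Injective t ∧
      (∀ i j, t i ≠ σ (t j)) ∧ ∀ e ∈ A, ∃ i, e = t i ∨ e = σ (t i) := by
  classical
  -- The numbering serves to choose from each orbit the element with the smaller number.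
  obtain ⟨r, hr⟩ := exists_injective_nat α
  set T := {e ∈ A | r e < r (σ e)} with hT
  have hnot : {e ∈ A | ¬ r e < r (σ e)} = T.image σ := by
    ext e
    rw [Finset.mem_filter, Finset.mem_image]
    constructor
    · rintro ⟨he, hlt⟩
      obtain ⟨h1, h2, h3⟩ := hσ e he
      refine ⟨σ e, Finset.mem_filter.2 ⟨h1, ?_⟩, h3⟩
      rw [h3]
      exact lt_of_le_of_ne (not_lt.1 hlt) fun h => h2 (hr h)
    · rintro ⟨f, hf, rfl⟩
      rw [hT, Finset.mem_filter] at hf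
      obtain ⟨h1, h2, h3⟩ := hσ f hf.1
      exact ⟨h1, by rw [h3]; exact not_lt.2 hf.2.le⟩
  have hcard : 2 * T.card = A.card := by
    rw [← Finset.card_filter_add_card_filter_not (s := A) (fun e => r e < r (σ e)), hnot,
      Finset.card_image_of_injOn, two_mul]
    intro e he f hf hef
    rw [← (hσ e (Finset.mem_filter.1 he).1).2.2, ← (hσ f (Finset.mem_filter.1 hf).1).2.2]
    exact congrArg σ hef
  let t : Fin T.card → α := fun i => (T.equivFin.symm i : α)
  have htT : ∀ i, t i ∈ T := fun i => (T.equivFin.symm i).2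
  refine ⟨T.card, t, hcard, fun i => (Finset.mem_filter.1 (htT i)).1,
    Subtype.val_injective.comp T.equivFin.symm.injective, fun i j h => ?_, fun e he => ?_⟩
  · have h1 := (Finset.mem_filter.1 (htT i)).2
    have h2 := (Finset.mem_filter.1 (htT j)).2
    rw [h, (hσ _ (Finset.mem_filter.1 (htT j)).1).2.2] at h1
    exact absurd h1 (not_lt.2 h2.le)
  · by_cases h : r e < r (σ e)
    · exact ⟨T.equivFin ⟨e, Finset.mem_filter.2 ⟨he, h⟩⟩, Or.inl (by simp [t])⟩
    · have : e ∈ T.image σ := hnot ▸ Finset.mem_filter.2 ⟨he, h⟩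
      obtain ⟨f, hf, rfl⟩ := Finset.mem_image.1 this
      exact ⟨T.equivFin ⟨f, hf⟩, Or.inr (by simp [t])⟩

/-- An orbit {t, σ t} contributes the six vertices ±t, ±σ t and ±(t - σ t), a hexagon in the plane
of t and σ t. Together the orbits exhaust the lattice basis. -/
theorem SimplicialData.latticeIso {ι : Type} [Fintype ι] [DecidableEq ι] {V U : Finset (ι → ℤ)}
    (h : SimplicialData V U) (hc : V.card = 3 * Fintype.card ι) :
    ∃ k, 2 * k = Fintype.card ι ∧
      LatticeIso (convexHull ℝ (intVec '' (V : Set (ι → ℤ)))) (hexagonSum k) := by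
  obtain ⟨A, g, σ, hA, hg1, hg0, -, hσ, hV⟩ := h.exists_involution hc
  obtain ⟨k, t, hk, htA, htinj, htσ, hsurj⟩ := exists_pairing A σ hσ
  refine ⟨k, hk.trans hA, ?_⟩
  -- The sign is chosen so that the vertex (1, 1) of the hexagon goes to the vertex `t i - σ (t i)`
  -- of P. The dual basis `G` carries the same sign.
  let B : Fin k × Fin 2 → ι → ℤ := fun p => if p.2 = 0 then t p.1 else -σ (t p.1)
  let G : Fin k × Fin 2 → ι → ℤ := fun p => if p.2 = 0 then g (t p.1) else -g (σ (t p.1))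
  have hBG : ∀ p q, B q ⬝ᵥ G p = if p = q then 1 else 0 := by
    rintro ⟨i, a⟩ ⟨j, b⟩
    have hσA : ∀ i, σ (t i) ∈ A := fun i => (hσ _ (htA i)).1
    have hσinj : ∀ i j, σ (t i) = σ (t j) → i = j := fun i j hij => htinj (by
      rw [← (hσ _ (htA i)).2.2, hij, (hσ _ (htA j)).2.2])
    fin_cases a <;> fin_cases b <;> simp [B, G]
    · by_cases hij : i = j
      · subst hij; simp [hg1 _ (htA i)]
      · rw [if_neg hij, hg0 _ (htA i) _ (htA j) fun h => hij (htinj h).symm]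
    · exact hg0 _ (htA i) _ (hσA j) (htσ i j).symm
    · exact hg0 _ (hσA i) _ (htA j) (htσ j i)
    · by_cases hij : i = j
      · subst hij; simp [hg1 _ (hσA i)]
      · rw [if_neg hij, hg0 _ (hσA i) _ (hσA j) fun h => hij (hσinj _ _ h).symm]
  let N : Matrix ι (Fin k × Fin 2) ℤ := Matrix.of fun i p => B p i
  let M : Matrix (Fin k × Fin 2) ι ℤ := Matrix.of G
  have hMN : M * N = 1 := by
    ext p q
    rw [Matrix.mul_apply, Matrix.one_apply, ← hBG p q, dotProduct_comm]
    rfl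
  have hNM : N * M = 1 := by
    rw [Matrix.mul_eq_one_comm_of_card_eq]
    · exact hMN
    · rw [Fintype.card_prod, Fintype.card_fin, Fintype.card_fin, mul_comm, hk, hA]
  refine (LatticeIso.of_matrix hNM hMN ?_).symm
  rw [hexagonSum, image_convexHull_matrix]
  congr 2
  have hN : ∀ (i : Fin k) (m : Fin 2 → ℤ), N *ᵥ embed i m = m 0 • t i - m 1 • σ (t i) := by
    intro i m
    ext l
    rw [Matrix.mulVec, dotProduct_comm, embed_dotProduct, dotProduct, Fin.sum_univ_two]
    simp [N, B]
    ring
  have hσσ : ∀ i, σ (σ (t i)) = t i := fun i => (hσ _ (htA i)).2.2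
  have hσA : ∀ i, σ (t i) ∈ A := fun i => (hσ _ (htA i)).1
  ext v
  rw [Finset.mem_coe, hV]
  constructor
  · rintro ⟨_, ⟨i, m, hm, rfl⟩, rfl⟩
    simp only [hN]
    simp only [hexagon, Finset.mem_insert, Finset.mem_singleton] at hm
    rcases hm with rfl | rfl | rfl | rfl | rfl | rfl
    · left; simpa using htA i
    · right; left; simpa using hσA i
    · right; right; exact ⟨σ (t i), hσA i, by simp [hσσ]⟩
    · right; left; simpa using htA i
    · left; simpa using hσA i
    · right; right; exact ⟨t i, htA i, by simp; abel⟩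
  · have key : ∀ i, ∀ m ∈ hexagon, v = m 0 • t i - m 1 • σ (t i) →
        v ∈ (N *ᵥ ·) '' freeSum k hexagon := fun i m hm hv =>
      ⟨embed i m, ⟨i, m, hm, rfl⟩, (hN i m).trans hv.symm⟩
    rintro (hv | hv | ⟨e, he, rfl⟩)
    · obtain ⟨i, rfl | rfl⟩ := hsurj v hv
      · exact key i ![1, 0] (by decide) (by simp)
      · exact key i (-![0, 1]) (by decide) (by simp)
    · obtain ⟨i, hi | hi⟩ := hsurj _ hv
      · exact key i (-![1, 0]) (by decide) (by rw [← hi]; simp)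
      · exact key i ![0, 1] (by decide) (by rw [← hi]; simp)
    · obtain ⟨i, rfl | rfl⟩ := hsurj e he
      · exact key i (-![1, 1]) (by decide) (by simp; abel)
      · exact key i ![1, 1] (by decide) (by simp [hσσ])

end Equality

/-! ### Reduction of a simplicial reflexive polytope to its finite vertex sets. -/

section Reflexive

/-- In dimension 0 the only vertex is 0, which is not primitive. This is where `d ≠ 0` comes from.
-/
theorem IsFanoPolytope.nonempty_index {ι : Type} [Fintype ι] {P : Set (ι → ℝ)}
    (hP : IsFanoPolytope P) : Nonempty ι := by
  by_contra hne
  rw [not_nonempty_iff] at hne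
  obtain ⟨⟨hpoly, hlat⟩, h0, hprim⟩ := hP
  have hv : (vertices P).Nonempty := by
    have h1 := hpoly.eq_convexHull.2
    have h2 : (convexHull ℝ (vertices P)).Nonempty := h1 ▸ ⟨0, interior_subset h0⟩
    exact convexHull_nonempty_iff.1 h2
  obtain ⟨v, hv⟩ := hv
  obtain ⟨n, rfl⟩ := hlat hv
  have := hprim n hv 0 n (Subsingleton.elim _ _)
  simp at this

theorem IsReflexive.exists_simplicialData {ι : Type} [Fintype ι] {P : Set (ι → ℝ)}
    (hP : IsReflexive P) (hs : IsSimplicial P) : ∃ V U : Finset (ι → ℤ),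
      SimplicialData V U ∧ P = convexHull ℝ (intVec '' (V : Set (ι → ℤ))) := by
  have hne := hP.1.nonempty_index
  obtain ⟨⟨hlat, h0, hprim⟩, hdual⟩ := hP
  obtain ⟨V, hV, hPV⟩ := hlat.exists_finset
  obtain ⟨U, hU, hPU⟩ := hdual.exists_finset
  refine ⟨V, U, ?_, hPV⟩
  have hfin := V.finite_toSet.image (intVec (ι := ι))
  have hvert : vertices (convexHull ℝ (intVec '' (V : Set (ι → ℤ)))) =
      intVec '' (V : Set (ι → ℤ)) := by rw [← hPV, hV]
  refine ⟨hvert, by rwa [← hPV], fun h0V => ?_, by rw [← hPV, hPU], by rw [← hPV, hU], ?_⟩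
  · have := hprim 0 (by rw [hV]; exact ⟨0, h0V, rfl⟩) 0 0 (by simp)
    simp at this
  · intro u hu
    have hy : intVec u ∈ vertices (dual (convexHull ℝ (intVec '' (V : Set (ι → ℤ))))) := by
      rw [← hPV, hU]; exact ⟨u, hu, rfl⟩
    have := linearIndependent_of_isSimplicial hfin hvert (by rwa [← hPV]) hy
    let f : {v ∈ V | v ⬝ᵥ u = -1} →
        {x ∈ intVec '' (V : Set (ι → ℤ)) | x ⬝ᵥ intVec u = -1} := fun v =>
      ⟨intVec (v : ι → ℤ), by rw [SimplicialData.image_active]; exact ⟨v, rfl⟩⟩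
    have hf : Function.Injective f := fun v v' h =>
      Subtype.ext (intVec_injective (congrArg Subtype.val h))
    exact this.comp f hf

end Reflexive

/-! ### The open charts of a toric variety. -/

section Charts

variable {ι : Type} [Fintype ι] (C : ConeSystem ι)

instance {σ τ : C.cones} (f : σ ⟶ τ) :
    IsOpenImmersion ((C.diagram ⋙ Over.forget SpecC).map f) :=
  inferInstanceAs (IsOpenImmersion (C.diagram.map f).left)

instance : ((C.diagram ⋙ Over.forget SpecC) ⋙ Scheme.forget).IsLocallyDirected :=
  inferInstanceAs (C.diagram ⋙ Over.forget SpecC ⋙ Scheme.forget).IsLocallyDirected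

/-- The open chart of the toric variety given by a cone. -/
def ConeSystem.chart (σ : C.cones) : σ.1.affine ⟶ toricVariety C := colimit.ι C.diagram σ

theorem ConeSystem.chart_comp {σ τ : C.cones} (h : σ.1 ≤ τ.1) :
    RationalCone.affineMap h ≫ C.chart τ = C.chart σ :=
  colimit.w C.diagram (homOfLE h : σ ⟶ τ)

/-- The underlying scheme of the toric variety is the colimit of the underlying schemes. -/
def ConeSystem.leftIso : (toricVariety C).left ≅ colimit (C.diagram ⋙ Over.forget SpecC) :=
  preservesColimitIso (Over.forget SpecC) C.diagram

theorem ConeSystem.chart_leftIso (σ : C.cones) :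
    (C.chart σ).left ≫ C.leftIso.hom = colimit.ι (C.diagram ⋙ Over.forget SpecC) σ :=
  ι_preservesColimitIso_hom (Over.forget SpecC) C.diagram σ

theorem ConeSystem.chart_left (σ : C.cones) :
    (C.chart σ).left = colimit.ι (C.diagram ⋙ Over.forget SpecC) σ ≫ C.leftIso.inv :=
  (Iso.eq_comp_inv _).2 (C.chart_leftIso σ)

instance (σ : C.cones) : IsOpenImmersion (C.chart σ).left :=
  (C.chart_left σ).symm ▸ inferInstanceAs
    (IsOpenImmersion (colimit.ι (C.diagram ⋙ Over.forget SpecC) σ ≫ C.leftIso.inv))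

theorem ConeSystem.leftIso_chart_apply (σ : C.cones) (y : σ.1.affine.left) :
    C.leftIso.hom ((C.chart σ).left y) = colimit.ι (C.diagram ⋙ Over.forget SpecC) σ y :=
  (Scheme.Hom.comp_apply (C.chart σ).left C.leftIso.hom y).symm.trans
    (congrArg (fun f : (σ.1.affine.left ⟶ colimit (C.diagram ⋙ Over.forget SpecC)) => f y)
      (C.chart_leftIso σ))

theorem ConeSystem.exists_chart (x : (toricVariety C).left) :
    ∃ (σ : C.cones) (y : σ.1.affine.left), (C.chart σ).left y = x := by
  obtain ⟨σ, y, hy⟩ := Scheme.IsLocallyDirected.ι_jointly_surjective _ (C.leftIso.hom x)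
  exact ⟨σ, y, C.leftIso.hom.isOpenEmbedding.injective ((C.leftIso_chart_apply σ y).trans hy)⟩

theorem ConeSystem.exists_of_chart_eq {σ τ : C.cones} {x : σ.1.affine.left}
    {y : τ.1.affine.left} (h : (C.chart σ).left x = (C.chart τ).left y) :
    ∃ (ρ : C.cones) (h1 : ρ.1 ≤ σ.1) (h2 : ρ.1 ≤ τ.1) (z : ρ.1.affine.left),
      (RationalCone.affineMap h1).left z = x ∧ (RationalCone.affineMap h2).left z = y := by
  have h' := ((C.leftIso_chart_apply σ x).symm.trans (congrArg C.leftIso.hom h)).trans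
    (C.leftIso_chart_apply τ y)
  obtain ⟨ρ, f, g, z, h1, h2⟩ :=
    (Scheme.IsLocallyDirected.ι_eq_ι_iff (C.diagram ⋙ Over.forget SpecC)).1 h'
  exact ⟨ρ, leOfHom f, leOfHom g, z, h1, h2⟩

end Charts

/-! ### Morphisms over ℂ into affine schemes. -/

section SpecOver

/-- The spectrum of a `ℂ`-algebra as a scheme over `ℂ`. -/
abbrev specOver (A : Type) [CommRing A] [Algebra ℂ A] : Over SpecC :=
  Over.mk (Spec.map (CommRingCat.ofHom (algebraMap ℂ A)))

variable {A B : Type} [CommRing A] [Algebra ℂ A] [CommRing B] [Algebra ℂ B]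

/-- The morphism of spectra given by a homomorphism of `ℂ`-algebras. -/
def specOverMap (φ : A →ₐ[ℂ] B) : specOver B ⟶ specOver A :=
  Over.homMk (Spec.map (CommRingCat.ofHom φ.toRingHom)) (by
    change Spec.map _ ≫ Spec.map _ = Spec.map _
    rw [← Spec.map_comp, ← CommRingCat.ofHom_comp]
    congr 2
    exact φ.comp_algebraMap)

/-- The ring homomorphism given by a morphism to a spectrum. -/
def pullFun {T : Over SpecC} (f : T ⟶ specOver A) : A →+* Γ(T.left, ⊤) :=
  ((Scheme.ΓSpecIso (.of A)).inv ≫ f.left.appTop).hom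

/-- The structure of a `ℂ`-algebra on the global sections of a scheme over `ℂ`. -/
def structMap (T : Over SpecC) : ℂ →+* Γ(T.left, ⊤) :=
  ((Scheme.ΓSpecIso (.of ℂ)).inv ≫ T.hom.appTop).hom

theorem pullFun_injective {T : Over SpecC} {f g : T ⟶ specOver A} (h : pullFun f = pullFun g) :
    f = g := by
  apply Over.OverMorphism.ext
  apply ext_to_Spec
  exact CommRingCat.hom_ext h

theorem pullFun_comp_specOverMap {T : Over SpecC} (f : T ⟶ specOver B) (φ : A →ₐ[ℂ] B) :
    pullFun (f ≫ specOverMap φ) = (pullFun f).comp φ.toRingHom := by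
  have h := Scheme.ΓSpecIso_inv_naturality (CommRingCat.ofHom φ.toRingHom)
  have : (Scheme.ΓSpecIso (.of A)).inv ≫ (f.left ≫ (specOverMap φ).left).appTop =
      CommRingCat.ofHom φ.toRingHom ≫ (Scheme.ΓSpecIso (.of B)).inv ≫ f.left.appTop := by
    rw [Scheme.Hom.comp_appTop]
    exact (Category.assoc _ _ _).symm.trans ((congrArg (· ≫ f.left.appTop) h.symm).trans
      (Category.assoc _ _ _))
  exact congrArg CommRingCat.Hom.hom this

theorem pullFun_algebraMap {T : Over SpecC} (f : T ⟶ specOver A) :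
    (pullFun f).comp (algebraMap ℂ A) = structMap T := by
  have h := Scheme.ΓSpecIso_inv_naturality (CommRingCat.ofHom (algebraMap ℂ A))
  have h2 : T.hom = f.left ≫ Spec.map (CommRingCat.ofHom (algebraMap ℂ A)) := (Over.w f).symm
  have : CommRingCat.ofHom (algebraMap ℂ A) ≫ (Scheme.ΓSpecIso (.of A)).inv ≫ f.left.appTop =
      (Scheme.ΓSpecIso (.of ℂ)).inv ≫ T.hom.appTop := by
    rw [h2, Scheme.Hom.comp_appTop]
    exact (Category.assoc _ _ _).symm.trans ((congrArg (· ≫ f.left.appTop) h).trans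
      (Category.assoc _ _ _))
  exact congrArg CommRingCat.Hom.hom this

/-- Together with `pullFun_injective` this is the adjunction between Spec and global sections over
ℂ, which reduces the universal property of a product of affine charts to algebra. -/
theorem exists_pullFun_eq {T : Over SpecC} (ψ : A →+* Γ(T.left, ⊤))
    (hψ : ψ.comp (algebraMap ℂ A) = structMap T) : ∃ f : T ⟶ specOver A, pullFun f = ψ := by
  have key : ∀ {R : CommRingCat} (φ : R ⟶ Γ(T.left, ⊤)),
      (Scheme.ΓSpecIso R).inv ≫ (T.left.toSpecΓ ≫ Spec.map φ).appTop = φ := by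
    intro R φ
    rw [Scheme.Hom.comp_appTop, Scheme.toSpecΓ_appTop, ← Category.assoc,
      ← Scheme.ΓSpecIso_inv_naturality, Category.assoc, Iso.inv_hom_id, Category.comp_id]
  refine ⟨Over.homMk (T.left.toSpecΓ ≫ Spec.map (CommRingCat.ofHom ψ)) ?_, ?_⟩
  · apply ext_to_Spec
    refine Eq.trans ?_ (CommRingCat.hom_ext (f := CommRingCat.ofHom (structMap T)) rfl)
    change (Scheme.ΓSpecIso (.of ℂ)).inv ≫ ((T.left.toSpecΓ ≫ Spec.map (CommRingCat.ofHom ψ)) ≫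
      Spec.map (CommRingCat.ofHom (algebraMap ℂ A))).appTop = _
    rw [Category.assoc, ← Spec.map_comp, ← CommRingCat.ofHom_comp, hψ]
    exact key _
  · exact congrArg CommRingCat.Hom.hom (key (CommRingCat.ofHom ψ))

end SpecOver

/-! ### Products of affine toric varieties. -/

section ProductChart

variable {k : ℕ} {S : Type} [AddCommMonoid S] {R : Fin k → Type} [∀ i, AddCommMonoid (R i)]

theorem single_eq_prod (E : S ≃+ ∀ i, R i) (s : S) :
    (AddMonoidAlgebra.single s 1 : AddMonoidAlgebra ℂ S) =
      ∏ i, AddMonoidAlgebra.single (E.symm (Pi.single i (E s i))) 1 := by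
  have h1 : s = ∑ i, E.symm (Pi.single i (E s i)) := by
    rw [← map_sum, Finset.univ_sum_single, AddEquiv.symm_apply_apply]
  have h2 := map_prod (AddMonoidAlgebra.of ℂ S)
    (fun i => Multiplicative.ofAdd (E.symm (Pi.single i (E s i)))) Finset.univ
  rw [← ofAdd_sum, ← h1] at h2
  exact h2

/-- The spectrum of the algebra of a product of monoids is the product over `ℂ` of the spectra:
morphisms into it are families of morphisms. -/
theorem existsUnique_specOver_lift (E : S ≃+ ∀ i, R i)
    (π : ∀ i, specOver (AddMonoidAlgebra ℂ S) ⟶ specOver (AddMonoidAlgebra ℂ (R i)))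
    (hπ : ∀ i, ∃ φ : AddMonoidAlgebra ℂ (R i) →ₐ[ℂ] AddMonoidAlgebra ℂ S, π i = specOverMap φ ∧
      ∀ r, φ (AddMonoidAlgebra.single r 1) = AddMonoidAlgebra.single (E.symm (Pi.single i r)) 1)
    {T : Over SpecC} (f : ∀ i, T ⟶ specOver (AddMonoidAlgebra ℂ (R i))) :
    ∃! g : T ⟶ specOver (AddMonoidAlgebra ℂ S), ∀ i, g ≫ π i = f i := by
  choose φ hφ hφs using hπ
  have hpull : ∀ (g : T ⟶ specOver (AddMonoidAlgebra ℂ S)) (i) (r : R i),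
      pullFun g (AddMonoidAlgebra.single (E.symm (Pi.single i r)) 1) =
        pullFun (g ≫ π i) (AddMonoidAlgebra.single r 1) := by
    intro g i r
    rw [hφ, pullFun_comp_specOverMap, ← hφs]
    rfl
  have halg : ∀ {S : Type} [AddCommMonoid S] (f : T ⟶ specOver (AddMonoidAlgebra ℂ S)) (r : ℂ),
      pullFun f (AddMonoidAlgebra.single 0 r) = structMap T r := fun f r =>
    congrArg (fun h : ℂ →+* Γ(T.left, ⊤) => h r) (pullFun_algebraMap f)
  let : Algebra ℂ Γ(T.left, ⊤) := (structMap T).toAlgebra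
  -- A monomial is the product of the monomials of its components (`single_eq_prod`), so this value
  -- is forced by the `f i`.
  let ψ : Multiplicative S →* Γ(T.left, ⊤) :=
    { toFun := fun s => ∏ i, pullFun (f i) (AddMonoidAlgebra.single (E s.toAdd i) 1)
      map_one' := by
        refine Finset.prod_eq_one fun i _ => ?_
        rw [toAdd_one, map_zero, Pi.zero_apply]
        exact map_one (pullFun (f i))
      map_mul' := fun s t => by
        rw [← Finset.prod_mul_distrib]
        refine Finset.prod_congr rfl fun i _ => ?_
        rw [toAdd_mul, map_add, Pi.add_apply, ← map_mul, AddMonoidAlgebra.single_mul_single,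
          one_mul] }
  let Ψ : AddMonoidAlgebra ℂ S →ₐ[ℂ] Γ(T.left, ⊤) := AddMonoidAlgebra.lift ℂ Γ(T.left, ⊤) S ψ
  obtain ⟨g, hg⟩ := exists_pullFun_eq (T := T) Ψ.toRingHom Ψ.comp_algebraMap
  have hΨ : ∀ s, pullFun g (AddMonoidAlgebra.single s 1) =
      ∏ i, pullFun (f i) (AddMonoidAlgebra.single (E s i) 1) := by
    intro s
    rw [hg]
    change Ψ _ = _
    simp only [Ψ]
    rw [AddMonoidAlgebra.lift_single, one_smul]
    rfl
  refine ⟨g, fun i => ?_, fun h hh => ?_⟩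
  · apply pullFun_injective
    apply AddMonoidAlgebra.ringHom_ext
    · intro r
      rw [halg, halg]
    · intro r
      rw [← hpull, hΨ, AddEquiv.apply_symm_apply, Finset.prod_eq_single i, Pi.single_eq_same]
      · intro j _ hj
        rw [Pi.single_eq_of_ne hj]
        exact map_one (pullFun (f j))
      · simp
  · apply pullFun_injective
    apply AddMonoidAlgebra.ringHom_ext
    · intro r
      rw [halg, halg]
    · intro s
      rw [hΨ, single_eq_prod E s, map_prod]
      refine Finset.prod_congr rfl fun i _ => ?_
      rw [hpull, hh]

end ProductChart

/-! ### Gluing product charts to a product of toric varieties. -/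

section Gluing

/-- A bijective morphism that is an open immersion on the members of an open cover is an
isomorphism. -/
theorem isIso_of_bijective {X Y : Scheme.{0}} (f : X ⟶ Y) (hf : Function.Bijective f)
    (h : ∀ x : X, ∃ (U : Scheme.{0}) (c : U ⟶ X) (_ : IsOpenImmersion c) (u : U), c u = x ∧
      IsOpenImmersion (c ≫ f)) : IsIso f := by
  have hopen : IsOpenMap f := by
    rw [isOpenMap_iff_nhds_le]
    intro x
    obtain ⟨U, c, hc, u, rfl, hcf⟩ := h x
    have h1 : nhds (c u) = Filter.map c (nhds u) := (c.isOpenEmbedding.map_nhds_eq u).symm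
    have h2 := (c ≫ f).isOpenEmbedding.map_nhds_eq u
    rw [h1, Filter.map_map]
    exact h2.ge
  have hemb : Topology.IsOpenEmbedding f :=
    .of_continuous_injective_isOpenMap f.continuous hf.1 hopen
  have hstalk : ∀ x, IsIso (f.stalkMap x) := by
    intro x
    obtain ⟨U, c, hc, u, rfl, hcf⟩ := h x
    have h1 := Scheme.Hom.stalkMap_comp c f u
    have h2 : IsIso (f.stalkMap (c u) ≫ c.stalkMap u) := by
      have := (IsOpenImmersion.iff_isIso_stalkMap.1 hcf).2 u
      exact h1 ▸ this
    exact IsIso.of_isIso_comp_right (f.stalkMap (c u)) (c.stalkMap u)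
  have : IsOpenImmersion f := IsOpenImmersion.of_isIso_stalkMap f hemb
  have : Surjective f := ⟨hf.2⟩
  exact (isIso_iff_isOpenImmersion_and_surjective f).2 ⟨inferInstance, inferInstance⟩

/-- A product over `ℂ` of open subschemes is an open subscheme of the product. -/
theorem isOpenImmersion_piLift {k : ℕ} {Y U : Over SpecC} {V : Fin k → Over SpecC}
    (κ : ∀ i, V i ⟶ Y) [∀ i, IsOpenImmersion (κ i).left] (π : ∀ i, U ⟶ V i)
    (huniv : ∀ (T : Over SpecC) (f : ∀ i, T ⟶ V i), ∃! g : T ⟶ U, ∀ i, g ≫ π i = f i) :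
    IsOpenImmersion (Pi.lift fun i => π i ≫ κ i).left ∧
      Set.range (Pi.lift fun i => π i ≫ κ i).left =
        ⋂ i, (Pi.π (fun _ : Fin k => Y) i).left ⁻¹' Set.range (κ i).left := by
  set Z : Over SpecC := ∏ᶜ fun _ : Fin k => Y with hZ
  set c : U ⟶ Z := Pi.lift fun i => π i ≫ κ i with hc
  have hcπ : ∀ i, c ≫ Pi.π _ i = π i ≫ κ i := fun i => by rw [hc, Pi.lift_π]
  let W : Z.left.Opens := ⟨⋂ i, (Pi.π (fun _ : Fin k => Y) i).left ⁻¹' Set.range (κ i).left,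
    isOpen_iInter_of_finite fun i => (κ i).left.isOpenEmbedding.isOpen_range.preimage
      (Pi.π (fun _ : Fin k => Y) i).left.continuous⟩
  let W' : Over SpecC := Over.mk (W.ι ≫ Z.hom)
  let inc : W' ⟶ Z := Over.homMk W.ι rfl
  have hmonoinc : Mono inc := by
    have : Mono inc.left := inferInstanceAs (Mono W.ι)
    exact Over.mono_of_mono_left inc
  have hmonoκ : ∀ i, Mono (κ i) := fun i => Over.mono_of_mono_left (κ i)
  -- On the candidate image W every projection factors through `V i`. By the universal property of U
  -- the factorizations give the inverse of U → W.
  have hlift : ∀ i, ∃ f : W' ⟶ V i, f ≫ κ i = inc ≫ Pi.π _ i := by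
    intro i
    have hr : Set.range (W.ι ≫ (Pi.π (fun _ : Fin k => Y) i).left) ⊆ Set.range (κ i).left := by
      rintro _ ⟨w, rfl⟩
      rw [Scheme.Hom.comp_apply]
      have := Set.mem_iInter.1 w.2 i
      exact this
    let l := IsOpenImmersion.lift (κ i).left (W.ι ≫ (Pi.π (fun _ : Fin k => Y) i).left) hr
    have hl : l ≫ (κ i).left = W.ι ≫ (Pi.π (fun _ : Fin k => Y) i).left :=
      IsOpenImmersion.lift_fac _ _ _
    refine ⟨Over.homMk l ?_, ?_⟩
    · change l ≫ (V i).hom = W.ι ≫ Z.hom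
      rw [← Over.w (κ i), ← Over.w (Pi.π (fun _ : Fin k => Y) i), ← Category.assoc, hl,
        Category.assoc]
    · apply Over.OverMorphism.ext
      exact hl
  choose f hf using hlift
  obtain ⟨g, hg, -⟩ := huniv W' f
  have hgc : g ≫ c = inc := by
    apply Pi.hom_ext
    intro i
    rw [Category.assoc, hcπ, ← Category.assoc, hg, hf]
  have hrange : Set.range c.left ⊆ W := by
    rintro _ ⟨u, rfl⟩
    refine Set.mem_iInter.2 fun i => ⟨(π i).left u, ?_⟩
    rw [← Scheme.Hom.comp_apply, ← Scheme.Hom.comp_apply, ← Over.comp_left, ← Over.comp_left, hcπ]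
  obtain ⟨c', hc'⟩ : ∃ c' : U ⟶ W', c' ≫ inc = c := by
    have hr : Set.range c.left ⊆ Set.range W.ι := by rwa [Scheme.Opens.range_ι]
    refine ⟨Over.homMk (IsOpenImmersion.lift W.ι c.left hr) ?_, ?_⟩
    · change IsOpenImmersion.lift W.ι c.left hr ≫ W.ι ≫ Z.hom = U.hom
      rw [IsOpenImmersion.lift_fac_assoc, Over.w]
    · apply Over.OverMorphism.ext
      exact IsOpenImmersion.lift_fac W.ι c.left hr
  have h1 : c' ≫ g = 𝟙 U := by
    refine (huniv U π).unique (fun i => ?_) (fun i => Category.id_comp _)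
    rw [Category.assoc, hg, ← cancel_mono (κ i), Category.assoc, hf, ← Category.assoc, hc', hcπ]
  have h2 : g ≫ c' = 𝟙 W' := by
    rw [← cancel_mono inc, Category.assoc, hc', hgc, Category.id_comp]
  let e : U ≅ W' := ⟨c', g, h1, h2⟩
  have he : IsIso c'.left := ((Over.forget SpecC).mapIso e).isIso_hom
  have hcl : c.left = c'.left ≫ W.ι := by rw [← hc']; rfl
  refine ⟨hcl ▸ inferInstance, Set.Subset.antisymm hrange fun z hz => ?_⟩
  obtain ⟨u, hu⟩ := (Scheme.homeoOfIso (asIso c'.left)).surjective (⟨z, hz⟩ : W)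
  refine ⟨u, ?_⟩
  rw [hcl, Scheme.Hom.comp_apply]
  exact congrArg Subtype.val hu

/-- The toric variety of a product fan is the product of the toric varieties. -/
theorem nonempty_iso_pi {ι κ : Type} [Fintype ι] [Fintype κ] (C : ConeSystem ι)
    (D : ConeSystem κ) {k : ℕ} (p : Fin k → C.cones → D.cones)
    (proj : ∀ i σ, σ.1.affine ⟶ (p i σ).1.affine)
    (hnat : ∀ (σ τ : C.cones) (h : σ.1 ≤ τ.1) (i), ∃ h' : (p i σ).1 ≤ (p i τ).1,
      proj i σ ≫ RationalCone.affineMap h' = RationalCone.affineMap h ≫ proj i τ)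
    (huniv : ∀ (σ : C.cones) (T : Over SpecC) (f : ∀ i, T ⟶ (p i σ).1.affine),
      ∃! g : T ⟶ σ.1.affine, ∀ i, g ≫ proj i σ = f i)
    (hsurj : ∀ τ : Fin k → D.cones, ∃ σ, ∀ i, p i σ = τ i)
    (hinf : ∀ (σ τ : C.cones) (ρ : Fin k → D.cones), (∀ i, (ρ i).1 ≤ (p i σ).1) →
      (∀ i, (ρ i).1 ≤ (p i τ).1) → ∃ μ : C.cones, μ.1 ≤ σ.1 ∧ μ.1 ≤ τ.1 ∧ ∀ i, p i μ = ρ i) :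
    Nonempty (toricVariety C ≅ ∏ᶜ fun _ : Fin k => toricVariety D) := by
  set Y := toricVariety D
  let c : ∀ σ : C.cones, σ.1.affine ⟶ ∏ᶜ fun _ : Fin k => Y := fun σ =>
    Pi.lift fun i => proj i σ ≫ D.chart (p i σ)
  have hc : ∀ (σ τ : C.cones) (h : σ.1 ≤ τ.1), RationalCone.affineMap h ≫ c τ = c σ := by
    intro σ τ h
    apply Pi.hom_ext
    intro i
    obtain ⟨h', hh⟩ := hnat σ τ h i
    rw [Category.assoc, Pi.lift_π, Pi.lift_π, ← Category.assoc, ← hh, Category.assoc,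
      D.chart_comp]
  let Φ : toricVariety C ⟶ ∏ᶜ fun _ : Fin k => Y :=
    colimit.desc C.diagram ⟨_, ⟨fun σ => c σ, fun σ τ h =>
      (hc σ τ (leOfHom h)).trans (Category.comp_id _).symm⟩⟩
  have hΦ : ∀ σ, C.chart σ ≫ Φ = c σ := fun σ => colimit.ι_desc _ _
  have hcop : ∀ σ, IsOpenImmersion (c σ).left ∧ Set.range (c σ).left =
      ⋂ i, (Pi.π (fun _ : Fin k => Y) i).left ⁻¹' Set.range (D.chart (p i σ)).left :=
    fun σ => isOpenImmersion_piLift (fun i => D.chart (p i σ)) (fun i => proj i σ) (huniv σ)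
  have hΦapp : ∀ σ x, Φ.left ((C.chart σ).left x) = (c σ).left x := fun σ x => by
    rw [← hΦ, Over.comp_left, Scheme.Hom.comp_apply]
  have hsur : Function.Surjective Φ.left := by
    intro z
    have := fun i => D.exists_chart ((Pi.π (fun _ : Fin k => Y) i).left z)
    choose τ y hy using this
    obtain ⟨σ, hσ⟩ := hsurj τ
    have hz : z ∈ Set.range (c σ).left := by
      rw [(hcop σ).2, Set.mem_iInter]
      intro i
      rw [hσ i]
      exact ⟨y i, hy i⟩
    obtain ⟨x, rfl⟩ := hz
    exact ⟨(C.chart σ).left x, hΦapp σ x⟩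
  have hinj : Function.Injective Φ.left := by
    intro a b hab
    obtain ⟨σ, x, rfl⟩ := C.exists_chart a
    obtain ⟨τ, y, rfl⟩ := C.exists_chart b
    rw [hΦapp, hΦapp] at hab
    have hx : (c σ).left x ∈ Set.range (c σ).left := ⟨x, rfl⟩
    have hy : (c σ).left x ∈ Set.range (c τ).left := ⟨y, hab.symm⟩
    rw [(hcop _).2, Set.mem_iInter] at hx hy
    choose x' hx' using hx
    choose y' hy' using hy
    -- In every factor the two points meet in the chart of a common face; `hinf` assembles these
    -- faces to a common face of σ and τ, whose chart contains the point already.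
    have := fun i => D.exists_of_chart_eq ((hx' i).trans (hy' i).symm)
    choose ρ h1 h2 z hz1 hz2 using this
    obtain ⟨μ, hμσ, hμτ, hμ⟩ := hinf σ τ ρ h1 h2
    have hw : (c σ).left x ∈ Set.range (c μ).left := by
      rw [(hcop μ).2, Set.mem_iInter]
      intro i
      rw [hμ i]
      refine ⟨z i, ?_⟩
      rw [← hx' i, ← hz1 i, ← D.chart_comp (h1 i), Over.comp_left, Scheme.Hom.comp_apply]
    obtain ⟨w, hw⟩ := hw
    have hσw : (RationalCone.affineMap hμσ).left w = x := by
      have := (hcop σ).1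
      apply (c σ).left.isOpenEmbedding.injective
      rw [← hw, ← hc μ σ hμσ, Over.comp_left, Scheme.Hom.comp_apply]
    have hτw : (RationalCone.affineMap hμτ).left w = y := by
      have := (hcop τ).1
      apply (c τ).left.isOpenEmbedding.injective
      rw [← hab, ← hw, ← hc μ τ hμτ, Over.comp_left, Scheme.Hom.comp_apply]
    rw [← hσw, ← hτw, ← Scheme.Hom.comp_apply, ← Scheme.Hom.comp_apply, ← Over.comp_left,
      ← Over.comp_left, C.chart_comp, C.chart_comp]
  have hiso : IsIso Φ.left := by
    refine isIso_of_bijective Φ.left ⟨hinj, hsur⟩ fun a => ?_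
    obtain ⟨σ, x, rfl⟩ := C.exists_chart a
    refine ⟨_, (C.chart σ).left, inferInstance, x, rfl, ?_⟩
    rw [← Over.comp_left, hΦ]
    exact (hcop σ).1
  have : IsIso ((Over.forget SpecC).map Φ) := hiso
  have : IsIso Φ := isIso_of_reflects_iso Φ (Over.forget SpecC)
  exact ⟨asIso Φ⟩

end Gluing

/-! ### Decompositions of the lattice and product fans. -/

section Splitting

variable {ι κ : Type} [Fintype ι] [Fintype κ]

omit [Fintype ι] in
theorem RationalCone.ext {σ τ : RationalCone ι} (h : ∀ x, x ∈ σ.carrier ↔ x ∈ τ.carrier) :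
    σ = τ := by
  have : σ.carrier = τ.carrier := Submodule.ext h
  cases σ; cases τ; cases this; rfl

omit [Fintype ι] in
theorem intVec_vecMul (A : Matrix κ ι ℤ) (m : κ → ℤ) :
    intVec (m ᵥ* A) = intVec m ᵥ* realMatrix A := by
  ext i
  simp [intVec, Matrix.vecMul, dotProduct, realMatrix]

theorem pairing_vecMul (A : Matrix κ ι ℤ) (m : κ → ℤ) (x : ι → ℝ) :
    pairing (m ᵥ* A) x = pairing m (realMatrix A *ᵥ x) := by
  change x ⬝ᵥ intVec (m ᵥ* A) = (realMatrix A *ᵥ x) ⬝ᵥ intVec m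
  rw [intVec_vecMul, dotProduct_comm, ← Matrix.dotProduct_mulVec, dotProduct_comm]

theorem pairing_sum {α : Type} (s : Finset α) (f : α → ι → ℤ) (x : ι → ℝ) :
    pairing (∑ i ∈ s, f i) x = ∑ i ∈ s, pairing (f i) x := by
  classical
  induction s using Finset.induction_on with
  | empty => simp [pairing_zero]
  | insert a s ha ih => rw [Finset.sum_insert ha, Finset.sum_insert ha, pairing_add, ih]

/-- A decomposition of the lattice `ℤ^ι` as a direct sum of `k` copies of `ℤ^κ`, given by the
matrices of the projections and of the inclusions. -/
structure Splitting [DecidableEq ι] [DecidableEq κ] {k : ℕ} (M : Fin k → Matrix κ ι ℤ)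
    (N : Fin k → Matrix ι κ ℤ) : Prop where
  mul_self : ∀ i, M i * N i = 1
  mul_ne : ∀ i j, i ≠ j → M i * N j = 0
  sum : ∑ i, N i * M i = 1

namespace Splitting

variable [DecidableEq ι] [DecidableEq κ] {k : ℕ} {M : Fin k → Matrix κ ι ℤ}
  {N : Fin k → Matrix ι κ ℤ} (h : Splitting M N)

include h

theorem real_mul_self (i : Fin k) : realMatrix (M i) * realMatrix (N i) = 1 := by
  rw [← realMatrix_mul, h.mul_self, realMatrix_one]

theorem real_mul_ne {i j : Fin k} (hij : i ≠ j) : realMatrix (M i) * realMatrix (N j) = 0 := by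
  rw [← realMatrix_mul, h.mul_ne i j hij]
  ext
  simp [realMatrix]

theorem real_sum : ∑ i, realMatrix (N i) * realMatrix (M i) = 1 := by
  rw [← realMatrix_one, ← h.sum]
  ext a b
  simp [realMatrix, Matrix.sum_apply, Matrix.mul_apply]

theorem proj_incl (i : Fin k) (z : κ → ℝ) : realMatrix (M i) *ᵥ (realMatrix (N i) *ᵥ z) = z := by
  rw [Matrix.mulVec_mulVec, h.real_mul_self, Matrix.one_mulVec]

theorem proj_incl_ne {i j : Fin k} (hij : i ≠ j) (z : κ → ℝ) :
    realMatrix (M i) *ᵥ (realMatrix (N j) *ᵥ z) = 0 := by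
  rw [Matrix.mulVec_mulVec, h.real_mul_ne hij, Matrix.zero_mulVec]

theorem sum_incl_proj (x : ι → ℝ) :
    ∑ i, realMatrix (N i) *ᵥ (realMatrix (M i) *ᵥ x) = x := by
  simp_rw [Matrix.mulVec_mulVec]
  rw [← Matrix.sum_mulVec, h.real_sum, Matrix.one_mulVec]

theorem vecMul_self (i : Fin k) (m : κ → ℤ) : (m ᵥ* M i) ᵥ* N i = m := by
  rw [Matrix.vecMul_vecMul, h.mul_self, Matrix.vecMul_one]

theorem vecMul_ne {i j : Fin k} (hij : i ≠ j) (m : κ → ℤ) : (m ᵥ* M i) ᵥ* N j = 0 := by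
  rw [Matrix.vecMul_vecMul, h.mul_ne i j hij, Matrix.vecMul_zero]

theorem sum_vecMul (n : ι → ℤ) : ∑ i, (n ᵥ* N i) ᵥ* M i = n := by
  simp_rw [Matrix.vecMul_vecMul]
  rw [← Matrix.vecMul_sum, h.sum, Matrix.vecMul_one]

/-- The cone `σ` is the product of the cones `τ i`. -/
theorem mem_hull_iff {H : Set (κ → ℤ)} {y : ι → ℝ} {x : ι → ℝ} :
    x ∈ PointedCone.hull ℝ {s ∈ intVec '' {v | ∃ i, ∃ m ∈ H, v = N i *ᵥ m} | s ⬝ᵥ y = -1} ↔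
      ∀ i, realMatrix (M i) *ᵥ x ∈
        PointedCone.hull ℝ {s ∈ intVec '' H | s ⬝ᵥ (y ᵥ* realMatrix (N i)) = -1} := by
  have hdot : ∀ i (z : κ → ℝ), (realMatrix (N i) *ᵥ z) ⬝ᵥ y = z ⬝ᵥ (y ᵥ* realMatrix (N i)) := by
    intro i z
    rw [dotProduct_comm, Matrix.dotProduct_mulVec, dotProduct_comm]
  constructor
  · intro hx i
    induction hx using Submodule.span_induction with
    | mem x hx =>
      obtain ⟨⟨_, ⟨j, m, hm, rfl⟩, rfl⟩, hxy⟩ := hx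
      rw [← realMatrix_mulVec] at hxy ⊢
      by_cases hij : i = j
      · subst hij
        rw [h.proj_incl]
        exact Submodule.subset_span ⟨⟨m, hm, rfl⟩, by rw [← hdot, hxy]⟩
      · rw [h.proj_incl_ne hij]
        exact Submodule.zero_mem _
    | zero => rw [Matrix.mulVec_zero]; exact Submodule.zero_mem _
    | add x y _ _ hx hy => rw [Matrix.mulVec_add]; exact Submodule.add_mem _ hx hy
    | smul c x _ hx =>
      have e : realMatrix (M i) *ᵥ (c • x) = c • (realMatrix (M i) *ᵥ x) :=
        Matrix.mulVec_smul (realMatrix (M i)) (c : ℝ) x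
      exact e ▸ Submodule.smul_mem _ _ hx
  · intro hx
    rw [← h.sum_incl_proj x]
    refine Submodule.sum_mem _ fun i _ => ?_
    have key : ∀ z ∈ PointedCone.hull ℝ {s ∈ intVec '' H | s ⬝ᵥ (y ᵥ* realMatrix (N i)) = -1},
        realMatrix (N i) *ᵥ z ∈ PointedCone.hull ℝ
          {s ∈ intVec '' {v | ∃ i, ∃ m ∈ H, v = N i *ᵥ m} | s ⬝ᵥ y = -1} := by
      intro z hz
      induction hz using Submodule.span_induction with
      | mem x hx =>
        obtain ⟨⟨m, hm, rfl⟩, hxy⟩ := hx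
        refine Submodule.subset_span ⟨⟨_, ⟨i, m, hm, rfl⟩, (realMatrix_mulVec _ _).symm⟩, ?_⟩
        rw [hdot, hxy]
      | zero => rw [Matrix.mulVec_zero]; exact Submodule.zero_mem _
      | add x y _ _ hx hy => rw [Matrix.mulVec_add]; exact Submodule.add_mem _ hx hy
      | smul c x _ hx =>
        have e : realMatrix (N i) *ᵥ (c • x) = c • (realMatrix (N i) *ᵥ x) :=
          Matrix.mulVec_smul (realMatrix (N i)) (c : ℝ) x
        exact e ▸ Submodule.smul_mem _ _ hx
    exact key _ (hx i)

/-- The toric variety of a product fan, for a decomposition of the lattice, is the product of the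
toric varieties. -/
theorem nonempty_iso {C : ConeSystem ι} {D : ConeSystem κ}
    (h1 : ∀ σ ∈ C.cones, ∃ τ : Fin k → RationalCone κ, (∀ i, τ i ∈ D.cones) ∧
      ∀ x, x ∈ σ.carrier ↔ ∀ i, realMatrix (M i) *ᵥ x ∈ (τ i).carrier)
    (h2 : ∀ τ : Fin k → RationalCone κ, (∀ i, τ i ∈ D.cones) → ∃ σ ∈ C.cones,
      ∀ x, x ∈ σ.carrier ↔ ∀ i, realMatrix (M i) *ᵥ x ∈ (τ i).carrier) :
    Nonempty (toricVariety C ≅ ∏ᶜ fun _ : Fin k => toricVariety D) := by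
  have h1' : ∀ σ : C.cones, ∃ τ : Fin k → D.cones,
      ∀ x, x ∈ σ.1.carrier ↔ ∀ i, realMatrix (M i) *ᵥ x ∈ (τ i).1.carrier := by
    intro σ
    obtain ⟨τ, hτ, hx⟩ := h1 σ.1 σ.2
    exact ⟨fun i => ⟨τ i, hτ i⟩, hx⟩
  choose p hp using h1'
  have hincl : ∀ (σ : RationalCone ι) (τ : Fin k → RationalCone κ),
      (∀ x, x ∈ σ.carrier ↔ ∀ i, realMatrix (M i) *ᵥ x ∈ (τ i).carrier) → ∀ i z,
        (z ∈ (τ i).carrier ↔ realMatrix (N i) *ᵥ z ∈ σ.carrier) := by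
    intro σ τ hστ i z
    rw [hστ]
    constructor
    · intro hz j
      by_cases hij : j = i
      · subst hij
        rwa [h.proj_incl]
      · rw [h.proj_incl_ne hij]
        exact Submodule.zero_mem _
    · intro hz
      simpa only [h.proj_incl] using hz i
  have hq := fun σ : C.cones => hincl σ.1 (fun i => (p σ i).1) (hp σ)
  -- The factors of a product cone are its preimages under the inclusions, hence determined by the
  -- cone.
  have hpeq : ∀ (σ : C.cones) (τ : Fin k → D.cones),
      (∀ x, x ∈ σ.1.carrier ↔ ∀ i, realMatrix (M i) *ᵥ x ∈ (τ i).1.carrier) →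
        ∀ i, p σ i = τ i := fun σ τ hστ i => Subtype.ext (RationalCone.ext fun z => by
    rw [hq σ i, hincl σ.1 (fun i => (τ i).1) hστ])
  have hg : ∀ (σ : C.cones) (i) (m : κ → ℤ), m ∈ (p σ i).1.dualMonoid →
      m ᵥ* M i ∈ σ.1.dualMonoid := by
    intro σ i m hm x hx
    rw [pairing_vecMul]
    exact hm _ ((hp σ x).1 hx i)
  have hh : ∀ (σ : C.cones) (i) (n : ι → ℤ), n ∈ σ.1.dualMonoid →
      n ᵥ* N i ∈ (p σ i).1.dualMonoid := by
    intro σ i n hn z hz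
    rw [pairing_vecMul]
    exact hn _ ((hq σ i z).1 hz)
  have hsum : ∀ (m : Fin k → κ → ℤ) (i), (∑ j, m j ᵥ* M j) ᵥ* N i = m i := by
    intro m i
    rw [Matrix.sum_vecMul, Finset.sum_eq_single i (fun j _ hj => h.vecMul_ne hj _) (by simp),
      h.vecMul_self]
  -- The dual monoid of a product of cones is the product of the dual monoids.
  let E : ∀ σ : C.cones, σ.1.dualMonoid ≃+ ∀ i, (p σ i).1.dualMonoid := fun σ =>
    { toFun := fun n i => ⟨n.1 ᵥ* N i, hh σ i n.1 n.2⟩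
      invFun := fun m => ⟨∑ j, (m j).1 ᵥ* M j,
        sum_mem fun j _ => hg σ j (m j).1 (m j).2⟩
      left_inv := fun n => Subtype.ext (h.sum_vecMul n.1)
      right_inv := fun m => funext fun i => Subtype.ext (hsum (fun j => (m j).1) i)
      map_add' := fun m n => funext fun i => Subtype.ext (Matrix.add_vecMul _ _ _) }
  let G : ∀ (σ : C.cones) i, (p σ i).1.dualMonoid →+ σ.1.dualMonoid := fun σ i =>
    { toFun := fun m => ⟨m.1 ᵥ* M i, hg σ i m.1 m.2⟩
      map_zero' := Subtype.ext (Matrix.zero_vecMul _)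
      map_add' := fun m n => Subtype.ext (Matrix.add_vecMul _ _ _) }
  have hEG : ∀ σ i r, (E σ).symm (Pi.single i r) = G σ i r := by
    intro σ i r
    rw [AddEquiv.symm_apply_eq]
    funext j
    apply Subtype.ext
    change _ = (r.1 ᵥ* M i) ᵥ* N j
    by_cases hij : j = i
    · subst hij
      rw [Pi.single_eq_same, h.vecMul_self]
    · rw [Pi.single_eq_of_ne hij, h.vecMul_ne (Ne.symm hij)]
      rfl
  let φ : ∀ (σ : C.cones) i, (p σ i).1.Ring →ₐ[ℂ] σ.1.Ring := fun σ i =>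
    AddMonoidAlgebra.mapDomainAlgHom ℂ ℂ (G σ i)
  have hφ : ∀ σ i r (c : ℂ), φ σ i (AddMonoidAlgebra.single r c) =
      AddMonoidAlgebra.single (G σ i r) c := fun σ i r c => AddMonoidAlgebra.mapDomain_single
  refine nonempty_iso_pi C D (fun i σ => p σ i) (fun i σ => specOverMap (φ σ i)) ?_ ?_ ?_ ?_
  · intro σ τ hστ i
    obtain ⟨n, hn⟩ := hστ
    have h' : (p σ i).1 ≤ (p τ i).1 := by
      refine ⟨n ᵥ* N i, hh τ i n hn.1, fun z => ?_⟩
      rw [hq σ, hq τ, hn.2, pairing_vecMul]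
    refine ⟨h', ?_⟩
    have hcomp : (φ σ i).comp (RationalCone.ringMap h') =
        (RationalCone.ringMap ⟨n, hn⟩).comp (φ τ i) := by
      refine AddMonoidAlgebra.algHom_ext (fun r => ?_) (Subsingleton.elim _ _)
      rw [AlgHom.comp_apply, AlgHom.comp_apply, RationalCone.ringMap_single, hφ, hφ,
        RationalCone.ringMap_single]
      rfl
    apply Over.OverMorphism.ext
    change Spec.map (CommRingCat.ofHom (φ σ i).toRingHom) ≫
        Spec.map (CommRingCat.ofHom (RationalCone.ringMap h').toRingHom) =
      Spec.map (CommRingCat.ofHom (RationalCone.ringMap ⟨n, hn⟩).toRingHom) ≫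
        Spec.map (CommRingCat.ofHom (φ τ i).toRingHom)
    rw [← Spec.map_comp, ← Spec.map_comp, ← CommRingCat.ofHom_comp, ← CommRingCat.ofHom_comp]
    congr 2
    exact congrArg AlgHom.toRingHom hcomp
  · intro σ T f
    refine existsUnique_specOver_lift (E σ) (fun i => specOverMap (φ σ i))
      (fun i => ⟨φ σ i, rfl, fun r => ?_⟩) f
    rw [hφ, hEG]
  · intro τ
    obtain ⟨σ, hσ, hx⟩ := h2 (fun i => (τ i).1) fun i => (τ i).2
    exact ⟨⟨σ, hσ⟩, hpeq ⟨σ, hσ⟩ τ hx⟩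
  · intro σ τ ρ hρσ hρτ
    -- If `m i` cuts out `ρ i`, the sum of the pulled back forms is nonnegative on σ and vanishes
    -- exactly where all of them do. The resulting face depends only on the `ρ i`, so it is the same
    -- for σ and τ.
    have key : ∀ σ : C.cones, (∀ i, (ρ i).1 ≤ (p σ i).1) → ∃ μ : RationalCone ι, μ ≤ σ.1 ∧
        ∀ x, x ∈ μ.carrier ↔ ∀ i, realMatrix (M i) *ᵥ x ∈ (ρ i).1.carrier := by
      intro σ hσ
      choose m hm using hσ
      have hmem : ∑ i, m i ᵥ* M i ∈ σ.1.dualMonoid :=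
        sum_mem fun i _ => hg σ i (m i) (hm i).1
      refine ⟨σ.1.faceBy _ hmem, ⟨_, σ.1.isFaceBy_faceBy _ hmem⟩, fun x => ?_⟩
      rw [(σ.1.isFaceBy_faceBy _ hmem).2, pairing_sum]
      constructor
      · rintro ⟨hx, h0⟩ i
        rw [Finset.sum_eq_zero_iff_of_nonneg
          fun i _ => hg σ i (m i) (hm i).1 x hx] at h0
        rw [(hm i).2, ← pairing_vecMul]
        exact ⟨(hp σ x).1 hx i, h0 i (Finset.mem_univ i)⟩
      · intro hx
        refine ⟨(hp σ x).2 fun i => (((hm i).2 _).1 (hx i)).1,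
          Finset.sum_eq_zero fun i _ => ?_⟩
        rw [pairing_vecMul]
        exact (((hm i).2 _).1 (hx i)).2
    obtain ⟨μ, hμσ, hμ⟩ := key σ hρσ
    obtain ⟨ν, hντ, hν⟩ := key τ hρτ
    have hμν : μ = ν := RationalCone.ext fun x => by rw [hμ, hν]
    have hμC := C.face_mem hμσ σ.2
    exact ⟨⟨μ, hμC⟩, hμσ, hμν ▸ hντ, hpeq ⟨μ, hμC⟩ ρ hμ⟩

end Splitting

/-- If the polytope `P` is isomorphic to the free sum of hexagons, then its toric variety is a
power of `S₃`. -/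
theorem LatticeIso.nonempty_iso_S3pow [DecidableEq ι] {P : Set (ι → ℝ)} {k : ℕ}
    (hP : LatticeIso P (hexagonSum k)) (h0 : (0 : ι → ℝ) ∈ interior P) :
    Nonempty (toricVariety (spannedFan P) ≅ S3pow k) := by
  obtain ⟨A, B, hAB, hBA, hAP⟩ := hP.exists_matrix
  -- The blocks of rows of `A` are the projections to the planes, the blocks of columns of its
  -- inverse the inclusions.
  let M : Fin k → Matrix (Fin 2) ι ℤ := fun i => A.submatrix (fun j => (i, j)) id
  let N : Fin k → Matrix ι (Fin 2) ℤ := fun i => B.submatrix id (fun j => (i, j))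
  have hMN : ∀ i j a b, (M i * N j) a b = (1 : Matrix (Fin k × Fin 2) (Fin k × Fin 2) ℤ) (i, a) (j, b) := by
    intro i j a b
    rw [← hAB]
    rfl
  have h : Splitting M N := by
    refine ⟨fun i => ?_, fun i j hij => ?_, ?_⟩
    · ext a b
      rw [hMN]
      simp [Matrix.one_apply]
    · ext a b
      rw [hMN, Matrix.one_apply_ne (fun h => hij (Prod.ext_iff.1 h).1)]
      rfl
    · rw [← hBA]
      ext a b
      rw [Matrix.sum_apply, Matrix.mul_apply, Fintype.sum_prod_type]
      rfl
  set S : Set (ι → ℤ) := {v | ∃ i, ∃ m ∈ (hexagon : Set (Fin 2 → ℤ)), v = N i *ᵥ m} with hS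
  have hBe : ∀ i m, B *ᵥ embed i m = N i *ᵥ m := by
    intro i m
    ext a
    have := embed_dotProduct i m (B a)
    rw [dotProduct_comm] at this
    change B a ⬝ᵥ embed i m = (fun j => B a (i, j)) ⬝ᵥ m
    rw [this, dotProduct_comm]
  have hSB : S = (B *ᵥ ·) '' freeSum k hexagon := by
    ext v
    constructor
    · rintro ⟨i, m, hm, rfl⟩
      exact ⟨_, ⟨i, m, hm, rfl⟩, hBe i m⟩
    · rintro ⟨_, ⟨i, m, hm, rfl⟩, rfl⟩
      exact ⟨i, m, hm, hBe i m⟩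
  have hPS : P = convexHull ℝ (intVec '' S) := by
    rw [hSB, ← image_convexHull_matrix]
    change P = (realMatrix B *ᵥ ·) '' hexagonSum k
    rw [← hAP, Set.image_image]
    simp_rw [Matrix.mulVec_mulVec, ← realMatrix_mul, hBA, realMatrix_one, Matrix.one_mulVec]
    exact (Set.image_id' P).symm
  have hSfin : (intVec '' S).Finite := by
    rw [hSB]
    exact ((finite_freeSum _).image _).image _
  have h0' : (0 : Fin 2 → ℝ) ∈ interior (convexHull ℝ (intVec '' (hexagon : Set (Fin 2 → ℤ)))) := by
    rw [convexHull_hexagon, mem_interior]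
    refine ⟨{x | (-1 < x 0 ∧ x 0 < 1) ∧ (-1 < x 1 ∧ x 1 < 1) ∧ (-1 < x 0 - x 1 ∧ x 0 - x 1 < 1)},
      fun x hx => mem_Z2_iff.2 ⟨⟨hx.1.1.le, hx.1.2.le⟩, ⟨hx.2.1.1.le, hx.2.1.2.le⟩,
        hx.2.2.1.le, hx.2.2.2.le⟩, ?_, by norm_num⟩
    simp only [Set.ofPred_and]
    repeat' apply IsOpen.inter
    all_goals exact isOpen_lt (by fun_prop) (by fun_prop)
  have hHfin : (intVec '' (hexagon : Set (Fin 2 → ℤ))).Finite := hexagon.finite_toSet.image _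
  rw [hPS] at h0 ⊢
  have hdual : ∀ y : ι → ℝ, y ∈ ToricFano.dual (convexHull ℝ (intVec '' S)) ↔ ∀ i, y ᵥ* realMatrix (N i) ∈
      ToricFano.dual (convexHull ℝ (intVec '' (hexagon : Set (Fin 2 → ℤ)))) := by
    intro y
    simp_rw [mem_dual_convexHull]
    have hdot : ∀ i (z : Fin 2 → ℝ), (realMatrix (N i) *ᵥ z) ⬝ᵥ y = z ⬝ᵥ (y ᵥ* realMatrix (N i)) := by
      intro i z
      rw [dotProduct_comm, Matrix.dotProduct_mulVec, dotProduct_comm]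
    constructor
    · rintro hy i _ ⟨m, hm, rfl⟩
      rw [← hdot, realMatrix_mulVec]
      exact hy _ ⟨_, ⟨i, m, hm, rfl⟩, rfl⟩
    · rintro hy _ ⟨_, ⟨i, m, hm, rfl⟩, rfl⟩
      rw [← realMatrix_mulVec, hdot]
      exact hy i _ ⟨m, hm, rfl⟩
  have hfg : ∀ {α : Type} (H : Set (α → ℤ)) (hH : (intVec '' H).Finite) (p : (α → ℝ) → Prop),
      ∃ T : Finset (α → ℤ), PointedCone.hull ℝ {s ∈ intVec '' H | p s} =
        PointedCone.hull ℝ (intVec '' (T : Set (α → ℤ))) := by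
    intro α H hH p
    have hf : {m ∈ H | p (intVec m)}.Finite :=
      (hH.of_finite_image intVec_injective.injOn).subset (Set.sep_subset _ _)
    refine ⟨hf.toFinset, ?_⟩
    rw [hf.coe_toFinset]
    congr 1
    ext s
    constructor
    · rintro ⟨⟨m, hm, rfl⟩, hs⟩
      exact ⟨m, ⟨hm, hs⟩, rfl⟩
    · rintro ⟨m, ⟨hm, hs⟩, rfl⟩
      exact ⟨⟨m, hm, rfl⟩, hs⟩
  suffices key : Nonempty (toricVariety (spannedFan (convexHull ℝ (intVec '' S))) ≅
      ∏ᶜ fun _ : Fin k => toricVariety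
        (spannedFan (convexHull ℝ (intVec '' (hexagon : Set (Fin 2 → ℤ)))))) by
    rw [convexHull_hexagon] at key
    exact key
  refine h.nonempty_iso ?_ ?_
  · intro σ hσ
    obtain ⟨y, hy, hσy⟩ := (mem_spannedFan_iff hSfin h0).1 hσ
    refine ⟨fun i => ⟨PointedCone.hull ℝ {s ∈ intVec '' (hexagon : Set (Fin 2 → ℤ)) |
      s ⬝ᵥ (y ᵥ* realMatrix (N i)) = -1}, hfg _ hHfin _⟩, fun i => ?_, fun x => ?_⟩
    · exact (mem_spannedFan_iff hHfin h0').2 ⟨_, (hdual y).1 hy i, rfl⟩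
    · rw [hσy, h.mem_hull_iff]
  · intro τ hτ
    have := fun i => (mem_spannedFan_iff hHfin h0').1 (hτ i)
    choose z hz hτz using this
    have hy : ∀ i, (∑ j, z j ᵥ* realMatrix (M j)) ᵥ* realMatrix (N i) = z i := by
      intro i
      rw [Matrix.sum_vecMul, Finset.sum_eq_single i (fun j _ hj => ?_) (by simp),
        Matrix.vecMul_vecMul, h.real_mul_self, Matrix.vecMul_one]
      rw [Matrix.vecMul_vecMul, h.real_mul_ne hj, Matrix.vecMul_zero]
    refine ⟨⟨PointedCone.hull ℝ {s ∈ intVec '' S | s ⬝ᵥ (∑ j, z j ᵥ* realMatrix (M j)) = -1},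
      hfg _ hSfin _⟩, (mem_spannedFan_iff hSfin h0).2 ⟨_, (hdual _).2 fun i => ?_, rfl⟩, fun x => ?_⟩
    · rw [hy]
      exact hz i
    · refine h.mem_hull_iff.trans (forall_congr' fun i => ?_)
      rw [hy, hτz]

end Splitting

/-! ### Points of codimension one missed by a map. -/

section CodimOne

variable {X Y Z : Type} [TopologicalSpace X] [TopologicalSpace Y] [TopologicalSpace Z]

/-- A point whose closure is the whole space. -/
def IsGenericPt (x : X) : Prop := ∀ y, x ⤳ y

/-- The points of codimension one, for an irreducible space with a generic point: those whose only
proper generization is the generic point. -/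
def codimOne (X : Type) [TopologicalSpace X] : Set X :=
  {x | ¬ IsGenericPt x ∧ ∀ y, y ⤳ x → y = x ∨ IsGenericPt y}

theorem isGenericPt_iff {c : X → Y} (hc : Topology.IsOpenEmbedding c) {η : Y}
    (hη : IsGenericPt η) {x : X} : IsGenericPt (c x) ↔ IsGenericPt x := by
  constructor
  · intro h y
    exact hc.isInducing.specializes_iff.1 (h (c y))
  · intro h y
    obtain ⟨z, rfl⟩ := (hη (c x)).mem_open hc.isOpen_range ⟨x, rfl⟩
    exact (hc.isInducing.specializes_iff.2 (h z)).trans (hη y)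

/-- An open set contains all generizations of its points, and the generic point, so codimension one
can be tested on it. -/
theorem mem_codimOne_iff {c : X → Y} (hc : Topology.IsOpenEmbedding c) {η : Y}
    (hη : IsGenericPt η) {x : X} : c x ∈ codimOne Y ↔ x ∈ codimOne X := by
  refine and_congr (not_congr (isGenericPt_iff hc hη)) ⟨fun h y hy => ?_, fun h y hy => ?_⟩
  · exact (h _ (hc.isInducing.specializes_iff.2 hy)).imp (fun e => hc.injective e)
      (isGenericPt_iff hc hη).1
  · obtain ⟨z, rfl⟩ := hy.mem_open hc.isOpen_range ⟨x, rfl⟩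
    exact (h z (hc.isInducing.specializes_iff.1 hy)).imp (fun e => congrArg c e)
      (isGenericPt_iff hc hη).2

/-- The points of codimension one that are not in the image of a map. -/
def codimOneCompl (c : X → Y) : Set Y := codimOne Y \ Set.range c

omit [TopologicalSpace X] in
theorem codimOneCompl_comp {s : X → Y} {c : Y → Z} (hc : Topology.IsOpenEmbedding c) {η : Z}
    (hη : IsGenericPt η) : codimOneCompl (c ∘ s) = codimOneCompl c ∪ c '' codimOneCompl s := by
  ext z
  constructor
  · rintro ⟨h1, h2⟩
    by_cases hz : z ∈ Set.range c
    · obtain ⟨y, rfl⟩ := hz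
      refine Or.inr ⟨y, ⟨(mem_codimOne_iff hc hη).1 h1, ?_⟩, rfl⟩
      rintro ⟨x, rfl⟩
      exact h2 ⟨x, rfl⟩
    · exact Or.inl ⟨h1, hz⟩
  · rintro (⟨h1, h2⟩ | ⟨y, ⟨h1, h2⟩, rfl⟩)
    · exact ⟨h1, fun ⟨x, hx⟩ => h2 ⟨s x, hx⟩⟩
    · refine ⟨(mem_codimOne_iff hc hη).2 h1, ?_⟩
      rintro ⟨x, hx⟩
      exact h2 ⟨x, hc.injective hx⟩

omit [TopologicalSpace X] in
theorem ncard_codimOneCompl_comp {s : X → Y} {c : Y → Z} (hc : Topology.IsOpenEmbedding c) {η : Z}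
    (hη : IsGenericPt η) (hfc : (codimOneCompl c).Finite) (hfs : (codimOneCompl s).Finite) :
    (codimOneCompl (c ∘ s)).ncard = (codimOneCompl c).ncard + (codimOneCompl s).ncard := by
  rw [codimOneCompl_comp hc hη, Set.ncard_union_eq ?_ hfc (hfs.image c),
    Set.ncard_image_of_injective _ hc.injective]
  rw [Set.disjoint_left]
  rintro _ ⟨_, h⟩ ⟨y, _, rfl⟩
  exact h ⟨y, rfl⟩

omit [TopologicalSpace X] in
theorem finite_codimOneCompl_of_comp {s : X → Y} {c : Y → Z} (hc : Topology.IsOpenEmbedding c)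
    {η : Z} (hη : IsGenericPt η) (hf : (codimOneCompl (c ∘ s)).Finite) :
    (codimOneCompl c).Finite ∧ (codimOneCompl s).Finite := by
  rw [codimOneCompl_comp hc hη] at hf
  exact ⟨hf.subset Set.subset_union_left,
    (hf.subset Set.subset_union_right).of_finite_image hc.injective.injOn⟩

end CodimOne

/-! ### Prime divisors and units of localizations in factorial rings. -/

section Factorial

variable {B : Type} [CommRing B] [IsDomain B]

theorem isGenericPt_primeSpectrum_iff {p : PrimeSpectrum B} :
    IsGenericPt p ↔ p.asIdeal = ⊥ := by
  constructor
  · intro h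
    exact le_bot_iff.1 ((PrimeSpectrum.le_iff_specializes _ _).2 (h ⊥))
  · intro h q
    rw [← PrimeSpectrum.le_iff_specializes, ← PrimeSpectrum.asIdeal_le_asIdeal, h]
    exact bot_le

theorem mem_codimOne_primeSpectrum_iff {p : PrimeSpectrum B} : p ∈ codimOne (PrimeSpectrum B) ↔
    p.asIdeal ≠ ⊥ ∧ ∀ q : PrimeSpectrum B, q.asIdeal ≤ p.asIdeal → q = p ∨ q.asIdeal = ⊥ := by
  simp only [codimOne, Set.mem_ofPred_eq, isGenericPt_primeSpectrum_iff,
    ← PrimeSpectrum.le_iff_specializes, ← PrimeSpectrum.asIdeal_le_asIdeal, ne_eq]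

variable [UniqueFactorizationMonoid B]

/-- A nonzero prime ideal of a factorial ring contains a prime element, and minimality makes this
element a generator. With `mem_codimOne_of_prime`, points of codimension one are primes up to units.
-/
theorem exists_prime_of_mem_codimOne {p : PrimeSpectrum B} (hp : p ∈ codimOne (PrimeSpectrum B)) :
    ∃ q, Prime q ∧ p.asIdeal = Ideal.span {q} := by
  obtain ⟨h0, h⟩ := mem_codimOne_primeSpectrum_iff.1 hp
  obtain ⟨q, hqp, hq⟩ := p.2.exists_mem_prime_of_ne_bot h0
  have hprime : (Ideal.span {q}).IsPrime := (Ideal.span_singleton_prime hq.ne_zero).2 hq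
  refine ⟨q, hq, ?_⟩
  rcases h ⟨_, hprime⟩ ((Ideal.span_singleton_le_iff_mem _).2 hqp) with h1 | h1
  · rw [← h1]
  · exact absurd (Ideal.span_singleton_eq_bot.1 h1) hq.ne_zero

theorem mem_codimOne_of_prime {q : B} (hq : Prime q) :
    (⟨Ideal.span {q}, (Ideal.span_singleton_prime hq.ne_zero).2 hq⟩ : PrimeSpectrum B) ∈
      codimOne (PrimeSpectrum B) := by
  refine mem_codimOne_primeSpectrum_iff.2 ⟨fun h => hq.ne_zero (Ideal.span_singleton_eq_bot.1 h),
    fun p hp => ?_⟩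
  by_cases h0 : p.asIdeal = ⊥
  · exact Or.inr h0
  obtain ⟨r, hrp, hr⟩ := p.2.exists_mem_prime_of_ne_bot h0
  left
  apply PrimeSpectrum.ext
  refine le_antisymm hp ((Ideal.span_singleton_le_iff_mem _).2 ?_)
  have h1 : q ∣ r := Ideal.mem_span_singleton.1 (hp hrp)
  exact p.asIdeal.mem_of_dvd (hq.associated_of_dvd hr h1).symm.dvd hrp

/-- The prime divisors of an element, as points of codimension one. -/
def primeDivisors (f : B) : Set (PrimeSpectrum B) :=
  {p ∈ codimOne (PrimeSpectrum B) | f ∈ p.asIdeal}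

omit [UniqueFactorizationMonoid B] in
theorem finite_primeDivisors [IsNoetherianRing B] {f : B} (hf : f ≠ 0) :
    (primeDivisors f).Finite := by
  refine Set.Finite.of_finite_image (f := PrimeSpectrum.asIdeal)
    ((Ideal.finite_minimalPrimes_of_isNoetherianRing B (Ideal.span {f})).subset ?_)
    fun p _ q _ h => PrimeSpectrum.ext h
  rintro _ ⟨p, ⟨hp, hfp⟩, rfl⟩
  refine ⟨⟨p.2, (Ideal.span_singleton_le_iff_mem _).2 hfp⟩, fun q hq hqp => ?_⟩
  rcases (mem_codimOne_primeSpectrum_iff.1 hp).2 ⟨q, hq.1⟩ hqp with h | h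
  · exact (congrArg PrimeSpectrum.asIdeal h).ge
  · have h' : q = ⊥ := h
    have := hq.2 (Ideal.mem_span_singleton_self f)
    rw [h'] at this
    exact absurd this hf

variable (R : Type) [CommRing R] [Algebra B R]

/-- This is the `q`-adic order on the units of B_f, computed from any representation as a quotient
by a power of `f`; unique factorization makes it independent of the representation. -/
theorem exists_valuation {f : B} (hf : f ≠ 0) [IsLocalization.Away f R] {q : B} (hq : Prime q) :
    ∃ v : Rˣ →* Multiplicative ℤ, ∀ (r : Rˣ) (a : B) (n : ℕ),
      (r : R) * algebraMap B R f ^ n = algebraMap B R a →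
        (v r).toAdd = (multiplicity q a : ℤ) - n * multiplicity q f := by
  have hinj : Function.Injective (algebraMap B R) :=
    IsLocalization.injective R (powers_le_nonZeroDivisors_of_noZeroDivisors hf)
  have hR : Nontrivial R := hinj.nontrivial
  have hmul : ∀ {a b : B}, a ≠ 0 → b ≠ 0 →
      multiplicity q (a * b) = multiplicity q a + multiplicity q b := fun ha hb =>
    multiplicity_mul hq (.of_prime_left hq (mul_ne_zero ha hb))
  have hpow : ∀ n : ℕ, multiplicity q (f ^ n) = n * multiplicity q f := fun n =>
    FiniteMultiplicity.multiplicity_pow hq (.of_prime_left hq hf)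
  have hfu : IsUnit (algebraMap B R f) := IsLocalization.Away.algebraMap_isUnit f
  have hne : ∀ (r : Rˣ) (a : B) (n : ℕ), (r : R) * algebraMap B R f ^ n = algebraMap B R a →
      a ≠ 0 := by
    rintro r a n h rfl
    rw [map_zero] at h
    exact (r.isUnit.mul (hfu.pow n)).ne_zero h
  choose n a hna using fun r : Rˣ => IsLocalization.Away.surj f (r : R)
  have key : ∀ (r : Rˣ) (b : B) (m : ℕ), (r : R) * algebraMap B R f ^ m = algebraMap B R b →
      (multiplicity q (a r) : ℤ) - n r * multiplicity q f =
        multiplicity q b - m * multiplicity q f := by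
    intro r b m h
    have h1 : a r * f ^ m = b * f ^ n r := by
      apply hinj
      rw [map_mul, map_mul, ← hna, ← h, map_pow, map_pow]
      ring
    have h2 := congrArg (multiplicity q) h1
    rw [hmul (hne r _ _ (hna r)) (pow_ne_zero _ hf), hmul (hne r _ _ h) (pow_ne_zero _ hf), hpow,
      hpow] at h2
    have h3 : (multiplicity q (a r) : ℤ) + m * multiplicity q f =
      multiplicity q b + n r * multiplicity q f := by exact_mod_cast h2
    linarith
  refine ⟨MonoidHom.mk' (fun r => Multiplicative.ofAdd
    ((multiplicity q (a r) : ℤ) - n r * multiplicity q f)) fun r s => ?_, fun r b m h => key r b m h⟩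
  have h1 : ((r * s : Rˣ) : R) * algebraMap B R f ^ (n r + n s) = algebraMap B R (a r * a s) := by
    rw [map_mul, ← hna, ← hna, Units.val_mul]
    ring
  rw [← ofAdd_add, key _ _ _ h1, hmul (hne r _ _ (hna r)) (hne s _ _ (hna s))]
  congr 1
  push_cast
  ring

/-- The units of B_f modulo those of B are free on the primes dividing `f`: the orders at these
primes are independent, and a unit of order 0 at all of them comes from B. -/
theorem exists_units_hom {f : B} (hf : f ≠ 0) [IsLocalization.Away f R] [Finite (primeDivisors f)] :
    ∃ v : Rˣ →* Multiplicative (primeDivisors f → ℤ), Function.Surjective v ∧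
      ∀ r, v r = 1 → ∃ u : Bˣ, Units.map (algebraMap B R : B →* R) u = r := by
  classical
  have hinj : Function.Injective (algebraMap B R) :=
    IsLocalization.injective R (powers_le_nonZeroDivisors_of_noZeroDivisors hf)
  have hR : Nontrivial R := hinj.nontrivial
  have hfu : IsUnit (algebraMap B R f) := IsLocalization.Away.algebraMap_isUnit f
  choose q hq hpq using fun p : primeDivisors f => exists_prime_of_mem_codimOne p.2.1
  choose v hv using fun p : primeDivisors f => exists_valuation R hf (hq p)
  have hqf : ∀ p, q p ∣ f := fun p => by
    have := p.2.2
    rwa [hpq, Ideal.mem_span_singleton] at this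
  have hqu : ∀ p, IsUnit (algebraMap B R (q p)) := fun p =>
    isUnit_of_dvd_unit ((algebraMap B R).map_dvd (hqf p)) hfu
  have hnd : ∀ p p', p ≠ p' → ¬ q p ∣ q p' := by
    intro p p' hne hd
    apply hne
    apply Subtype.ext
    apply PrimeSpectrum.ext
    rw [hpq, hpq, Ideal.span_singleton_eq_span_singleton]
    exact (hq p).associated_of_dvd (hq p') hd
  let w : Rˣ →* Multiplicative (primeDivisors f → ℤ) :=
    MonoidHom.mk' (fun r => Multiplicative.ofAdd fun p => (v p r).toAdd) fun r s => by
      rw [← ofAdd_add]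
      congr 1
      funext p
      rw [map_mul]
      rfl
  have hw : ∀ r p, (w r).toAdd p = (v p r).toAdd := fun r p => rfl
  have hwq : ∀ p, (w (hqu p).unit).toAdd = Pi.single p 1 := by
    intro p
    funext p'
    rw [hw, hv p' (hqu p).unit (q p) 0 (by simp)]
    by_cases h : p' = p
    · subst h
      rw [Pi.single_eq_same]
      simp
    · rw [Pi.single_eq_of_ne h, multiplicity_eq_zero.2 (hnd p' p h)]
      simp
  refine ⟨w, ?_, ?_⟩
  · intro z
    have := Fintype.ofFinite (primeDivisors f)
    refine ⟨∏ p, (hqu p).unit ^ (z.toAdd p), ?_⟩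
    rw [map_prod]
    simp_rw [map_zpow]
    apply Multiplicative.toAdd.injective
    rw [toAdd_prod]
    simp_rw [toAdd_zpow, hwq]
    funext p
    simp [Finset.sum_apply, Pi.single_apply]
  · intro r hr
    obtain ⟨n, a, ha⟩ := IsLocalization.Away.surj f (r : R)
    obtain ⟨m, b, hb⟩ := IsLocalization.Away.surj f ((r⁻¹ : Rˣ) : R)
    have hab : a * b = f ^ (n + m) := by
      apply hinj
      rw [map_mul, ← ha, ← hb, map_pow, pow_add]
      have := r.mul_inv
      linear_combination (algebraMap B R f ^ n * algebraMap B R f ^ m) * this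
    have hab0 : a * b ≠ 0 := hab ▸ pow_ne_zero _ hf
    have ha0 : a ≠ 0 := left_ne_zero_of_mul hab0
    -- For primes dividing `f` this is the vanishing of the orders of `r`; any other prime cannot
    -- divide `a`, which divides a power of `f`.
    have hmult : ∀ p, Prime p → emultiplicity p a = emultiplicity p (f ^ n) := by
      intro p hp
      by_cases hpf : p ∣ f
      · let P : primeDivisors f := ⟨_, mem_codimOne_of_prime hp, Ideal.mem_span_singleton.2 hpf⟩
        have hass : Associated (q P) p := by
          rw [← Ideal.span_singleton_eq_span_singleton, ← hpq]
        have h1 : (v P r).toAdd = 0 := by rw [← hw, hr]; rfl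
        rw [hv P r a n ha, sub_eq_zero] at h1
        rw [emultiplicity_eq_of_associated_left hass,
          emultiplicity_eq_of_associated_left hass,
          (FiniteMultiplicity.of_prime_left (hq P) ha0).emultiplicity_eq_multiplicity,
          (FiniteMultiplicity.of_prime_left (hq P)
            (pow_ne_zero n hf)).emultiplicity_eq_multiplicity,
          FiniteMultiplicity.multiplicity_pow (hq P) (.of_prime_left (hq P) hf)]
        exact_mod_cast h1
      · rw [emultiplicity_eq_zero.2 (fun h => hpf (hp.dvd_of_dvd_pow h)), emultiplicity_eq_zero.2]
        intro h
        exact hpf (hp.dvd_of_dvd_pow (hab ▸ h.mul_right b))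
    have hass : Associated (f ^ n) a := associated_of_dvd_dvd
      ((UniqueFactorizationMonoid.dvd_iff_emultiplicity_le (pow_ne_zero n hf)).2
        fun p hp => (hmult p hp).ge)
      ((UniqueFactorizationMonoid.dvd_iff_emultiplicity_le ha0).2 fun p hp => (hmult p hp).le)
    obtain ⟨u, hu⟩ := hass
    refine ⟨u, Units.ext ?_⟩
    have h1 : (r : R) * algebraMap B R f ^ n = algebraMap B R u * algebraMap B R f ^ n := by
      rw [ha, ← hu, map_mul, map_pow, mul_comm]
    exact ((hfu.pow n).mul_left_inj.1 h1).symm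

end Factorial

/-! ### The rank of the units modulo a divisible subgroup. -/

section Divisible

/-- The rank of the quotient of an abelian group by a divisible subgroup, if free of finite rank,
does not depend on the subgroup. -/
theorem card_eq_of_surjective {G : Type} [CommGroup G] {α β : Type} [Finite α] [Finite β]
    (v : G →* Multiplicative (α → ℤ)) (hv : Function.Surjective v)
    (hvd : ∀ g, v g = 1 → ∀ n : ℕ, 0 < n → ∃ h, h ^ n = g)
    (w : G →* Multiplicative (β → ℤ)) (hw : Function.Surjective w)
    (hwd : ∀ g, w g = 1 → ∀ n : ℕ, 0 < n → ∃ h, h ^ n = g) : Nat.card α = Nat.card β := by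
  have key : ∀ {α β : Type} (v : G →* Multiplicative (α → ℤ)) (w : G →* Multiplicative (β → ℤ)),
      (∀ g, v g = 1 → ∀ n : ℕ, 0 < n → ∃ h, h ^ n = g) → v.ker ≤ w.ker := by
    intro α β v w hvd g hg
    rw [MonoidHom.mem_ker]
    apply Multiplicative.toAdd.injective
    funext j
    -- An integer divisible by its absolute value plus one is 0. Hence each kernel, being divisible,
    -- is contained in the other one.
    obtain ⟨h, hh⟩ := hvd g hg (((w g).toAdd j).natAbs + 1) (Nat.succ_pos _)
    have h1 : (w g).toAdd j = ((((w g).toAdd j).natAbs + 1 : ℕ) : ℤ) * (w h).toAdd j := by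
      conv_lhs => rw [← hh, map_pow, toAdd_pow]
      simp
    exact Int.eq_zero_of_abs_lt_dvd ⟨_, h1⟩ (by rw [Int.abs_eq_natAbs]; push_cast; omega)
  have hker : v.ker = w.ker := le_antisymm (key v w hvd) (key w v hwd)
  let e : Multiplicative (α → ℤ) ≃* Multiplicative (β → ℤ) :=
    ((QuotientGroup.quotientKerEquivOfSurjective v hv).symm.trans
      (QuotientGroup.quotientMulEquivOfEq hker)).trans
      (QuotientGroup.quotientKerEquivOfSurjective w hw)
  have := Fintype.ofFinite α
  have := Fintype.ofFinite β
  have h := (AddEquiv.toMultiplicative.symm e).toIntLinearEquiv.finrank_eq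
  rw [Module.finrank_fintype_fun_eq_card, Module.finrank_fintype_fun_eq_card] at h
  rwa [Nat.card_eq_fintype_card, Nat.card_eq_fintype_card]

/-- The number of prime divisors of `f` is determined by the localization at `f`. -/
theorem ncard_primeDivisors_eq {B : Type} [CommRing B] [IsDomain B] [UniqueFactorizationMonoid B]
    [IsNoetherianRing B] (hB : ∀ (u : Bˣ) (n : ℕ), 0 < n → ∃ w : Bˣ, w ^ n = u) {f g : B}
    (hf : f ≠ 0) (hg : g ≠ 0) (e : Localization.Away f ≃+* Localization.Away g) :
    (primeDivisors f).ncard = (primeDivisors g).ncard := by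
  have := (finite_primeDivisors hf).to_subtype
  have := (finite_primeDivisors hg).to_subtype
  obtain ⟨v, hv, hvk⟩ := exists_units_hom (Localization.Away f) hf
  obtain ⟨w, hw, hwk⟩ := exists_units_hom (Localization.Away g) hg
  let E := Units.mapEquiv (e : Localization.Away f ≃* Localization.Away g)
  refine card_eq_of_surjective v hv ?_ (w.comp E.toMonoidHom) (hw.comp E.surjective) ?_
  · intro r hr n hn
    obtain ⟨u, rfl⟩ := hvk r hr
    obtain ⟨x, rfl⟩ := hB u n hn
    exact ⟨Units.map (algebraMap B (Localization.Away f) : B →* Localization.Away f) x,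
      (map_pow _ _ _).symm⟩
  · intro r hr n hn
    obtain ⟨u, hu⟩ := hwk (E r) hr
    obtain ⟨x, rfl⟩ := hB u n hn
    refine ⟨E.symm (Units.map (algebraMap B (Localization.Away g) : B →* Localization.Away g) x), ?_⟩
    rw [← map_pow, ← map_pow, hu]
    exact E.symm_apply_apply r

end Divisible

/-! ### Comparison of two open immersions of the same affine scheme. -/

section TorusCharts

theorem exists_basicOpen_eq_preimage {X : Scheme.{0}} {A : Type} [CommRing A]
    (j : Spec (.of A) ⟶ X) {U : X.Opens} (hU : Set.range j ⊆ U) (f : Γ(X, U)) :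
    ∃ f₀ : A, j ⁻¹' (X.basicOpen f) = (PrimeSpectrum.basicOpen f₀ : Set (PrimeSpectrum A)) := by
  have htop : (⊤ : (Spec (.of A)).Opens) = j ⁻¹ᵁ U := by
    refine le_antisymm (fun x _ => ?_) le_top
    exact hU ⟨x, rfl⟩
  let f₁ : Γ(Spec (.of A), ⊤) := (Spec (.of A)).presheaf.map (eqToHom htop).op (j.app U f)
  refine ⟨(Scheme.ΓSpecIso (.of A)).hom f₁, ?_⟩
  have h1 : (Spec (.of A)).basicOpen f₁ = PrimeSpectrum.basicOpen ((Scheme.ΓSpecIso (.of A)).hom f₁) :=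
    basicOpen_eq_of_affine' f₁
  have h2 : (Spec (.of A)).basicOpen f₁ = (Spec (.of A)).basicOpen (j.app U f) :=
    Scheme.basicOpen_res_eq _ _ _
  have h3 := Scheme.preimage_basicOpen j f
  rw [← h2, h1] at h3
  exact congrArg (fun V : (Spec (.of A)).Opens => (V : Set (Spec (.of A)))) h3

/-- Both localizations are the ring of global sections of `W`. -/
theorem nonempty_ringEquiv_of_range {W : Scheme.{0}} {B : Type} [CommRing B]
    (e e' : W ⟶ Spec (.of B)) [IsOpenImmersion e] [IsOpenImmersion e'] {b b' : B}
    (he : Set.range e = (PrimeSpectrum.basicOpen b : Set (PrimeSpectrum B)))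
    (he' : Set.range e' = (PrimeSpectrum.basicOpen b' : Set (PrimeSpectrum B))) :
    Nonempty (Localization.Away b ≃+* Localization.Away b') := by
  have key : ∀ (e : W ⟶ Spec (.of B)) [IsOpenImmersion e] {b : B},
      Set.range e = (PrimeSpectrum.basicOpen b : Set (PrimeSpectrum B)) →
        Nonempty (Localization.Away b ≃+* Γ(W, ⊤)) := by
    intro e _ b he
    have : IsOpenImmersion (Spec.map (CommRingCat.ofHom (algebraMap B (Localization.Away b)))) :=
      IsOpenImmersion.of_isLocalization b
    have hr : Set.range (Spec.map (CommRingCat.ofHom (algebraMap B (Localization.Away b)))) =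
        Set.range e :=
      (PrimeSpectrum.localization_away_comap_range (Localization.Away b) b).trans he.symm
    let i := IsOpenImmersion.isoOfRangeEq _ e hr
    let i' : CommRingCat.of (Localization.Away b) ≅ Γ(W, ⊤) :=
      (Scheme.ΓSpecIso (.of (Localization.Away b))).symm ≪≫ (Scheme.Γ.mapIso i.op).symm
    exact ⟨i'.commRingCatIsoToRingEquiv⟩
  obtain ⟨i⟩ := key e he
  obtain ⟨i'⟩ := key e' he'
  exact ⟨i.trans i'.symm⟩

/-- Two open immersions of the same torus into an irreducible scheme miss the same number of points
of codimension one. Here the torus may be any affine scheme with an open immersion into the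
spectrum of a factorial ring with divisible units. -/
theorem ncard_codimOneCompl_eq {X : Scheme.{0}} {A B : Type} [CommRing A] [CommRing B]
    [IsDomain B] [UniqueFactorizationMonoid B] [IsNoetherianRing B]
    (hB : ∀ (u : Bˣ) (n : ℕ), 0 < n → ∃ w : Bˣ, w ^ n = u)
    (a : Spec (.of A) ⟶ Spec (.of B)) [IsOpenImmersion a]
    (ha : ∀ f : A, ∃ b : B, a '' (PrimeSpectrum.basicOpen f : Set (PrimeSpectrum A)) =
      (PrimeSpectrum.basicOpen b : Set (PrimeSpectrum B)))
    [Nonempty (PrimeSpectrum A)] {η : X} (hη : IsGenericPt η)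
    (j j' : Spec (.of A) ⟶ X) [IsOpenImmersion j] [IsOpenImmersion j']
    (hj : (codimOneCompl j).Finite) (hj' : (codimOneCompl j').Finite) :
    (codimOneCompl j).ncard = (codimOneCompl j').ncard := by
  have hmem : ∀ (j : Spec (.of A) ⟶ X) [IsOpenImmersion j], η ∈ j.opensRange := by
    intro j _
    obtain ⟨x⟩ := (inferInstance : Nonempty (PrimeSpectrum A))
    exact (hη (j x)).mem_open j.isOpenEmbedding.isOpen_range ⟨x, rfl⟩
  obtain ⟨f, g, hfg, hηf⟩ := exists_basicOpen_le_affine_inter (isAffineOpen_opensRange j)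
    (isAffineOpen_opensRange j') η ⟨hmem j, hmem j'⟩
  let W := X.basicOpen f
  have hbot : IsGenericPt (⊥ : PrimeSpectrum B) := isGenericPt_primeSpectrum_iff.2 rfl
  -- With s : W → Spec A the restricted chart, the points of codimension one missed by W in X are
  -- those missed by `j` and those missed by `s`; in Spec B the prime divisors of `b` are the points
  -- missed by `a` and those missed by `s`. Eliminating the contribution of `s` gives the formula.
  have key : ∀ (j : Spec (.of A) ⟶ X) [IsOpenImmersion j] (f : Γ(X, j.opensRange)),
      W = X.basicOpen f → (codimOneCompl j).Finite →
        ∃ (e : (W : Scheme) ⟶ Spec (.of B)) (_ : IsOpenImmersion e) (b : B), b ≠ 0 ∧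
          Set.range e = (PrimeSpectrum.basicOpen b : Set (PrimeSpectrum B)) ∧
          (codimOneCompl W.ι).ncard + (codimOneCompl a).ncard =
            (codimOneCompl j).ncard + (primeDivisors b).ncard := by
    intro j _ f hWf hj
    have hr : Set.range W.ι ⊆ Set.range j := by
      rw [Scheme.Opens.range_ι, hWf]
      exact X.basicOpen_le f
    let s : (W : Scheme) ⟶ Spec (.of A) := IsOpenImmersion.lift j W.ι hr
    have hs : s ≫ j = W.ι := IsOpenImmersion.lift_fac _ _ _
    have : IsOpenImmersion (s ≫ j) := hs ▸ inferInstance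
    have : IsOpenImmersion s := IsOpenImmersion.of_comp s j
    obtain ⟨f₀, hf₀⟩ := exists_basicOpen_eq_preimage j (U := j.opensRange) subset_rfl f
    have hsr : Set.range s = (PrimeSpectrum.basicOpen f₀ : Set (PrimeSpectrum A)) := by
      rw [← hf₀, ← hWf, ← Scheme.Opens.range_ι W, ← hs]
      ext x
      constructor
      · rintro ⟨w, rfl⟩
        exact ⟨w, Scheme.Hom.comp_apply _ _ _⟩
      · rintro ⟨w, hw⟩
        rw [Scheme.Hom.comp_apply] at hw
        exact ⟨w, j.isOpenEmbedding.injective hw⟩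
    obtain ⟨b, hb⟩ := ha f₀
    have her : Set.range (s ≫ a) = (PrimeSpectrum.basicOpen b : Set (PrimeSpectrum B)) := by
      rw [← hb, ← hsr, ← Set.range_comp]
      rfl
    have hb0 : b ≠ 0 := by
      rintro rfl
      have : (s ≫ a) ⟨η, hηf⟩ ∈ Set.range (s ≫ a) := ⟨_, rfl⟩
      rw [her] at this
      exact this (Ideal.zero_mem _)
    have hsa : codimOneCompl (a ∘ s) = primeDivisors b := by
      have h1 : Set.range (a ∘ s) = (PrimeSpectrum.basicOpen b : Set (PrimeSpectrum B)) := her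
      ext p
      change p ∈ codimOne (PrimeSpectrum B) ∧ p ∉ Set.range (a ∘ s) ↔ _
      rw [h1]
      exact and_congr_right fun _ => not_not
    have hfin := finite_codimOneCompl_of_comp (s := s) a.isOpenEmbedding hbot
      (hsa ▸ finite_primeDivisors hb0)
    have h1 := ncard_codimOneCompl_comp (s := s) a.isOpenEmbedding hbot hfin.1 hfin.2
    have h2 := ncard_codimOneCompl_comp (s := s) j.isOpenEmbedding hη hj hfin.2
    have h3 : (codimOneCompl W.ι).ncard = (codimOneCompl j).ncard + (codimOneCompl s).ncard := by
      rw [← h2, ← hs]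
      rfl
    have h4 : (primeDivisors b).ncard = (codimOneCompl a).ncard + (codimOneCompl s).ncard :=
      (congrArg Set.ncard hsa.symm).trans h1
    exact ⟨s ≫ a, inferInstance, b, hb0, her, by omega⟩
  obtain ⟨e, he, b, hb, hr, h⟩ := key j f rfl hj
  obtain ⟨e', he', b', hb', hr', h'⟩ := key j' g hfg hj'
  obtain ⟨i⟩ := nonempty_ringEquiv_of_range e e' hr hr'
  have := ncard_primeDivisors_eq hB hb hb' i
  omega

end TorusCharts

/-! ### The torus as an open subset of affine space. -/

section Torus

variable {ι : Type} [Fintype ι]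

/-- The cone generated by finitely many lattice points. -/
def genCone (A : Finset (ι → ℤ)) : RationalCone ι where
  carrier := PointedCone.hull ℝ (intVec '' (A : Set (ι → ℤ)))
  fg := ⟨A, rfl⟩

omit [Fintype ι] in
theorem intVec_mem_genCone {A : Finset (ι → ℤ)} {v : ι → ℤ} (hv : v ∈ A) :
    intVec v ∈ (genCone A).carrier := Submodule.subset_span ⟨v, hv, rfl⟩

theorem mem_dualMonoid_genCone {A : Finset (ι → ℤ)} {m : ι → ℤ} :
    m ∈ (genCone A).dualMonoid ↔ ∀ v ∈ A, 0 ≤ v ⬝ᵥ m := by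
  have key : ∀ v : ι → ℤ, 0 ≤ pairing m (intVec v) ↔ 0 ≤ v ⬝ᵥ m := fun v => by
    change 0 ≤ intVec v ⬝ᵥ intVec m ↔ _
    rw [intVec_dotProduct]
    exact Int.cast_nonneg_iff
  constructor
  · intro h v hv
    exact (key v).1 (h _ (intVec_mem_genCone hv))
  · intro h
    refine RationalCone.mem_dualMonoid_of_gen (s := intVec '' (A : Set (ι → ℤ))) rfl ?_
    rintro _ ⟨v, hv, rfl⟩
    exact (key v).2 (h v hv)

/-- The face of a cone cut out by `m` is generated by the generators on which `m` vanishes. -/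
theorem isFaceBy_genCone {A A' : Finset (ι → ℤ)} {m : ι → ℤ} (hm : ∀ v ∈ A, 0 ≤ v ⬝ᵥ m)
    (h : ∀ v, v ∈ A' ↔ v ∈ A ∧ v ⬝ᵥ m = 0) : (genCone A').IsFaceBy (genCone A) m := by
  have key : ∀ v : ι → ℤ, pairing m (intVec v) = ((v ⬝ᵥ m : ℤ) : ℝ) := intVec_dotProduct (b := m)
  refine ⟨mem_dualMonoid_genCone.2 hm, fun x => ?_⟩
  have e : intVec '' (A' : Set (ι → ℤ)) = {y ∈ intVec '' (A : Set (ι → ℤ)) | pairing m y = 0} := by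
    ext y
    constructor
    · rintro ⟨v, hv, rfl⟩
      obtain ⟨h1, h2⟩ := (h v).1 hv
      exact ⟨⟨v, h1, rfl⟩, by rw [key, h2, Int.cast_zero]⟩
    · rintro ⟨⟨v, hv, rfl⟩, h0⟩
      rw [key, Int.cast_eq_zero] at h0
      exact ⟨v, (h v).2 ⟨hv, h0⟩, rfl⟩
  change x ∈ PointedCone.hull ℝ _ ↔ _
  rw [e]
  refine hull_inter_eq_zero ?_ x
  rintro _ ⟨v, hv, rfl⟩
  rw [key]
  exact_mod_cast hm v hv

/-- The ring embeds in the group algebra of ℤ^ι, the ring of Laurent polynomials. -/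
instance (σ : RationalCone ι) : IsDomain σ.Ring :=
  (AddMonoidAlgebra.mapDomain_injective (f := σ.dualMonoid.subtype)
    Subtype.val_injective).isDomain
    (AddMonoidAlgebra.mapDomainRingHom ℂ σ.dualMonoid.subtype)

/-- The zero cone, whose affine toric variety is the torus. -/
def zeroCone (ι : Type) [Fintype ι] : RationalCone ι := genCone ∅

theorem mem_dualMonoid_zeroCone (m : ι → ℤ) : m ∈ (zeroCone ι).dualMonoid :=
  mem_dualMonoid_genCone.2 (by simp)

/-- After clearing denominators `f` comes from some `c` in R, and the image is where both `c` and
`h` are nonzero. -/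
theorem exists_basicOpen_eq_image {R S : Type} [CommRing R] [CommRing S] [Algebra R S] (h : R)
    [IsLocalization.Away h S] (f : S) : ∃ b : R, PrimeSpectrum.comap (algebraMap R S) ''
      (PrimeSpectrum.basicOpen f : Set (PrimeSpectrum S)) =
        (PrimeSpectrum.basicOpen b : Set (PrimeSpectrum R)) := by
  obtain ⟨n, c, hc⟩ := IsLocalization.Away.surj h f
  have hu : IsUnit (algebraMap R S h ^ n) := (IsLocalization.Away.algebraMap_isUnit h).pow n
  have h1 : (PrimeSpectrum.basicOpen f : Set (PrimeSpectrum S)) =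
      PrimeSpectrum.comap (algebraMap R S) ⁻¹'
        (PrimeSpectrum.basicOpen c : Set (PrimeSpectrum R)) := by
    ext p
    change f ∉ p.asIdeal ↔ algebraMap R S c ∉ p.asIdeal
    rw [← hc, Ideal.mul_unit_mem_iff_mem _ hu]
  refine ⟨c * h, ?_⟩
  rw [h1, Set.image_preimage_eq_inter_range, PrimeSpectrum.localization_away_comap_range S h,
    PrimeSpectrum.basicOpen_mul]
  rfl

variable [DecidableEq ι]

/-- The positive orthant, whose affine toric variety is the affine space. -/
def orthant (ι : Type) [Fintype ι] [DecidableEq ι] : RationalCone ι :=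
  genCone (Finset.univ.image fun i : ι => Pi.single i 1)

theorem mem_dualMonoid_orthant {m : ι → ℤ} : m ∈ (orthant ι).dualMonoid ↔ ∀ i, 0 ≤ m i := by
  rw [orthant, mem_dualMonoid_genCone]
  simp

theorem zeroCone_isFaceBy_orthant : (zeroCone ι).IsFaceBy (orthant ι) fun _ => 1 := by
  refine isFaceBy_genCone ?_ ?_
  · simp
  · intro v
    simp only [Finset.notMem_empty, Finset.mem_image, Finset.mem_univ, true_and, false_iff,
      not_and]
    rintro ⟨i, rfl⟩
    simp

/-- The coordinate ring of the affine space is the polynomial ring. -/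
def orthantRingEquiv (ι : Type) [Fintype ι] [DecidableEq ι] :
    (orthant ι).Ring ≃+* MvPolynomial ι ℂ :=
  AddMonoidAlgebra.mapDomainRingEquiv ℂ
    { toFun := fun m => Finsupp.equivFunOnFinite.symm fun i => (m.1 i).toNat
      invFun := fun n => ⟨fun i => n i, mem_dualMonoid_orthant.2 fun _ => Int.natCast_nonneg _⟩
      left_inv := fun m => Subtype.ext (funext fun i => Int.toNat_of_nonneg
        (mem_dualMonoid_orthant.1 m.2 i))
      right_inv := fun _ => Finsupp.ext fun _ => Int.toNat_natCast _
      map_add' := fun m n => Finsupp.ext fun i => Int.toNat_add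
        (mem_dualMonoid_orthant.1 m.2 i) (mem_dualMonoid_orthant.1 n.2 i) }

/-- The units of a polynomial ring over ℂ are the nonzero constants, which have roots of all orders.
-/
theorem exists_units_pow_eq (u : (orthant ι).Ringˣ) {n : ℕ} (hn : 0 < n) :
    ∃ w : (orthant ι).Ringˣ, w ^ n = u := by
  have e := Units.mapEquiv (orthantRingEquiv ι : (orthant ι).Ring ≃* MvPolynomial ι ℂ)
  obtain ⟨r, hr, hu⟩ := MvPolynomial.isUnit_iff_eq_C_of_isReduced.1 (e u).isUnit
  obtain ⟨z, rfl⟩ := IsAlgClosed.exists_pow_nat_eq r hn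
  have hz : IsUnit z := (isUnit_pow_iff hn.ne').1 hr
  refine ⟨e.symm (Units.map (MvPolynomial.C : ℂ →+* MvPolynomial ι ℂ) hz.unit), ?_⟩
  rw [← map_pow, MulEquiv.symm_apply_eq]
  apply Units.ext
  rw [hu, Units.val_pow_eq_pow_val, map_pow]
  rfl

/-- Two open immersions of the torus into an irreducible scheme miss the same number of points of
codimension one. -/
theorem ncard_codimOneCompl_torus {X : Scheme.{0}} {η : X} (hη : IsGenericPt η)
    (j j' : Spec (.of (zeroCone ι).Ring) ⟶ X) [IsOpenImmersion j] [IsOpenImmersion j']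
    (hj : (codimOneCompl j).Finite) (hj' : (codimOneCompl j').Finite) :
    (codimOneCompl j).ncard = (codimOneCompl j').ncard := by
  have hle : zeroCone ι ≤ orthant ι := ⟨_, zeroCone_isFaceBy_orthant⟩
  have h1 : UniqueFactorizationMonoid (orthant ι).Ring :=
    (orthantRingEquiv ι).symm.toMulEquiv.uniqueFactorizationMonoid inferInstance
  have h2 : IsNoetherianRing (orthant ι).Ring :=
    isNoetherianRing_of_ringEquiv _ (orthantRingEquiv ι).symm
  let := (RationalCone.ringMap hle).toRingHom.toAlgebra
  have h3 := (zeroCone_isFaceBy_orthant (ι := ι)).isLocalization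
  let a : Spec (.of (zeroCone ι).Ring) ⟶ Spec (.of (orthant ι).Ring) :=
    (RationalCone.affineMap hle).left
  have h4 : IsOpenImmersion a := inferInstanceAs (IsOpenImmersion (RationalCone.affineMap hle).left)
  exact ncard_codimOneCompl_eq (fun u n hn => exists_units_pow_eq u hn) a
    (fun f => exists_basicOpen_eq_image (AddMonoidAlgebra.single
      (⟨_, zeroCone_isFaceBy_orthant.1⟩ : (orthant ι).dualMonoid) (1 : ℂ)) f) hη j j' hj hj'

end Torus

/-! ### The cones of the spanned fan and their face relation. -/

section ActiveCones

variable {ι : Type} [Fintype ι] {V : Finset (ι → ℤ)}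

open Classical in
/-- The points of `V` in the face cut out by `y`. -/
def active (V : Finset (ι → ℤ)) (y : ι → ℝ) : Finset (ι → ℤ) :=
  V.filter fun v => intVec v ⬝ᵥ y = -1

theorem mem_active {y : ι → ℝ} {v : ι → ℤ} : v ∈ active V y ↔ v ∈ V ∧ intVec v ⬝ᵥ y = -1 := by
  simp [active]

theorem active_zero : active V 0 = ∅ := by
  ext v
  simp [mem_active]

theorem mem_cones_iff (h0 : (0 : ι → ℝ) ∈ interior (convexHull ℝ (intVec '' (V : Set (ι → ℤ)))))
    {σ : RationalCone ι} :
    σ ∈ (spannedFan (convexHull ℝ (intVec '' (V : Set (ι → ℤ))))).cones ↔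
      ∃ y ∈ dual (convexHull ℝ (intVec '' (V : Set (ι → ℤ)))), σ = genCone (active V y) := by
  have e : ∀ y : ι → ℝ, {x ∈ intVec '' (V : Set (ι → ℤ)) | x ⬝ᵥ y = -1} =
      intVec '' (active V y : Set (ι → ℤ)) := by
    intro y
    ext x
    constructor
    · rintro ⟨⟨v, hv, rfl⟩, h⟩
      exact ⟨v, mem_active.2 ⟨hv, h⟩, rfl⟩
    · rintro ⟨v, hv, rfl⟩
      exact ⟨⟨v, (mem_active.1 hv).1, rfl⟩, (mem_active.1 hv).2⟩
  rw [mem_spannedFan_iff (V.finite_toSet.image _) h0]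
  refine exists_congr fun y => and_congr_right fun _ => ?_
  rw [e]
  constructor
  · intro h
    exact RationalCone.ext fun x => by rw [h]; rfl
  · rintro rfl
    rfl

/-- Write `y` as a convex combination of lattice points of the dual; a constraint is tight at `y`
exactly if it is tight at all points of positive weight. This replaces the real `y` by integral
forms. -/
theorem exists_support (hd : dual (convexHull ℝ (intVec '' (V : Set (ι → ℤ)))) ⊆
      convexHull ℝ (dual (convexHull ℝ (intVec '' (V : Set (ι → ℤ)))) ∩ latticePoints ι))
    {y : ι → ℝ} (hy : y ∈ dual (convexHull ℝ (intVec '' (V : Set (ι → ℤ))))) :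
    ∃ T : Finset (ι → ℤ), T.Nonempty ∧ (∀ u ∈ T, ∀ v ∈ V, -1 ≤ v ⬝ᵥ u) ∧
      ∀ v, v ∈ active V y ↔ v ∈ V ∧ ∀ u ∈ T, v ⬝ᵥ u = -1 := by
  classical
  obtain ⟨α, _, w, z, hw0, hw1, hz, hsum⟩ := mem_convexHull_iff_exists_fintype.1 (hd hy)
  choose u hu using fun i => (hz i).2
  have hle : ∀ i, ∀ v ∈ V, -1 ≤ v ⬝ᵥ u i := by
    intro i v hv
    have h := mem_dual_convexHull.1 (hz i).1 (intVec v) ⟨v, hv, rfl⟩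
    rw [← hu, intVec_dotProduct] at h
    exact_mod_cast h
  have hdot : ∀ v, intVec v ⬝ᵥ y = ∑ i, w i * ((v ⬝ᵥ u i : ℤ) : ℝ) := by
    intro v
    rw [← hsum, dotProduct_sum]
    refine Finset.sum_congr rfl fun i _ => ?_
    rw [dotProduct_smul, ← hu, intVec_dotProduct, smul_eq_mul]
  refine ⟨(Finset.univ.filter fun i => 0 < w i).image u, ?_, ?_, fun v => ?_⟩
  · rw [Finset.image_nonempty]
    by_contra h
    rw [Finset.not_nonempty_iff_eq_empty, Finset.filter_eq_empty_iff] at h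
    have : ∑ i, w i = 0 := Finset.sum_eq_zero fun i _ =>
      le_antisymm (not_lt.1 (h (Finset.mem_univ i))) (hw0 i)
    rw [hw1] at this
    exact one_ne_zero this
  · intro x hx
    obtain ⟨i, _, rfl⟩ := Finset.mem_image.1 hx
    exact hle i
  · rw [mem_active]
    refine and_congr_right fun hv => ?_
    have h1 : intVec v ⬝ᵥ y + 1 = ∑ i, w i * (((v ⬝ᵥ u i : ℤ) : ℝ) + 1) := by
      simp_rw [mul_add, mul_one]
      rw [Finset.sum_add_distrib, hw1, hdot]
    have h2 : ∀ i, 0 ≤ w i * (((v ⬝ᵥ u i : ℤ) : ℝ) + 1) := fun i => by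
      have : (-1 : ℝ) ≤ ((v ⬝ᵥ u i : ℤ) : ℝ) := by exact_mod_cast hle i v hv
      exact mul_nonneg (hw0 i) (by linarith)
    rw [← add_eq_zero_iff_eq_neg, h1, Finset.sum_eq_zero_iff_of_nonneg fun i _ => h2 i]
    simp only [Finset.mem_image, Finset.mem_filter, Finset.mem_univ, true_and, forall_const,
      mul_eq_zero]
    constructor
    · rintro h _ ⟨i, hi, rfl⟩
      have := (h i).resolve_left hi.ne'
      have h3 : ((v ⬝ᵥ u i : ℤ) : ℝ) = -1 := by linarith
      exact_mod_cast h3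
    · intro h i
      rcases (hw0 i).eq_or_lt with hi | hi
      · exact Or.inl hi.symm
      · right
        rw [h _ ⟨i, hi, rfl⟩]
        norm_num

/-- In the fan spanned by a polytope whose dual is the convex hull of lattice points, inclusion of
faces gives faces of cones. -/
theorem genCone_active_le (hd : dual (convexHull ℝ (intVec '' (V : Set (ι → ℤ)))) ⊆
      convexHull ℝ (dual (convexHull ℝ (intVec '' (V : Set (ι → ℤ)))) ∩ latticePoints ι))
    {y y' : ι → ℝ} (hy : y ∈ dual (convexHull ℝ (intVec '' (V : Set (ι → ℤ)))))
    (hy' : y' ∈ dual (convexHull ℝ (intVec '' (V : Set (ι → ℤ)))))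
    (h : active V y' ⊆ active V y) : genCone (active V y') ≤ genCone (active V y) := by
  obtain ⟨T, ⟨u, hu⟩, -, hT⟩ := exists_support hd hy
  obtain ⟨T', -, hle, hT'⟩ := exists_support hd hy'
  have key : ∀ v ∈ active V y, v ⬝ᵥ ∑ x ∈ T', (x - u) = ∑ x ∈ T', (v ⬝ᵥ x + 1) := by
    intro v hv
    rw [dotProduct_sum]
    refine Finset.sum_congr rfl fun x _ => ?_
    rw [dotProduct_sub, ((hT v).1 hv).2 u hu, sub_neg_eq_add]
  have hnn : ∀ v ∈ active V y, ∀ x ∈ T', 0 ≤ v ⬝ᵥ x + 1 := fun v hv x hx => by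
    have := hle x hx v ((hT v).1 hv).1
    omega
  -- On the larger face `u` has the constant level -1, so this form is a sum of the nonnegative
  -- terms `v ⬝ᵥ x + 1`; it vanishes exactly if all points of `T'` are tight at `v`.
  refine ⟨∑ x ∈ T', (x - u), isFaceBy_genCone (fun v hv => ?_) fun v => ?_⟩
  · rw [key v hv]
    exact Finset.sum_nonneg (hnn v hv)
  · constructor
    · intro hv
      refine ⟨h hv, ?_⟩
      rw [key v (h hv)]
      refine Finset.sum_eq_zero fun x hx => ?_
      rw [((hT' v).1 hv).2 x hx]
      rfl
    · rintro ⟨hv, hv0⟩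
      rw [key v hv, Finset.sum_eq_zero_iff_of_nonneg (hnn v hv)] at hv0
      exact (hT' v).2 ⟨((hT v).1 hv).1, fun x hx => by have := hv0 x hx; omega⟩

theorem exists_active_eq_singleton
    (h0 : (0 : ι → ℝ) ∈ interior (convexHull ℝ (intVec '' (V : Set (ι → ℤ)))))
    (hV : vertices (convexHull ℝ (intVec '' (V : Set (ι → ℤ)))) = intVec '' (V : Set (ι → ℤ)))
    (hz : (0 : ι → ℤ) ∉ V) {v : ι → ℤ} (hv : v ∈ V) :
    ∃ y ∈ dual (convexHull ℝ (intVec '' (V : Set (ι → ℤ)))), active V y = {v} := by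
  set P := convexHull ℝ (intVec '' (V : Set (ι → ℤ)))
  have hvP : intVec v ∈ vertices P := hV ▸ ⟨v, hv, rfl⟩
  have hface : IsFace P {intVec v} := ⟨isExtreme_singleton.2 hvP, convex_singleton _⟩
  have hne : ({intVec v} : Set (ι → ℝ)) ≠ P := by
    intro h
    have h1 : (0 : ι → ℝ) ∈ ({intVec v} : Set (ι → ℝ)) := h ▸ interior_subset h0
    have h2 : intVec v = intVec (0 : ι → ℤ) := by
      rw [← Set.mem_singleton_iff.1 h1]
      ext
      simp [intVec]
    exact hz (intVec_injective h2 ▸ hv)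
  obtain ⟨y, hy, hF⟩ := hface.exists_dual (V.finite_toSet.image _) h0 hne
  refine ⟨y, hy, ?_⟩
  ext w
  rw [mem_active, Finset.mem_singleton]
  constructor
  · rintro ⟨hw, hwy⟩
    have : intVec w ∈ ({intVec v} : Set (ι → ℝ)) := by
      rw [hF]
      exact ⟨subset_convexHull ℝ _ ⟨w, hw, rfl⟩, hwy⟩
    exact intVec_injective this
  · rintro rfl
    refine ⟨hv, ?_⟩
    have : intVec w ∈ ({intVec w} : Set (ι → ℝ)) := rfl
    rw [hF] at this
    exact this.2

end ActiveCones

/-! ### The prime ideal of the divisor of a ray. -/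

section RayPoint

variable {ι : Type} [Fintype ι] (σ : RationalCone ι) (v : ι → ℤ)
  (hv : ∀ m ∈ σ.dualMonoid, 0 ≤ v ⬝ᵥ m)

/-- The homomorphism that kills the monomials that are positive on `v`. -/
def rayHom : σ.Ring →ₐ[ℂ] AddMonoidAlgebra ℂ (ι → ℤ) :=
  AddMonoidAlgebra.lift ℂ _ _
    { toFun := fun m => if v ⬝ᵥ m.toAdd.1 = 0 then AddMonoidAlgebra.single m.toAdd.1 1 else 0
      map_one' := by
        simp only [toAdd_one, ZeroMemClass.coe_zero, dotProduct_zero, if_true]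
        rfl
      map_mul' := fun m n => by
        have hm := hv m.toAdd.1 m.toAdd.2
        have hn := hv n.toAdd.1 n.toAdd.2
        simp only [toAdd_mul, AddSubmonoid.coe_add, dotProduct_add]
        by_cases h1 : v ⬝ᵥ m.toAdd.1 = 0
        · by_cases h2 : v ⬝ᵥ n.toAdd.1 = 0
          · rw [if_pos h1, if_pos h2, h1, h2, add_zero, if_pos rfl,
              AddMonoidAlgebra.single_mul_single, one_mul]
          · rw [if_neg h2, mul_zero, if_neg (by omega)]
        · rw [if_neg h1, zero_mul, if_neg (by omega)] }

theorem rayHom_single (m : σ.dualMonoid) (c : ℂ) : rayHom σ v hv (AddMonoidAlgebra.single m c) =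
    if v ⬝ᵥ m.1 = 0 then AddMonoidAlgebra.single m.1 c else 0 := by
  rw [rayHom, AddMonoidAlgebra.lift_single]
  change c • (if v ⬝ᵥ m.1 = 0 then _ else _) = _
  split_ifs
  · rw [AddMonoidAlgebra.smul_single, smul_eq_mul, mul_one]
    rfl
  · rw [smul_zero]

/-- The generic point of the divisor of `v`. -/
def rayPoint : PrimeSpectrum σ.Ring := ⟨RingHom.ker (rayHom σ v hv), RingHom.ker_isPrime _⟩

theorem single_mem_rayPoint (m : σ.dualMonoid) :
    AddMonoidAlgebra.single m (1 : ℂ) ∈ (rayPoint σ v hv).asIdeal ↔ v ⬝ᵥ m.1 ≠ 0 := by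
  change rayHom σ v hv _ = 0 ↔ _
  rw [rayHom_single]
  split_ifs with h <;> simp [h]

theorem comap_rayPoint {τ : RationalCone ι} (h : τ ≤ σ) (hτ : ∀ m ∈ τ.dualMonoid, 0 ≤ v ⬝ᵥ m) :
    PrimeSpectrum.comap (RationalCone.ringMap h).toRingHom (rayPoint τ v hτ) =
      rayPoint σ v hv := by
  have e : (rayHom τ v hτ).comp (RationalCone.ringMap h) = rayHom σ v hv := by
    refine AddMonoidAlgebra.algHom_ext (fun m => ?_) (Subsingleton.elim _ _)
    rw [AlgHom.comp_apply, RationalCone.ringMap_single, rayHom_single, rayHom_single]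
  apply PrimeSpectrum.ext
  ext f
  change rayHom τ v hτ (RationalCone.ringMap h f) = 0 ↔ rayHom σ v hv f = 0
  rw [← e, AlgHom.comp_apply]

/-- The ideal is generated by the monomials that are positive on `v`: modulo these every element is
a combination of monomials orthogonal to `v`, and on such combinations `rayHom` is injective. -/
theorem rayPoint_le {I : Ideal σ.Ring}
    (h : ∀ m : σ.dualMonoid, 0 < v ⬝ᵥ m.1 → AddMonoidAlgebra.single m (1 : ℂ) ∈ I) :
    (rayPoint σ v hv).asIdeal ≤ I := by
  let S₀ : AddSubmonoid σ.dualMonoid :=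
    { carrier := {m | v ⬝ᵥ m.1 = 0}
      zero_mem' := by simp
      add_mem' := fun {a b} ha hb => by
        have ha' : v ⬝ᵥ a.1 = 0 := ha
        have hb' : v ⬝ᵥ b.1 = 0 := hb
        change v ⬝ᵥ (a.1 + b.1) = 0
        rw [dotProduct_add, ha', hb', add_zero] }
  let inc : AddMonoidAlgebra ℂ S₀ →ₐ[ℂ] σ.Ring := AddMonoidAlgebra.mapDomainAlgHom ℂ ℂ S₀.subtype
  have hinc : ∀ m c, inc (AddMonoidAlgebra.single m c) = AddMonoidAlgebra.single m.1 c :=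
    fun m c => AddMonoidAlgebra.mapDomain_single
  let J : Ideal σ.Ring := Ideal.span
    {f | ∃ m : σ.dualMonoid, 0 < v ⬝ᵥ m.1 ∧ f = AddMonoidAlgebra.single m (1 : ℂ)}
  have hJI : J ≤ I := by
    refine Ideal.span_le.2 ?_
    rintro _ ⟨m, hm, rfl⟩
    exact h m hm
  have hJker : J ≤ (rayPoint σ v hv).asIdeal := by
    refine Ideal.span_le.2 ?_
    rintro _ ⟨m, hm, rfl⟩
    exact (single_mem_rayPoint σ v hv m).2 hm.ne'
  have hdec : ∀ f : σ.Ring, ∃ g, f - inc g ∈ J := by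
    intro f
    induction f using AddMonoidAlgebra.induction_linear with
    | zero => exact ⟨0, by simp⟩
    | add f g hf hg =>
      obtain ⟨a, ha⟩ := hf
      obtain ⟨b, hb⟩ := hg
      refine ⟨a + b, ?_⟩
      rw [map_add, add_sub_add_comm]
      exact J.add_mem ha hb
    | single m c =>
      rcases (hv m.1 m.2).eq_or_lt with h0 | h0
      · exact ⟨AddMonoidAlgebra.single ⟨m, h0.symm⟩ c, by rw [hinc, sub_self]; exact J.zero_mem⟩
      · refine ⟨0, ?_⟩
        rw [map_zero, sub_zero]
        have : AddMonoidAlgebra.single m c = c • AddMonoidAlgebra.single m (1 : ℂ) := by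
          rw [AddMonoidAlgebra.smul_single, smul_eq_mul, mul_one]
        rw [this]
        exact Submodule.smul_of_tower_mem J c (Submodule.subset_span ⟨m, h0, rfl⟩)
  have hrI : ∀ g, rayHom σ v hv (inc g) =
      AddMonoidAlgebra.mapDomainAlgHom ℂ ℂ (σ.dualMonoid.subtype.comp S₀.subtype) g := by
    intro g
    have e : (rayHom σ v hv).comp inc =
        AddMonoidAlgebra.mapDomainAlgHom ℂ ℂ (σ.dualMonoid.subtype.comp S₀.subtype) := by
      refine AddMonoidAlgebra.algHom_ext (fun m => ?_) (Subsingleton.elim _ _)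
      have hm : v ⬝ᵥ m.1.1 = 0 := m.2
      rw [AlgHom.comp_apply, hinc, rayHom_single, if_pos hm]
      change _ = AddMonoidAlgebra.mapDomain (fun m : S₀ => m.1.1) _
      rw [AddMonoidAlgebra.mapDomain_single]
    rw [← e, AlgHom.comp_apply]
  intro f hf
  obtain ⟨g, hg⟩ := hdec f
  have h1 : rayHom σ v hv (inc g) = 0 := by
    have h2 : rayHom σ v hv (f - inc g) = 0 := hJker hg
    have h3 : rayHom σ v hv f = 0 := hf
    rwa [map_sub, h3, zero_sub, neg_eq_zero] at h2
  rw [hrI] at h1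
  have h4 : g = 0 := AddMonoidAlgebra.mapDomain_injective
    (f := σ.dualMonoid.subtype.comp S₀.subtype)
    (Subtype.val_injective.comp Subtype.val_injective) (h1.trans (map_zero
      (AddMonoidAlgebra.mapDomainAlgHom ℂ ℂ (σ.dualMonoid.subtype.comp S₀.subtype))).symm)
  rw [h4, map_zero, sub_zero] at hg
  exact hJI hg

end RayPoint

/-! ### The points of codimension one outside the torus. -/

section Divisors

variable {ι : Type} [Fintype ι]

/-- A finite set of nonzero lattice points that is the vertex set of a polytope with the origin in
its interior, such that the dual polytope is the convex hull of its lattice points. -/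
structure FanData (V : Finset (ι → ℤ)) : Prop where
  vert : vertices (convexHull ℝ (intVec '' (V : Set (ι → ℤ)))) = intVec '' (V : Set (ι → ℤ))
  zero_mem : (0 : ι → ℝ) ∈ interior (convexHull ℝ (intVec '' (V : Set (ι → ℤ))))
  zero_notMem : (0 : ι → ℤ) ∉ V
  dual_subset : dual (convexHull ℝ (intVec '' (V : Set (ι → ℤ)))) ⊆
    convexHull ℝ (dual (convexHull ℝ (intVec '' (V : Set (ι → ℤ)))) ∩ latticePoints ι)

theorem single_notMem_of_comap_eq {τ σ : RationalCone ι} {m : ι → ℤ} (h : τ.IsFaceBy σ m)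
    {p : PrimeSpectrum τ.Ring} {q : PrimeSpectrum σ.Ring}
    (hpq : PrimeSpectrum.comap (RationalCone.ringMap ⟨m, h⟩).toRingHom p = q) :
    AddMonoidAlgebra.single (⟨m, h.1⟩ : σ.dualMonoid) (1 : ℂ) ∉ q.asIdeal :=
  h.range.subset ⟨p, hpq⟩

theorem dotProduct_nonneg_of_mem {A : Finset (ι → ℤ)} {v : ι → ℤ} (hv : v ∈ A) :
    ∀ m ∈ (genCone A).dualMonoid, 0 ≤ v ⬝ᵥ m := fun _ hm => mem_dualMonoid_genCone.1 hm v hv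

theorem dotProduct_pos_of_isFaceBy {A : Finset (ι → ℤ)} {m : ι → ℤ}
    (hm : (zeroCone ι).IsFaceBy (genCone A) m) {v : ι → ℤ} (hv : v ∈ A) (hv0 : v ≠ 0) :
    0 < v ⬝ᵥ m := by
  refine lt_of_le_of_ne (dotProduct_nonneg_of_mem hv _ hm.1) fun h => hv0 ?_
  have h1 : intVec v ∈ (zeroCone ι).carrier := by
    refine (hm.2 _).2 ⟨intVec_mem_genCone hv, ?_⟩
    change intVec v ⬝ᵥ intVec m = 0
    rw [intVec_dotProduct, ← h, Int.cast_zero]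
  have h2 : (zeroCone ι).carrier = ⊥ := by
    change PointedCone.hull ℝ (intVec '' ((∅ : Finset (ι → ℤ)) : Set (ι → ℤ))) = ⊥
    rw [Finset.coe_empty, Set.image_empty]
    exact Submodule.span_empty
  rw [h2] at h1
  exact intVec_injective (((Submodule.mem_bot _).1 h1).trans (by ext; simp [intVec]))

/-- As `v` takes the value 1 on `m`, the monomial `t` of `m` generates the ideal of the divisor. A
smaller prime ideal without `t` consists of elements divisible by all powers of `t`, so it is 0. -/
theorem rayPoint_mem_codimOne {v m : ι → ℤ} (hm : v ⬝ᵥ m = 1)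
    (hv : ∀ n ∈ (genCone {v}).dualMonoid, 0 ≤ v ⬝ᵥ n) :
    rayPoint (genCone {v}) v hv ∈ codimOne (PrimeSpectrum (genCone {v}).Ring) := by
  set σ : RationalCone ι := genCone {v}
  have hmem : ∀ n : ι → ℤ, 0 ≤ v ⬝ᵥ n → n ∈ σ.dualMonoid := fun n hn =>
    mem_dualMonoid_genCone.2 fun w hw => by rwa [Finset.mem_singleton.1 hw]
  let t : σ.dualMonoid := ⟨m, hmem m (by rw [hm]; exact zero_le_one)⟩
  have hspan : ∀ I : Ideal σ.Ring, AddMonoidAlgebra.single t (1 : ℂ) ∈ I →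
      (rayPoint σ v hv).asIdeal ≤ I := by
    intro I hI
    refine rayPoint_le σ v hv fun n hn => ?_
    have hn' : n.1 - m ∈ σ.dualMonoid := hmem _ (by rw [dotProduct_sub, hm]; omega)
    have e : AddMonoidAlgebra.single n (1 : ℂ) = AddMonoidAlgebra.single t (1 : ℂ) *
        AddMonoidAlgebra.single (⟨_, hn'⟩ : σ.dualMonoid) (1 : ℂ) := by
      rw [AddMonoidAlgebra.single_mul_single, one_mul]
      congr 1
      apply Subtype.ext
      change n.1 = m + (n.1 - m)
      abel
    rw [e]
    exact Ideal.mul_mem_right _ _ hI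
  refine mem_codimOne_primeSpectrum_iff.2 ⟨fun h => ?_, fun q hq => ?_⟩
  · have h1 := (single_mem_rayPoint σ v hv t).2 (by rw [hm]; exact one_ne_zero)
    rw [h, Ideal.mem_bot] at h1
    simp at h1
  by_cases ht : AddMonoidAlgebra.single t (1 : ℂ) ∈ q.asIdeal
  · exact Or.inl (PrimeSpectrum.ext (le_antisymm hq (hspan _ ht)))
  right
  rw [eq_bot_iff]
  intro f hf
  have hpow : ∀ n : ℕ, ∃ g ∈ q.asIdeal, f = AddMonoidAlgebra.single t (1 : ℂ) ^ n * g := by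
    intro n
    induction n with
    | zero => exact ⟨f, hf, by simp⟩
    | succ n ih =>
      obtain ⟨g, hg, rfl⟩ := ih
      obtain ⟨g', rfl⟩ := Ideal.mem_span_singleton.1
        (hspan _ (Ideal.mem_span_singleton_self _) (hq hg))
      exact ⟨g', (q.2.mem_or_mem hg).resolve_left ht, by ring⟩
  rw [Ideal.mem_bot]
  by_contra hf0
  obtain ⟨n, hn⟩ : ∃ n, f.coeff n ≠ 0 := by
    by_contra! h
    exact hf0 (by ext n; exact h n)
  -- All monomials in a multiple of this power have a larger value on `v` than the exponent `n`,
  -- which occurs in `f`.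
  obtain ⟨g, -, hg⟩ := hpow ((v ⬝ᵥ n.1).toNat + 1)
  rw [hg, AddMonoidAlgebra.single_pow] at hn
  refine hn (AddMonoidAlgebra.coeff_single_mul_of_forall_add_ne _ _ fun d hd => ?_)
  have h1 := congrArg (fun x : σ.dualMonoid => v ⬝ᵥ x.1) hd
  have h2 : v ⬝ᵥ (((v ⬝ᵥ n.1).toNat + 1) • m + d.1) = v ⬝ᵥ n.1 := h1
  have h3 := hv d.1 d.2
  have h4 := hv n.1 n.2
  rw [dotProduct_add, dotProduct_smul, hm, nsmul_eq_mul, mul_one] at h2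
  push_cast at h2
  omega

namespace FanData

variable {V : Finset (ι → ℤ)} (hV : FanData V)

include hV

/-- The fan spanned by the polytope. -/
abbrev fan (_ : FanData V) : ConeSystem ι :=
  spannedFan (convexHull ℝ (intVec '' (V : Set (ι → ℤ))))

/-- The cone of the origin. -/
def zero : hV.fan.cones :=
  ⟨zeroCone ι, (mem_cones_iff hV.zero_mem).2 ⟨0, zero_mem_dual _, by rw [active_zero]; rfl⟩⟩

/-- The ray of a vertex. -/
def ray (v : V) : hV.fan.cones :=
  ⟨genCone {v.1}, (mem_cones_iff hV.zero_mem).2 <| by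
    obtain ⟨y, hy, h⟩ := exists_active_eq_singleton hV.zero_mem hV.vert hV.zero_notMem v.2
    exact ⟨y, hy, by rw [h]⟩⟩

theorem zero_le (σ : hV.fan.cones) : hV.zero.1 ≤ σ.1 := by
  obtain ⟨y, hy, hσ⟩ := (mem_cones_iff hV.zero_mem).1 σ.2
  rw [hσ]
  have := genCone_active_le hV.dual_subset hy (zero_mem_dual _)
    (by rw [active_zero]; exact Finset.empty_subset _)
  rwa [active_zero] at this

theorem ray_le {y : ι → ℝ} (hy : y ∈ dual (convexHull ℝ (intVec '' (V : Set (ι → ℤ))))) (v : V)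
    (hv : v.1 ∈ active V y) : (hV.ray v).1 ≤ genCone (active V y) := by
  obtain ⟨z, hz, h⟩ := exists_active_eq_singleton hV.zero_mem hV.vert hV.zero_notMem v.2
  have := genCone_active_le hV.dual_subset hy hz (by rwa [h, Finset.singleton_subset_iff])
  rwa [h] at this

/-- The toric variety of the fan. -/
abbrev toric (hV : FanData V) : Scheme.{0} := (toricVariety hV.fan).left

/-- The generic point of the toric variety. -/
def genericPt : hV.toric := (hV.fan.chart hV.zero).left (⊥ : PrimeSpectrum (zeroCone ι).Ring)

theorem chart_left_comp {σ τ : hV.fan.cones} (h : σ.1 ≤ τ.1) (p : PrimeSpectrum σ.1.Ring) :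
    (hV.fan.chart σ).left p = (hV.fan.chart τ).left
      (PrimeSpectrum.comap (RationalCone.ringMap h).toRingHom p : PrimeSpectrum τ.1.Ring) := by
  rw [← hV.fan.chart_comp h]
  rfl

/-- The zero cone is a face of every cone and the ring maps are injective, so the generic points of
all charts coincide. -/
theorem isGenericPt_genericPt : IsGenericPt hV.genericPt := by
  intro x
  obtain ⟨σ, p, rfl⟩ := hV.fan.exists_chart x
  have h1 : hV.genericPt = (hV.fan.chart σ).left (⊥ : PrimeSpectrum σ.1.Ring) := by
    refine (hV.chart_left_comp (hV.zero_le σ) _).trans (congrArg _ ?_)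
    apply PrimeSpectrum.ext
    exact (RingHom.injective_iff_ker_eq_bot _).1 (RationalCone.ringMap_injective (hV.zero_le σ))
  rw [h1]
  refine Specializes.map ?_ (hV.fan.chart σ).left.continuous
  exact (isGenericPt_primeSpectrum_iff (p := (⊥ : PrimeSpectrum σ.1.Ring))).2 rfl p

theorem mem_codimOne_chart {σ : hV.fan.cones} {p : PrimeSpectrum σ.1.Ring} :
    (hV.fan.chart σ).left p ∈ codimOne hV.toric ↔ p ∈ codimOne (PrimeSpectrum σ.1.Ring) :=
  mem_codimOne_iff (hV.fan.chart σ).left.isOpenEmbedding hV.isGenericPt_genericPt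

/-- The open immersion of the torus. -/
def torus : Spec (.of (zeroCone ι).Ring) ⟶ hV.toric := (hV.fan.chart hV.zero).left

instance : IsOpenImmersion hV.torus :=
  inferInstanceAs (IsOpenImmersion (hV.fan.chart hV.zero).left)

/-- The generic point of the torus-invariant divisor of a vertex. -/
def divisor (v : V) : hV.toric := (hV.fan.chart (hV.ray v)).left
  (rayPoint (genCone {v.1}) v.1 (dotProduct_nonneg_of_mem (Finset.mem_singleton_self v.1)))

/-- Outside the torus, `p` contains the monomial of the form `m₀` that cuts out the zero cone. This
forces `p` to contain all monomials positive on some ray generator `v`, hence the ideal of the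
divisor of `v`; codimension one gives equality. -/
theorem mem_range_divisor {x : hV.toric} (hx : x ∈ codimOneCompl hV.torus) :
    x ∈ Set.range hV.divisor := by
  classical
  obtain ⟨hx1, hx2⟩ := hx
  obtain ⟨⟨σ, hσC⟩, p, rfl⟩ := hV.fan.exists_chart x
  obtain ⟨y, hy, rfl⟩ := (mem_cones_iff hV.zero_mem).1 hσC
  set A := active V y with hA
  have hp := hV.mem_codimOne_chart.1 hx1
  obtain ⟨m₀, hm₀⟩ := hV.zero_le ⟨genCone A, hσC⟩
  have hm₀p : AddMonoidAlgebra.single (⟨m₀, hm₀.1⟩ : (genCone A).dualMonoid) (1 : ℂ) ∈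
      (p : PrimeSpectrum (genCone A).Ring).asIdeal := by
    by_contra h
    obtain ⟨z, hz⟩ := hm₀.range.superset h
    refine hx2 ⟨z, ?_⟩
    refine (hV.chart_left_comp (σ := hV.zero) (τ := ⟨genCone A, hσC⟩) ⟨m₀, hm₀⟩ z).trans ?_
    exact congrArg _ hz
  have hpos : ∀ v ∈ A, 0 < v ⬝ᵥ m₀ :=
    fun v hv => dotProduct_pos_of_isFaceBy hm₀ hv
      fun h => hV.zero_notMem (h ▸ (mem_active.1 hv).1)
  obtain ⟨v, hv, hvp⟩ : ∃ v ∈ A, ∀ m : (genCone A).dualMonoid, 0 < v ⬝ᵥ m.1 →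
      AddMonoidAlgebra.single m (1 : ℂ) ∈ (p : PrimeSpectrum (genCone A).Ring).asIdeal := by
    -- Otherwise the product of one monomial outside `p` for each generator is outside `p`, and its
    -- exponent `M` is positive on all generators.
    by_contra! hcon
    choose m hm hmp using fun v : A => hcon v.1 v.2
    let M : (genCone A).dualMonoid := ∑ v, m v
    have hM : AddMonoidAlgebra.single M (1 : ℂ) ∉
        (p : PrimeSpectrum (genCone A).Ring).asIdeal := by
      have h1 : AddMonoidAlgebra.single M (1 : ℂ) = ∏ v, AddMonoidAlgebra.single (m v) (1 : ℂ) := by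
        have := map_prod (AddMonoidAlgebra.of ℂ (genCone A).dualMonoid)
          (fun v => Multiplicative.ofAdd (m v)) Finset.univ
        rw [← ofAdd_sum] at this
        exact this
      rw [h1, (p : PrimeSpectrum (genCone A).Ring).2.prod_mem_iff]
      rintro ⟨v, -, h⟩
      exact hmp v h
    have hMpos : ∀ v ∈ A, 1 ≤ v ⬝ᵥ M.1 := by
      intro v hv
      have h1 : v ⬝ᵥ M.1 = ∑ w, v ⬝ᵥ (m w).1 := by
        rw [← dotProduct_sum]
        congr 1
        exact AddSubmonoid.coe_finsetSum _ _ _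
      rw [h1]
      have h2 := Finset.single_le_sum (f := fun w => v ⬝ᵥ (m w).1)
        (fun w _ => dotProduct_nonneg_of_mem hv _ (m w).2) (Finset.mem_univ ⟨v, hv⟩)
      have h3 := hm ⟨v, hv⟩
      exact le_trans h3 h2
    -- The number `k` dominates `m₀` on every generator, so the monomial of `m₀` divides the `k`-th
    -- power of that of `M`.
    let k : ℕ := ∑ v ∈ A, (v ⬝ᵥ m₀).toNat
    have hk : k • M.1 - m₀ ∈ (genCone A).dualMonoid := by
      refine mem_dualMonoid_genCone.2 fun v hv => ?_
      have h1 : (v ⬝ᵥ m₀).toNat ≤ k :=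
        Finset.single_le_sum (f := fun v => (v ⬝ᵥ m₀).toNat) (fun _ _ => Nat.zero_le _) hv
      have h2 : v ⬝ᵥ m₀ ≤ k := by omega
      have h3 : (k : ℤ) * 1 ≤ k * (v ⬝ᵥ M.1) :=
        mul_le_mul_of_nonneg_left (hMpos v hv) (Int.natCast_nonneg k)
      rw [dotProduct_sub, dotProduct_smul, nsmul_eq_mul]
      linarith
    have h4 : AddMonoidAlgebra.single M (1 : ℂ) ^ k =
        AddMonoidAlgebra.single (⟨m₀, hm₀.1⟩ : (genCone A).dualMonoid) (1 : ℂ) *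
          AddMonoidAlgebra.single (⟨_, hk⟩ : (genCone A).dualMonoid) (1 : ℂ) := by
      rw [AddMonoidAlgebra.single_pow, AddMonoidAlgebra.single_mul_single, one_pow, one_mul]
      congr 1
      apply Subtype.ext
      change k • M.1 = m₀ + (k • M.1 - m₀)
      abel
    refine hM ((p : PrimeSpectrum (genCone A).Ring).2.mem_of_pow_mem k ?_)
    rw [h4]
    exact Ideal.mul_mem_right _ _ hm₀p
  have hle := rayPoint_le (genCone A) v (dotProduct_nonneg_of_mem hv) hvp
  refine ⟨⟨v, (mem_active.1 hv).1⟩, ?_⟩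
  have heq : rayPoint (genCone A) v (dotProduct_nonneg_of_mem hv) = p := by
    refine ((mem_codimOne_primeSpectrum_iff.1 hp).2 _ hle).resolve_right fun h => ?_
    have h1 := (single_mem_rayPoint (genCone A) v (dotProduct_nonneg_of_mem hv) ⟨m₀, hm₀.1⟩).2
      (hpos v hv).ne'
    rw [h, Ideal.mem_bot] at h1
    simp at h1
  have hr := hV.ray_le hy ⟨v, (mem_active.1 hv).1⟩ hv
  refine (hV.chart_left_comp (τ := ⟨genCone A, hσC⟩) hr _).trans (congrArg _ ?_)
  exact (comap_rayPoint (genCone A) v (dotProduct_nonneg_of_mem hv) hr _).trans heq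

theorem finite_codimOneCompl : (codimOneCompl hV.torus).Finite :=
  (Set.finite_range hV.divisor).subset fun _ => hV.mem_range_divisor

theorem ncard_codimOneCompl_le : (codimOneCompl hV.torus).ncard ≤ V.card := by
  refine (Set.ncard_le_ncard (fun _ => hV.mem_range_divisor) (Set.finite_range _)).trans ?_
  rw [← Set.image_univ]
  refine (Set.ncard_image_le Set.finite_univ).trans ?_
  rw [Set.ncard_univ, Nat.card_eq_fintype_card, Fintype.card_coe]

theorem divisor_mem (v : V) {m : ι → ℤ} (hm : v.1 ⬝ᵥ m = 1) :
    hV.divisor v ∈ codimOneCompl hV.torus := by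
  refine ⟨hV.mem_codimOne_chart.2 (rayPoint_mem_codimOne hm _), ?_⟩
  rintro ⟨z, hz⟩
  have hz' : (hV.fan.chart hV.zero).left z = hV.divisor v := hz
  obtain ⟨n, hn⟩ := hV.zero_le (hV.ray v)
  have h1 := hV.chart_left_comp (σ := hV.zero) (τ := hV.ray v) ⟨n, hn⟩ z
  have h2 := single_notMem_of_comap_eq hn
    ((hV.fan.chart (hV.ray v)).left.isOpenEmbedding.injective (h1.symm.trans hz'))
  refine h2 ((single_mem_rayPoint _ _ _ _).2 (ne_of_gt ?_))
  exact dotProduct_pos_of_isFaceBy hn (Finset.mem_singleton_self v.1)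
    fun h => hV.zero_notMem (h ▸ v.2)

/-- If two divisors agree, their rays have a common face containing both generators, which are then
nonnegative multiples of each other. Since each is an exposed vertex, both factors are less than 1,
but their product is 1. -/
theorem divisor_injective : Function.Injective hV.divisor := by
  intro v w hvw
  obtain ⟨ρ, h1, h2, z, hz1, hz2⟩ := hV.fan.exists_of_chart_eq hvw
  have key : ∀ (v : V) (h : ρ.1 ≤ (hV.ray v).1),
      (RationalCone.affineMap h).left z = (rayPoint (genCone {v.1}) v.1
        (dotProduct_nonneg_of_mem (Finset.mem_singleton_self v.1)) : PrimeSpectrum (genCone {v.1}).Ring) →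
        intVec v.1 ∈ ρ.1.carrier := by
    rintro v ⟨n, hn⟩ hz
    have h3 : v.1 ⬝ᵥ n = 0 := not_not.1 fun h =>
      single_notMem_of_comap_eq hn hz ((single_mem_rayPoint _ _ _ _).2 h)
    refine (hn.2 _).2 ⟨intVec_mem_genCone (Finset.mem_singleton_self v.1), ?_⟩
    change intVec v.1 ⬝ᵥ intVec n = 0
    rw [intVec_dotProduct, h3, Int.cast_zero]
  have hv := key v h1 hz1
  have hw := key w h2 hz2
  have hsub : ∀ (v : V) (h : ρ.1 ≤ (hV.ray v).1) (x), x ∈ ρ.1.carrier →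
      ∃ c : ℝ, 0 ≤ c ∧ x = c • intVec v.1 := by
    rintro v ⟨n, hn⟩ x hx
    have h3 : x ∈ PointedCone.hull ℝ (intVec '' (({v.1} : Finset (ι → ℤ)) : Set (ι → ℤ))) :=
      ((hn.2 x).1 hx).1
    rw [Finset.coe_singleton, Set.image_singleton] at h3
    obtain ⟨c, rfl⟩ := Submodule.mem_span_singleton.1 h3
    exact ⟨c, c.2, rfl⟩
  obtain ⟨c, hc, hcw⟩ := hsub v h1 _ hw
  obtain ⟨b, hb, hbv⟩ := hsub w h2 _ hv
  by_contra hne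
  have hlt : ∀ v w : V, v ≠ w → ∀ c : ℝ, intVec w.1 = c • intVec v.1 → c < 1 := by
    intro v w hne c h
    obtain ⟨y, hy, hyv⟩ := exists_active_eq_singleton hV.zero_mem hV.vert hV.zero_notMem v.2
    have h3 : intVec v.1 ⬝ᵥ y = -1 := (mem_active.1 (hyv ▸ Finset.mem_singleton_self v.1)).2
    have h4 : -1 ≤ intVec w.1 ⬝ᵥ y := mem_dual_convexHull.1 hy _ ⟨w.1, w.2, rfl⟩
    have h5 : intVec w.1 ⬝ᵥ y ≠ -1 := fun h5 => by
      have : w.1 ∈ active V y := mem_active.2 ⟨w.2, h5⟩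
      rw [hyv, Finset.mem_singleton] at this
      exact hne (Subtype.ext this.symm)
    have h6 : intVec w.1 ⬝ᵥ y = -c := by rw [h, smul_dotProduct, h3, smul_eq_mul, mul_neg_one]
    have := lt_of_le_of_ne h4 h5.symm
    linarith
  have hc1 := hlt v w hne c hcw
  have hb1 := hlt w v (Ne.symm hne) b hbv
  have h7 : (1 - b * c) • intVec v.1 = 0 := by
    rw [sub_smul, one_smul, mul_smul, ← hcw, ← hbv, sub_self]
  rcases smul_eq_zero.1 h7 with h | h
  · nlinarith
  · have : v.1 = 0 := intVec_injective (h.trans (by ext; simp [intVec]))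
    exact hV.zero_notMem (this ▸ v.2)

theorem card_le_ncard_codimOneCompl (h : ∀ v ∈ V, ∃ m : ι → ℤ, v ⬝ᵥ m = 1) :
    V.card ≤ (codimOneCompl hV.torus).ncard := by
  have h1 : Set.range hV.divisor ⊆ codimOneCompl hV.torus := by
    rintro _ ⟨v, rfl⟩
    obtain ⟨m, hm⟩ := h v.1 v.2
    exact hV.divisor_mem v hm
  refine le_trans ?_ (Set.ncard_le_ncard h1 hV.finite_codimOneCompl)
  rw [← Set.image_univ, Set.ncard_image_of_injective _ hV.divisor_injective, Set.ncard_univ,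
    Nat.card_eq_fintype_card, Fintype.card_coe]

end FanData

end Divisors

/-! ### The number of rays as an invariant, and the final comparison. -/

section Comparison

theorem codimOneCompl_comp_surjective {X Y Z : Type} [TopologicalSpace Z] {s : X → Y}
    {c : Y → Z} (hs : Function.Surjective s) : codimOneCompl (c ∘ s) = codimOneCompl c := by
  rw [codimOneCompl, codimOneCompl, hs.range_comp]

/-- Reindexing the coordinates of the torus. -/
def zeroConeRingEquiv {ι κ : Type} [Fintype ι] [Fintype κ] (e : ι ≃ κ) :
    (zeroCone κ).Ring ≃+* (zeroCone ι).Ring :=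
  AddMonoidAlgebra.mapDomainRingEquiv ℂ
    { toFun := fun m => ⟨m.1 ∘ e, mem_dualMonoid_zeroCone _⟩
      invFun := fun m => ⟨m.1 ∘ e.symm, mem_dualMonoid_zeroCone _⟩
      left_inv := fun m => Subtype.ext (funext fun i => congrArg m.1 (e.apply_symm_apply i))
      right_inv := fun m => Subtype.ext (funext fun i => congrArg m.1 (e.symm_apply_apply i))
      map_add' := fun _ _ => rfl }

/-- Isomorphic toric varieties have the same number of torus-invariant prime divisors. -/
theorem FanData.card_le_of_iso {ι κ : Type} [Fintype ι] [Fintype κ] (e : ι ≃ κ)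
    {V : Finset (ι → ℤ)} {W : Finset (κ → ℤ)} (hV : FanData V) (hW : FanData W)
    (hprim : ∀ w ∈ W, ∃ m : κ → ℤ, w ⬝ᵥ m = 1)
    (i : toricVariety hW.fan ≅ toricVariety hV.fan) : W.card ≤ V.card := by
  classical
  let g : hW.toric ⟶ hV.toric := ((Over.forget SpecC).mapIso i).hom
  have hg : IsIso g := ((Over.forget SpecC).mapIso i).isIso_hom
  let t : Spec (.of (zeroCone ι).Ring) ⟶ Spec (.of (zeroCone κ).Ring) :=
    Spec.map (zeroConeRingEquiv e).toCommRingCatIso.hom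
  have ht : IsIso t := inferInstance
  have hts : Function.Surjective t := (Scheme.homeoOfIso (asIso t)).surjective
  have hgs : Function.Surjective g := (Scheme.homeoOfIso (asIso g)).surjective
  -- The torus of the first variety, carried over by the isomorphism, is a second embedding of the
  -- same torus. It need not agree with the given one, but it misses as many points of codimension
  -- one.
  have h1 : codimOneCompl (t ≫ hW.torus ≫ g) = g '' codimOneCompl hW.torus := by
    have h2 : codimOneCompl (t ≫ hW.torus ≫ g) = codimOneCompl (g ∘ hW.torus) :=
      codimOneCompl_comp_surjective (s := t) (c := g ∘ hW.torus) hts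
    rw [h2, codimOneCompl_comp g.isOpenEmbedding hV.isGenericPt_genericPt, codimOneCompl,
      hgs.range_eq, Set.sdiff_univ, Set.empty_union]
  have h3 : (codimOneCompl (t ≫ hW.torus ≫ g)).Finite :=
    h1 ▸ hW.finite_codimOneCompl.image g
  have h4 := ncard_codimOneCompl_torus hV.isGenericPt_genericPt hV.torus (t ≫ hW.torus ≫ g)
    hV.finite_codimOneCompl h3
  rw [h1, Set.ncard_image_of_injective _ g.isOpenEmbedding.injective] at h4
  exact (hW.card_le_ncard_codimOneCompl hprim).trans (h4.ge.trans hV.ncard_codimOneCompl_le)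

theorem SimplicialData.fanData {ι : Type} [Fintype ι] {V U : Finset (ι → ℤ)}
    (h : SimplicialData V U) : FanData V where
  vert := h.vert
  zero_mem := h.zero_mem
  zero_notMem := h.zero_notMem
  dual_subset := by
    have : intVec '' (U : Set (ι → ℤ)) ⊆
        dual (convexHull ℝ (intVec '' (V : Set (ι → ℤ)))) ∩ latticePoints ι := by
      rintro _ ⟨u, hu, rfl⟩
      refine ⟨?_, u, rfl⟩
      rw [h.dual_eq]
      exact subset_convexHull ℝ _ ⟨u, hu, rfl⟩
    exact h.dual_eq.subset.trans (convexHull_mono this)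

theorem fanData_hexagonSum {k : ℕ} (hk : k ≠ 0) :
    FanData (finite_freeSum (k := k) hexagon).toFinset where
  vert := by
    rw [Set.Finite.coe_toFinset]
    exact vertices_freeSum hexagon_exposed
  zero_mem := by
    rw [Set.Finite.coe_toFinset]
    exact zero_mem_interior_hexagonSum hk
  zero_notMem := by
    rw [Set.Finite.mem_toFinset]
    rintro ⟨i, m, hm, h⟩
    refine zero_notMem_hexagon (?_ : (0 : Fin 2 → ℤ) ∈ hexagon)
    have : m = 0 := by
      ext j
      have := congrFun h (i, j)
      simpa [embed] using this.symm
    exact this ▸ hm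
  dual_subset := by
    rw [Set.Finite.coe_toFinset]
    exact dual_freeSum_subset dual_hexagon_subset

theorem exists_dotProduct_eq_one_hexagon : ∀ m ∈ hexagon, ∃ n ∈ hexagon, m ⬝ᵥ n = 1 := by
  decide

theorem exists_dotProduct_eq_one {k : ℕ} {v : Fin k × Fin 2 → ℤ}
    (hv : v ∈ (finite_freeSum (k := k) hexagon).toFinset) : ∃ m, v ⬝ᵥ m = 1 := by
  rw [Set.Finite.mem_toFinset] at hv
  obtain ⟨i, m, hm, rfl⟩ := hv
  obtain ⟨n, -, hn⟩ := exists_dotProduct_eq_one_hexagon m hm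
  refine ⟨embed i n, ?_⟩
  rw [embed_dotProduct, ← hn]
  congr 1
  ext j
  simp [embed]

/-- A simplicial reflexive polytope whose toric variety is a power of `S₃` has at least `3d`
vertices. -/
theorem SimplicialData.le_card_of_iso {ι : Type} [Fintype ι] {V U : Finset (ι → ℤ)}
    (h : SimplicialData V U) {k : ℕ} (hk : k ≠ 0) (hc : 2 * k = Fintype.card ι)
    (i : toricVariety (spannedFan (convexHull ℝ (intVec '' (V : Set (ι → ℤ))))) ≅ S3pow k) :
    6 * k ≤ V.card := by
  have hrefl : LatticeIso (hexagonSum k) (hexagonSum k) :=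
    ⟨.refl ℤ _, .refl ℝ _, fun _ => rfl, Set.image_id _⟩
  obtain ⟨j⟩ := hrefl.nonempty_iso_S3pow (zero_mem_interior_hexagonSum hk)
  have he : Fintype.card ι = Fintype.card (Fin k × Fin 2) := by
    rw [← hc, Fintype.card_prod, Fintype.card_fin, Fintype.card_fin, mul_comm]
  have hW := fanData_hexagonSum hk
  have hj : Nonempty (toricVariety hW.fan ≅ S3pow k) := by
    have e : hW.fan = spannedFan (hexagonSum k) := by
      rw [FanData.fan, Set.Finite.coe_toFinset]
      rfl
    rw [e]
    exact ⟨j⟩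
  obtain ⟨j⟩ := hj
  -- Only the hexagon sum must have generators taking the value 1; there all divisors are known to
  -- occur, while for `V` the upper bound is enough.
  have h1 := FanData.card_le_of_iso (Fintype.equivOfCardEq he) h.fanData hW
    (fun w hw => exists_dotProduct_eq_one hw) (j ≪≫ i.symm)
  rwa [← Set.ncard_eq_toFinset_card _ (finite_freeSum hexagon), ncard_freeSum zero_notMem_hexagon,
    card_hexagon, mul_comm] at h1

end Comparison

end ToricFano

end

theorem theorem5p5 (d : ℕ) (P : Set (Fin d → ℝ))
    (hP : ToricFano.IsReflexive P) (hs : ToricFano.IsSimplicial P)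
    (hu : ∃ u ∈ ToricFano.vertices (ToricFano.dual P), -u ∈ ToricFano.dual P) :
    (Even d →
      (ToricFano.vertices P).ncard ≤ 3 * d ∧
      ((ToricFano.vertices P).ncard = 3 * d ↔
        ToricFano.LatticeIso (ToricFano.dual P) (ToricFano.Z2pow (d / 2))) ∧
      ((ToricFano.vertices P).ncard = 3 * d ↔
        Nonempty (ToricFano.toricVariety (ToricFano.spannedFan P) ≅ ToricFano.S3pow (d / 2)))) ∧
    (Odd d → (ToricFano.vertices P).ncard ≤ 3 * d - 1) := by
  have hd : d ≠ 0 := by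
    rintro rfl
    exact hP.1.nonempty_index.elim Fin.elim0
  obtain ⟨V, U, hVU, rfl⟩ := hP.exists_simplicialData hs
  set P := convexHull ℝ (ToricFano.intVec '' (V : Set (Fin d → ℤ)))
  have hcard : (ToricFano.vertices P).ncard = V.card := by
    rw [hVU.vert, ToricFano.intVec_injective.injOn.ncard_image, Set.ncard_coe_finset]
  have hle : V.card ≤ 3 * d := by
    have := hVU.card_le
    rwa [Fintype.card_fin] at this
  -- Evenness is part of the conclusion: this excludes 3d vertices in odd dimension and also gives
  -- both forward implications in even dimension.
  have heq : V.card = 3 * d → Even d ∧ ToricFano.LatticeIso P (ToricFano.hexagonSum (d / 2)) := by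
    intro h
    obtain ⟨k, hk, hiso⟩ := hVU.latticeIso (by rw [h, Fintype.card_fin])
    rw [Fintype.card_fin] at hk
    have hk' : d / 2 = k := by omega
    rw [hk']
    exact ⟨⟨k, by omega⟩, hiso⟩
  rw [hcard]
  refine ⟨fun hev => ?_, fun hodd => ?_⟩
  · have hk : d / 2 ≠ 0 := by
      obtain ⟨r, hr⟩ := hev
      omega
    have h2k : 2 * (d / 2) = d := Nat.two_mul_div_two_of_even hev
    refine ⟨hle, ?_, fun h => ?_, fun ⟨i⟩ => ?_⟩
    · rw [ToricFano.latticeIso_hexagonSum_iff (convex_convexHull ℝ _)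
        ((V.finite_toSet.image _).isClosed_convexHull ℝ) (interior_subset hVU.zero_mem) hk]
      refine ⟨fun h => (heq h).2, fun h => ?_⟩
      have := h.ncard_vertices
      rw [hcard, ToricFano.ncard_vertices_hexagonSum] at this
      omega
    · exact (heq h).2.nonempty_iso_S3pow hVU.zero_mem
    · have := hVU.le_card_of_iso hk (by rw [Fintype.card_fin, h2k]) i
      omega
  · have : V.card ≠ 3 * d := fun h => (Nat.not_even_iff_odd.2 hodd) (heq h).1
    omega
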